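/- Let $(R,\mu)$ be a finite probability space and let $P_r(z)=\sum_{k\ge1}p_{kr}z^k$ ($r\in R$) be polynomials with $p_{kr}\ge0$, $P_r(1)=1$, $P_r(z)\ne z$, all with the same mean $E=P_r'(1)$. Put $q_j=\int_R p_{1r}^j\,\mu(dr)$ and assume $q_1>0$. Let $X_0=1$, $X_{t+1}=\sum_{i=1}^{X_t}\xi_{it}$ be the Galton–Watson process in the i.i.d. random environment $(r_t)$ with law $\mu$: given the environment, the $\xi_{it}$ are independent, and $\xi_{it}$ has generating function $P_{r_t}$. Let $W=\lim_{t\to\infty}E^{-t}X_t$ be the martingale limit, and $$\Pi(z)=\lim_{t\to\infty}\int_R\cdots\int_R P_{r_1}\circ\cdots\circ P_{r_t}\Bigl(1-\frac z{E^t}\Bigr)\mu(dr_t)\cdots\mu(dr_1),\qquad p(x)=\frac1{2\pi}\int_{-\infty}^{+\infty}\Pi(iy)e^{iyx}\,dy .$$ For $j\ge1$ put $$\varphi_{nj}=\lim_{t\to\infty}\frac{\mathbb P(X_t=n\mid X_0=j)}{\mathbb P(X_t=j\mid X_0=j)},\qquad \Phi_j(z)=\sum_{n\ge j}\varphi_{nj}z^n,\qquad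 b_1=1,\quad b_n=-\sum_{m=1}^{n-1}\varphi_{nm}b_m,$$ $$K_j(z)=\lim_{t\to\infty}\int_R\cdots\int_R\Phi_j\Bigl(P_{r_t}\circ\cdots\circ P_{r_1}\Bigl(1-\frac z{E^t}\Bigr)\Bigr)\mu(dr_1)\cdots\mu(dr_t),\qquad \operatorname{Re}z>0,$$ and let $L_{nj}=\int_0^1 q_j^{-x}K_j(E^x)e^{-2\pi inx}\,dx$, $n\in\mathbb Z$, be the Fourier coefficients of the function $q_j^{-x}K_j(E^x)$ of real $x$. Assume: (a) the common critical angle of the family is greater than $\pi$. That is, for some $\theta>\pi$ and $\varepsilon>0$, whenever $0<|u|<\varepsilon$ and $|\arg u|<\theta/2$, we have $P_{r_t}\circ\cdots\circ P_{r_1}(1-u)\to0$ as $t\to\infty$ for every sequence $(r_t)$ in $R$; (b) the pseudo-inverse series $z=\sum_{j\ge1}b_j\Phi_j(z)$ converges in some disk $|z|<\rho$, $\rho>0$. Then: 1. All the limits above exist: $E^{-t}X_t\to W$ almost surely, $\varphi_{nj}$ exists for all $n$ and all $j\ge1$, $\Pi(z)$ exists for all $z\in\mathbb C$, and $K_j(z)$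 exists for $\operatorname{Re}z>0$. Each $\Phi_j$ converges for $|z|<1$. 2. For all $x>0$ and $\varepsilon\ge0$, $$p(x)=\lim_{T\to\infty}\frac1{2\pi}\int_{-T}^{T}\Pi(\varepsilon+iy)e^{(\varepsilon+iy)x}\,dy .$$ Moreover $p\ge0$ on $(0,\infty)$, and $W$ has the law $p(x)\,dx$ on $(0,\infty)$. 3. For $j\ge1$ and $\operatorname{Re}z>0$, $$K_j(Ez)=q_jK_j(z),\qquad K_j(z)=\sum_{n\in\mathbb Z}L_{nj}z^{\frac{2\pi in+\ln q_j}{\ln E}},$$ and for every real $x$ the series $$A_j(x)=\sum_{n\in\mathbb Z}\frac{L_{nj}e^{2\pi inx}}{\Gamma\bigl(-\frac{2\pi in+\ln q_j}{\ln E}\bigr)}$$ converges absolutely and defines a one-periodic function. 4. For every $x>0$, $$p(x)=\sum_{j=1}^{\infty}b_j\,x^{-1-\log_Eq_j}A_j(-\log_Ex),$$ where the series converges absolutely. -/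

import Mathlib

open MeasureTheory Filter Topology

noncomputable section

namespace GWRE

section Population

variable {R Ω : Type*} [MeasurableSpace R] [MeasurableSpace Ω]

/-- `env t` is the environment at time `t` and `ξ i t` the number of offspring of the `i`-th
individual living at time `t`.  The environments are independent with law `μ`; given the
environments, all `ξ i t` are independent, and `ξ i t = k` has probability
`(P (env t)).coeff k`.  This is expressed by the finite-dimensional distributions. -/
structure IsOffspringFamily (μ : Measure R) (P : R → Polynomial ℝ) (ℙ : Measure Ω)
    (env : ℕ → Ω → R) (ξ : ℕ → ℕ → Ω → ℕ) : Prop where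
  measurable_env : ∀ t, Measurable (env t)
  measurable_offspring : ∀ i t, Measurable (ξ i t)
  law : ∀ (T N : ℕ) (e : ℕ → R) (k : ℕ → ℕ → ℕ),
    ℙ.real {ω | ∀ t < T, env t ω = e t ∧ ∀ i < N, ξ i t ω = k i t} =
      ∏ t ∈ Finset.range T,
        (μ.real {e t} * ∏ i ∈ Finset.range N, (P (e t)).coeff (k i t))

/-- The size at time `t` of the population started from `j` individuals. -/
def population (ξ : ℕ → ℕ → Ω → ℕ) (j : ℕ) : ℕ → Ω → ℕ
  | 0, _ => j
  | t + 1, ω => ∑ i ∈ Finset.range (population ξ j t ω), ξ i t ω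

/-- The martingale limit `lim E⁻ᵗ X_t` of the process with `X_0 = 1`. -/
def martingaleLimit (E : ℝ) (ξ : ℕ → ℕ → Ω → ℕ) (ω : Ω) : ℝ :=
  limUnder atTop fun t : ℕ => (population ξ 1 t ω : ℝ) / E ^ t

/-- The ratio of probabilities of the events `X_t = n` and `X_t = j` for the process with
`X_0 = j`. -/
def rareRatio (ℙ : Measure Ω) (ξ : ℕ → ℕ → Ω → ℕ) (n j t : ℕ) : ℝ :=
  ℙ.real {ω | population ξ j t ω = n} / ℙ.real {ω | population ξ j t ω = j}

/-- `φ_{nj}`, the limit ratio of probabilities of rare events. -/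
def phi (ℙ : Measure Ω) (ξ : ℕ → ℕ → Ω → ℕ) (n j : ℕ) : ℝ :=
  limUnder atTop (rareRatio ℙ ξ n j)

/-- `Φ_j(z) = ∑_{n ≥ j} φ_{nj} zⁿ`. -/
def Phi (ℙ : Measure Ω) (ξ : ℕ → ℕ → Ω → ℕ) (j : ℕ) (z : ℂ) : ℂ :=
  ∑' n : ℕ, (phi ℙ ξ (j + n) j : ℂ) * z ^ (j + n)

/-- The coefficients `b_j` of the pseudo-inverse series `z = ∑_{j ≥ 1} b_j Φ_j(z)`:
`b_1 = 1` and `b_n = -∑_{m=1}^{n-1} φ_{nm} b_m` (the value at index `0` is never used). -/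
def bCoeff (ℙ : Measure Ω) (ξ : ℕ → ℕ → Ω → ℕ) : ℕ → ℝ
  | 0 => 0
  | 1 => 1
  | n + 2 => -∑ m : Fin (n + 1), phi ℙ ξ (n + 2) (m + 1) * bCoeff ℙ ξ (m + 1)

end Population

section Analytic

variable {R : Type*}

/-- The value of the real polynomial `P r` at a complex point. -/
def gen (P : R → Polynomial ℝ) (r : R) (z : ℂ) : ℂ := Polynomial.aeval z (P r)

/-- The orbit of `z` under the polynomials chosen by `e`:
`P_{e (t-1)} ∘ ⋯ ∘ P_{e 0} (z)`. -/
def orbit (P : R → Polynomial ℝ) (e : ℕ → R) (z : ℂ) : ℕ → ℂ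
  | 0 => z
  | t + 1 => gen P (e t) (orbit P e z t)

/-- The common domain of attraction of `0`: all sequences of the polynomials drive the point
to `0`.  It is open, it contains the open unit disk, and a sector at `1` that opens to the left
lies in it as soon as it lies in the common filled Julia set. -/
def basin (P : R → Polynomial ℝ) : Set ℂ :=
  {z | ∀ e : ℕ → R, Tendsto (orbit P e z) atTop (𝓝 0)}

/-- The critical angle at `1`: the supremum of the openings `θ` of the sectors with vertex `1`,
symmetric about the real axis and containing the points just to the left of `1`, whose part near
`1` lies in the common domain of attraction of `0`. -/
def criticalAngle (P : R → Polynomial ℝ) : ℝ :=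
  sSup {θ : ℝ | 0 < θ ∧ θ ≤ 2 * Real.pi ∧ ∃ ε > 0, ∀ u : ℂ,
    0 < ‖u‖ → ‖u‖ < ε → |u.arg| < θ / 2 → 1 - u ∈ basin P}

variable [MeasurableSpace R]

/-- The iterated integral `∫ ⋯ ∫ f (P_{r_1} ∘ ⋯ ∘ P_{r_t} (z)) μ(dr_1) ⋯ μ(dr_t)`. -/
def annealed (μ : Measure R) (P : R → Polynomial ℝ) (f : ℂ → ℂ) : ℕ → ℂ → ℂ
  | 0, z => f z
  | t + 1, z => ∫ r, annealed μ P f t (gen P r z) ∂μ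

/-- `Π(z) = lim ∫ ⋯ ∫ P_{r_1} ∘ ⋯ ∘ P_{r_t} (1 - z / Eᵗ) μ(dr_t) ⋯ μ(dr_1)`. -/
def PiFun (μ : Measure R) (P : R → Polynomial ℝ) (E : ℝ) (z : ℂ) : ℂ :=
  limUnder atTop fun t : ℕ => annealed μ P id t (1 - z / (E : ℂ) ^ t)

/-- `(1 / 2π) ∫_{-T}^{T} Π(ε + iy) e^{(ε + iy) x} dy`. -/
def inversionIntegral (μ : Measure R) (P : R → Polynomial ℝ) (E ε x T : ℝ) : ℂ :=
  (1 / (2 * (Real.pi : ℂ))) *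
    ∫ y in (-T)..T, PiFun μ P E (ε + y * Complex.I) * Complex.exp ((ε + y * Complex.I) * x)

/-- `p(x) = (1 / 2π) ∫_{-∞}^{∞} Π(iy) e^{iyx} dy`, as an improper integral. -/
def density (μ : Measure R) (P : R → Polynomial ℝ) (E x : ℝ) : ℝ :=
  (limUnder atTop fun T : ℝ => inversionIntegral μ P E 0 x T).re

/-- `q_j = ∫ p_{1r}^j μ(dr)`. -/
def q (μ : Measure R) (P : R → Polynomial ℝ) (j : ℕ) : ℝ := ∫ r, (P r).coeff 1 ^ j ∂μ

/-- The exponent `(2πin + ln q_j) / ln E`. -/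
def expo (μ : Measure R) (P : R → Polynomial ℝ) (E : ℝ) (j : ℕ) (n : ℤ) : ℂ :=
  (2 * Real.pi * Complex.I * n + Real.log (q μ P j)) / Real.log E

variable {Ω : Type*} [MeasurableSpace Ω]

/-- The approximations `∫ ⋯ ∫ Φ_j (P_{r_t} ∘ ⋯ ∘ P_{r_1} (1 - z / Eᵗ)) μ(dr_1) ⋯ μ(dr_t)` of
`K_j(z)`. -/
def KApprox (μ : Measure R) (P : R → Polynomial ℝ) (E : ℝ) (ℙ : Measure Ω)
    (ξ : ℕ → ℕ → Ω → ℕ) (j : ℕ) (z : ℂ) (t : ℕ) : ℂ :=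
  annealed μ P (Phi ℙ ξ j) t (1 - z / (E : ℂ) ^ t)

/-- The multiplicatively periodic function `K_j`. -/
def K (μ : Measure R) (P : R → Polynomial ℝ) (E : ℝ) (ℙ : Measure Ω)
    (ξ : ℕ → ℕ → Ω → ℕ) (j : ℕ) (z : ℂ) : ℂ :=
  limUnder atTop (KApprox μ P E ℙ ξ j z)

/-- `L_j(x) = q_j^{-x} K_j(E^x)` for real `x`. -/
def L (μ : Measure R) (P : R → Polynomial ℝ) (E : ℝ) (ℙ : Measure Ω)
    (ξ : ℕ → ℕ → Ω → ℕ) (j : ℕ) (x : ℝ) : ℂ :=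
  ((q μ P j ^ (-x) : ℝ) : ℂ) * K μ P E ℙ ξ j ((E ^ x : ℝ) : ℂ)

/-- The Fourier coefficient `L_{nj} = ∫_0^1 L_j(x) e^{-2πinx} dx`. -/
def LCoeff (μ : Measure R) (P : R → Polynomial ℝ) (E : ℝ) (ℙ : Measure Ω)
    (ξ : ℕ → ℕ → Ω → ℕ) (n : ℤ) (j : ℕ) : ℂ :=
  ∫ x in (0 : ℝ)..1, L μ P E ℙ ξ j x * Complex.exp (-(2 * Real.pi * Complex.I * n * x))

/-- The `n`-th term `L_{nj} e^{2πinx} / Γ(-(2πin + ln q_j) / ln E)` of the series of `A_j(x)`. -/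
def ATerm (μ : Measure R) (P : R → Polynomial ℝ) (E : ℝ) (ℙ : Measure Ω)
    (ξ : ℕ → ℕ → Ω → ℕ) (j : ℕ) (x : ℝ) (n : ℤ) : ℂ :=
  LCoeff μ P E ℙ ξ n j * Complex.exp (2 * Real.pi * Complex.I * n * x) /
    Complex.Gamma (-expo μ P E j n)

/-- The one-periodic function `A_j`. -/
def A (μ : Measure R) (P : R → Polynomial ℝ) (E : ℝ) (ℙ : Measure Ω)
    (ξ : ℕ → ℕ → Ω → ℕ) (j : ℕ) (x : ℝ) : ℂ :=
  ∑' n : ℤ, ATerm μ P E ℙ ξ j x n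

end Analytic

end GWRE

end

/-!
The density of `W` is obtained by inverting its Laplace transform `Π`, after moving the line of
integration to two rays that point to the left, where `Π` can be expanded.

* **Rare events.**  Averaging over the environment turns `P(X_t = n | X_0 = j)` into the
  coefficients of the polynomials `genPoly μ P j t`, the iterates of a triangular linear recursion
  whose `j`-th diagonal entry is `q_j`.  Since the `q_j` decrease strictly, the ratios converge
  (`exists_tendsto_ratio`), and the limits give a function `Φ_j` on the unit disk with the averaged
  Schröder equation `∫ Φ_j ∘ P_r μ(dr) = q_j Φ_j` (`IsOffspringFamily.annealed_Phi`).
* **Critical angle.**  A critical angle greater than `π` means that for some `ψ > π / 2` all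
  compositions of the polynomials drive the points `1 - u`, `|arg u| < ψ`, `u` small, to `0`.  By
  compactness the attraction is uniform, so that for `w` in a slightly smaller sector and `|w|`
  large the points `1 - w / Eᵗ` are near `0` after `t` steps, uniformly over the environments
  (`exists_reaches_sector`).  There `Φ_j` and the pseudo-inverse series are available, and passing
  to the limit gives `K_j(E w) = q_j K_j(w)` and `Π(w) = ∑ b_j K_j(w)` with a uniform summable
  majorant (`IsOffspringFamily.exists_sector_expansion`); in particular `Π` vanishes at infinity there.
* **Fourier series.**  In the variable `log_E w` the function `q_j^{-x} K_j(Eˣ)` is periodic and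
  holomorphic on a half-strip of width more than `π / ln E`.  Shifting the segment of integration
  shows that its Fourier coefficients decay fast enough for the expansion of `K_j` to converge with
  a majorant on all smaller sectors (`exists_multiplicative_expansion`).
* **Inversion.**  As `Π` is entire and vanishes at infinity in the sector, the integral of
  `Π(z) e^{zx}` over any vertical line `Re z = ε` equals its integral over two rays in the
  directions `±φ`, `φ > π / 2` (`tendsto_vertical`), on which `e^{zx}` decays exponentially.  There
  both expansions may be integrated term by term, and Hankel's formula
  `(1 / 2πi) ∫ zᵅ e^{zx} dz = x^{-1-α} / Γ(-α)` (`loopIntegral_cpow_mul`) produces the series of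
  `A_j` and of the density (`IsOffspringFamily.exists_loop_expansion`).
* **Law of the limit.**  The martingale is bounded in `L²`, and `Π(z) = E e^{-zW}` for `Re z ≥ 0`.
  Parseval's identity and the locally uniform bound `exists_norm_vertical_le` of the inversion
  integrals give `E g(W) = ∫ g p` for bump functions `g` on `(0, ∞)`, while `Π(λ) → 0` excludes an
  atom at `0` (`IsOffspringFamily.law_martingaleLimit`).
-/

set_option linter.unusedSectionVars false

namespace GWRE

/-! ### The offspring laws -/

/-- The standing assumptions on the offspring generating functions `P r`. -/
structure OffspringLaws {R : Type*} [MeasurableSpace R] (μ : Measure R) (P : R → Polynomial ℝ)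
    (E : ℝ) : Prop where
  nonneg : ∀ r k, 0 ≤ (P r).coeff k
  eval_one : ∀ r, (P r).eval 1 = 1
  coeff_zero : ∀ r, (P r).coeff 0 = 0
  ne_X : ∀ r, P r ≠ Polynomial.X
  mean : ∀ r, (Polynomial.derivative (P r)).eval 1 = E
  q_pos : 0 < q μ P 1

section Basic

variable {R : Type*} [Fintype R] [MeasurableSpace R] [MeasurableSingletonClass R]
  {μ : Measure R} [IsProbabilityMeasure μ] {P : R → Polynomial ℝ} {E : ℝ}

lemma sum_measureReal_singleton (μ : Measure R) [IsProbabilityMeasure μ] :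
    ∑ r, μ.real {r} = 1 := by
  have := integral_fintype (μ := μ) (f := fun _ : R => (1 : ℝ)) (Integrable.of_finite)
  rw [integral_const, probReal_univ, one_smul] at this
  rw [this]
  exact Finset.sum_congr rfl fun r _ => by rw [smul_eq_mul, mul_one]

lemma OffspringLaws.sum_coeff (h : OffspringLaws μ P E) (r : R) {N : ℕ}
    (hN : (P r).natDegree < N) : ∑ k ∈ Finset.range N, (P r).coeff k = 1 := by
  have := h.eval_one r
  rw [Polynomial.eval_eq_sum_range' hN] at this
  simpa using this

lemma OffspringLaws.coeff_one_le_one (h : OffspringLaws μ P E) (r : R) : (P r).coeff 1 ≤ 1 := by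
  rw [← h.sum_coeff r (N := (P r).natDegree + 2) (by omega)]
  exact Finset.single_le_sum (f := fun k => (P r).coeff k) (fun k _ => h.nonneg r k) (by simp)

lemma OffspringLaws.coeff_one_lt_one (h : OffspringLaws μ P E) (r : R) : (P r).coeff 1 < 1 := by
  refine lt_of_le_of_ne (h.coeff_one_le_one r) fun h1 => h.ne_X r ?_
  ext k
  rw [Polynomial.coeff_X]
  split_ifs with hk
  · rw [← hk, h1]
  · have hs := h.sum_coeff r (N := (P r).natDegree + 2 + k) (by omega)
    have : ∑ i ∈ ({1, k} : Finset ℕ), (P r).coeff i ≤ 1 := by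
      rw [← hs]
      refine Finset.sum_le_sum_of_subset_of_nonneg ?_ (fun i _ _ => h.nonneg r i)
      intro i hi
      simp only [Finset.mem_insert, Finset.mem_singleton] at hi
      simp only [Finset.mem_range]
      omega
    rw [Finset.sum_pair hk, h1] at this
    linarith [h.nonneg r k]

lemma OffspringLaws.one_lt (h : OffspringLaws μ P E) : 1 < E := by
  have hne : Nonempty R := by
    by_contra hR
    rw [not_nonempty_iff] at hR
    have := sum_measureReal_singleton μ
    simp at this
  obtain ⟨r⟩ := hne
  have hm := h.mean r
  have hs := h.sum_coeff r (N := (P r).natDegree + 1) (by omega)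
  rw [Polynomial.derivative_eval, Polynomial.sum_over_range' _ (by simp) _ (Nat.lt_succ_self _)]
    at hm
  simp only [one_pow, mul_one] at hm
  have hp : ∀ k ∈ Finset.range ((P r).natDegree + 1),
      (P r).coeff k ≤ (P r).coeff k * k := by
    intro k _
    rcases Nat.eq_zero_or_pos k with rfl | hk
    · simp [h.coeff_zero]
    · have : (1 : ℝ) ≤ k := by exact_mod_cast hk
      nlinarith [h.nonneg r k]
  rw [← hs, ← hm]
  refine lt_of_le_of_ne (Finset.sum_le_sum hp) fun he => ?_
  rw [Finset.sum_eq_sum_iff_of_le hp] at he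
  have hz : ∀ k, k ≠ 1 → (P r).coeff k = 0 := by
    intro k hk
    by_cases hkd : k ∈ Finset.range ((P r).natDegree + 1)
    · have := he k hkd
      have h1 : (k : ℝ) - 1 ≠ 0 := by
        rw [sub_ne_zero]; exact_mod_cast hk
      have : (P r).coeff k * ((k : ℝ) - 1) = 0 := by linarith
      exact (mul_eq_zero.1 this).resolve_right h1
    · exact Polynomial.coeff_eq_zero_of_natDegree_lt (by simpa [Nat.lt_succ_iff] using hkd)
  have hs2 := h.sum_coeff r (N := (P r).natDegree + 2) (by omega)
  rw [Finset.sum_eq_single_of_mem 1 (by simp) (fun k _ hk => hz k hk)] at hs2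
  exact (h.coeff_one_lt_one r).ne hs2

lemma q_eq_sum (μ : Measure R) [IsProbabilityMeasure μ] (P : R → Polynomial ℝ) (j : ℕ) :
    q μ P j = ∑ r, μ.real {r} * (P r).coeff 1 ^ j := by
  rw [q, integral_fintype (Integrable.of_finite)]
  rfl

lemma OffspringLaws.exists_charged (h : OffspringLaws μ P E) :
    ∃ r, 0 < μ.real {r} ∧ 0 < (P r).coeff 1 := by
  by_contra! hc
  have := h.q_pos
  rw [q_eq_sum] at this
  refine absurd this (not_lt.2 (Finset.sum_nonpos fun r _ => ?_))
  rcases (measureReal_nonneg (μ := μ) (s := {r})).eq_or_lt with h0 | h0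
  · simp [← h0]
  · simpa using mul_nonpos_of_nonneg_of_nonpos h0.le (hc r h0)

lemma OffspringLaws.q_pos' (h : OffspringLaws μ P E) (j : ℕ) : 0 < q μ P j := by
  obtain ⟨r, h1, h2⟩ := h.exists_charged
  rw [q_eq_sum]
  exact Finset.sum_pos' (fun i _ => mul_nonneg measureReal_nonneg (pow_nonneg (h.nonneg _ _) _))
    ⟨r, Finset.mem_univ _, by positivity⟩

lemma OffspringLaws.q_succ_lt (h : OffspringLaws μ P E) (j : ℕ) :
    q μ P (j + 1) < q μ P j := by
  obtain ⟨r, h1, h2⟩ := h.exists_charged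
  rw [q_eq_sum, q_eq_sum]
  refine Finset.sum_lt_sum (fun i _ => ?_) ⟨r, Finset.mem_univ _, ?_⟩
  · exact mul_le_mul_of_nonneg_left (pow_le_pow_of_le_one (h.nonneg _ _) (h.coeff_one_le_one i)
      (Nat.le_succ j)) measureReal_nonneg
  · exact mul_lt_mul_of_pos_left (pow_lt_pow_right_of_lt_one₀ h2 (h.coeff_one_lt_one r)
      (Nat.lt_succ_self j)) h1

lemma OffspringLaws.q_lt_one (h : OffspringLaws μ P E) {j : ℕ} (hj : 1 ≤ j) : q μ P j < 1 := by
  induction j, hj using Nat.le_induction with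
  | base =>
    have := h.q_succ_lt 0
    simpa [q_eq_sum μ P 0, sum_measureReal_singleton μ] using this
  | succ j _ ih => exact (h.q_succ_lt j).trans ih

/-! ### The offspring generating functions near `0` and near `1` -/

/-- By convexity the generating function lies below its chord after division by `x`. -/
lemma OffspringLaws.eval_le (h : OffspringLaws μ P E) (r : R) {x : ℝ} (h0 : 0 ≤ x) (h1 : x ≤ 1) :
    (P r).eval x ≤ x * ((P r).coeff 1 + (1 - (P r).coeff 1) * x) := by
  have hs := h.sum_coeff r (N := (P r).natDegree + 2) (by omega)
  rw [Polynomial.eval_eq_sum_range' (n := (P r).natDegree + 2) (by omega)]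
  have : ∀ k ∈ Finset.range ((P r).natDegree + 2), (P r).coeff k * x ^ k ≤
      (P r).coeff k * x ^ 2 + if k = 1 then (P r).coeff 1 * (x - x ^ 2) else 0 := by
    intro k _
    split_ifs with hk
    · subst hk; apply le_of_eq; ring
    · rcases Nat.eq_zero_or_pos k with rfl | hk'
      · simp [h.coeff_zero]
      · rw [add_zero]
        exact mul_le_mul_of_nonneg_left (pow_le_pow_of_le_one h0 h1 (by omega)) (h.nonneg r k)
  refine (Finset.sum_le_sum this).trans (le_of_eq ?_)
  rw [Finset.sum_add_distrib, ← Finset.sum_mul, hs, Finset.sum_ite_eq']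
  simp only [Finset.mem_range]
  rw [if_pos (by omega)]
  ring

lemma OffspringLaws.eval_nonneg (h : OffspringLaws μ P E) (r : R) {x : ℝ} (h0 : 0 ≤ x) :
    0 ≤ (P r).eval x := by
  rw [Polynomial.eval_eq_sum_range]
  exact Finset.sum_nonneg fun k _ => mul_nonneg (h.nonneg r k) (by positivity)

lemma OffspringLaws.eval_le_self (h : OffspringLaws μ P E) (r : R) {x : ℝ} (h0 : 0 ≤ x)
    (h1 : x ≤ 1) : (P r).eval x ≤ x := by
  refine (h.eval_le r h0 h1).trans ?_
  have : (P r).coeff 1 + (1 - (P r).coeff 1) * x ≤ 1 := by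
    nlinarith [h.coeff_one_le_one r]
  nlinarith

lemma OffspringLaws.norm_gen_le (h : OffspringLaws μ P E) (r : R) (z : ℂ) :
    ‖gen P r z‖ ≤ (P r).eval ‖z‖ := by
  rw [gen, Polynomial.aeval_eq_sum_range, Polynomial.eval_eq_sum_range]
  refine (norm_sum_le _ _).trans (Finset.sum_le_sum fun k _ => ?_)
  rw [norm_smul, norm_pow, Real.norm_of_nonneg (h.nonneg r k)]

lemma OffspringLaws.norm_gen_le_self (h : OffspringLaws μ P E) (r : R) {z : ℂ} (hz : ‖z‖ ≤ 1) :
    ‖gen P r z‖ ≤ ‖z‖ :=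
  (h.norm_gen_le r z).trans (h.eval_le_self r (norm_nonneg _) hz)

lemma continuous_gen (P : R → Polynomial ℝ) (r : R) : Continuous (gen P r) :=
  (P r).continuous_aeval

lemma differentiable_gen (P : R → Polynomial ℝ) (r : R) : Differentiable ℂ (gen P r) :=
  (P r).differentiable_aeval

lemma orbit_succ' (P : R → Polynomial ℝ) (e : ℕ → R) (z : ℂ) (t : ℕ) :
    orbit P e z (t + 1) = orbit P (fun s => e (s + 1)) (gen P (e 0) z) t := by
  induction t with
  | zero => rfl
  | succ t ih => rw [orbit, ih]; rfl

lemma orbit_add (P : R → Polynomial ℝ) (e : ℕ → R) (z : ℂ) (s t : ℕ) :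
    orbit P e z (s + t) = orbit P (fun i => e (s + i)) (orbit P e z s) t := by
  induction t with
  | zero => rfl
  | succ t ih => rw [← add_assoc, orbit, ih]; rfl

lemma OffspringLaws.norm_orbit_le (h : OffspringLaws μ P E) (e : ℕ → R) {z : ℂ} (hz : ‖z‖ ≤ 1)
    (t : ℕ) : ‖orbit P e z t‖ ≤ ‖z‖ := by
  induction t with
  | zero => rfl
  | succ t ih => exact (h.norm_gen_le_self _ (ih.trans hz)).trans ih

/-- The second order Taylor estimate of the generating functions at the fixed point `1`. -/
lemma OffspringLaws.exists_taylor (h : OffspringLaws μ P E) :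
    ∃ C > 0, ∀ r, ∀ u : ℂ, ‖u‖ ≤ 1 → ‖1 - gen P r (1 - u) - E * u‖ ≤ C * ‖u‖ ^ 2 := by
  have key : ∀ r, ∃ C, ∀ u : ℂ, ‖u‖ ≤ 1 → ‖1 - gen P r (1 - u) - E * u‖ ≤ C * ‖u‖ ^ 2 := by
    intro r
    set p : Polynomial ℂ := (P r).map (algebraMap ℝ ℂ) with hp
    have hgen : ∀ z, gen P r z = p.eval z := fun z => by
      rw [gen, hp, Polynomial.eval_map_algebraMap]
    set Q : Polynomial ℂ := 1 - p.comp (1 - Polynomial.X) - Polynomial.C (E : ℂ) * Polynomial.X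
      with hQ
    have e1 : p.eval 1 = 1 := by
      have := congrArg (algebraMap ℝ ℂ) (h.eval_one r)
      rw [hp, Polynomial.eval_map_algebraMap, ← Complex.ofReal_one,
        ← Complex.coe_algebraMap, Polynomial.aeval_algebraMap_apply]
      simpa using this
    have e2 : (Polynomial.derivative p).eval 1 = E := by
      have := congrArg (algebraMap ℝ ℂ) (h.mean r)
      rw [hp, Polynomial.derivative_map, Polynomial.eval_map_algebraMap, ← Complex.ofReal_one,
        ← Complex.coe_algebraMap, Polynomial.aeval_algebraMap_apply]
      simpa using this
    have c0 : Q.coeff 0 = 0 := by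
      rw [Polynomial.coeff_zero_eq_eval_zero, hQ]
      simp [Polynomial.eval_comp, e1]
    have c1 : Q.coeff 1 = 0 := by
      have : (Polynomial.derivative Q).coeff 0 = 0 := by
        rw [Polynomial.coeff_zero_eq_eval_zero, hQ]
        simp [Polynomial.eval_comp, Polynomial.derivative_comp, e2]
      rw [Polynomial.coeff_derivative] at this
      simpa using this
    obtain ⟨S, hS⟩ : Polynomial.X ^ 2 ∣ Q := by
      rw [Polynomial.X_pow_dvd_iff]
      intro d hd
      interval_cases d
      · exact c0
      · exact c1
    obtain ⟨C, hC⟩ := (isCompact_closedBall (0 : ℂ) 1).exists_bound_of_continuousOn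
      (f := fun u => S.eval u) S.continuous.continuousOn
    refine ⟨C, fun u hu => ?_⟩
    have : 1 - gen P r (1 - u) - E * u = u ^ 2 * S.eval u := by
      have := congrArg (Polynomial.eval u) hS
      rw [hQ] at this
      simpa [Polynomial.eval_comp, hgen] using this
    rw [this, norm_mul, norm_pow, mul_comm]
    gcongr
    exact hC u (by simpa using hu)
  choose C hC using key
  refine ⟨1 + ∑ r, |C r|, by positivity, fun r u hu => (hC r u hu).trans ?_⟩
  gcongr
  have := Finset.single_le_sum (f := fun r => |C r|) (fun i _ => abs_nonneg _) (Finset.mem_univ r)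
  exact (le_abs_self _).trans (by simpa using this.trans (by linarith))

/-- Along every orbit that starts close to the repelling fixed point `1`, the distance vector to
`1` is multiplied by `E` in each step, up to a relative error of the order of its final size. -/
lemma OffspringLaws.exists_linearization (h : OffspringLaws μ P E) :
    ∃ c > 0, ∀ (e : ℕ → R) (u : ℂ) (k : ℕ), E ^ k * ‖u‖ * c ≤ 1 →
      ‖1 - orbit P e (1 - u) k - E ^ k * u‖ ≤ c * (E ^ k * ‖u‖) ^ 2 := by
  obtain ⟨C, hC0, hC⟩ := h.exists_taylor
  have hE := h.one_lt
  have hE0 : 0 < E := by linarith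
  have hE1 : 0 < E * (E - 1) := mul_pos hE0 (by linarith)
  -- the constant reproduces itself under `v ↦ E v` since `E c + 4 C ≤ E ^ 2 c`
  set c : ℝ := max 2 (4 * C / (E * (E - 1))) with hc
  have hc2 : 2 ≤ c := le_max_left _ _
  have hcC : 4 * C ≤ c * (E * (E - 1)) := by
    rw [← div_le_iff₀ hE1]; exact le_max_right _ _
  refine ⟨c, by linarith, fun e u k => ?_⟩
  induction k with
  | zero =>
    intro _
    simp only [orbit, pow_zero, one_mul, sub_sub_cancel, sub_self, norm_zero]
    positivity
  | succ k ih =>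
    intro hk
    have hv0 : 0 ≤ E ^ k * ‖u‖ := by positivity
    have hk' : E ^ k * ‖u‖ * c ≤ 1 := by
      refine le_trans ?_ hk
      rw [pow_succ]
      have : E ^ k * ‖u‖ * c * 1 ≤ E ^ k * ‖u‖ * c * E := by gcongr
      linarith
    have ih' := ih hk'
    set v := E ^ k * ‖u‖ with hv
    set y := 1 - orbit P e (1 - u) k with hy
    have hvn : ‖(E : ℂ) ^ k * u‖ = v := by
      rw [norm_mul, norm_pow, Complex.norm_real, Real.norm_of_nonneg hE0.le]
    have hyn : ‖y‖ ≤ 2 * v := by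
      have : ‖y‖ ≤ ‖y - E ^ k * u‖ + ‖(E : ℂ) ^ k * u‖ := by
        simpa using norm_add_le (y - E ^ k * u) (E ^ k * u)
      rw [hvn] at this
      nlinarith
    have hy1 : ‖y‖ ≤ 1 := by nlinarith
    have ht := hC (e k) y hy1
    have hgy : gen P (e k) (1 - y) = orbit P e (1 - u) (k + 1) := by
      rw [hy, sub_sub_cancel]; rfl
    rw [hgy] at ht
    have : 1 - orbit P e (1 - u) (k + 1) - E ^ (k + 1) * u =
        (1 - orbit P e (1 - u) (k + 1) - E * y) + E * (y - E ^ k * u) := by ring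
    rw [this]
    refine (norm_add_le _ _).trans ?_
    rw [norm_mul, Complex.norm_real, Real.norm_of_nonneg hE0.le]
    have e1 : C * ‖y‖ ^ 2 ≤ 4 * C * v ^ 2 := by
      have : ‖y‖ ^ 2 ≤ (2 * v) ^ 2 := by gcongr
      nlinarith
    have e2 : E * ‖y - E ^ k * u‖ ≤ E * (c * v ^ 2) := by gcongr
    have e3 : E ^ (k + 1) * ‖u‖ = E * v := by rw [hv]; ring
    rw [e3]
    nlinarith [mul_le_mul_of_nonneg_right hcC (sq_nonneg v)]

end Basic

/-! ### Averaging over the environment -/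

section Annealed

variable {R : Type*} [Fintype R] [MeasurableSpace R] [MeasurableSingletonClass R]
  {μ : Measure R} [IsProbabilityMeasure μ] {P : R → Polynomial ℝ} {E : ℝ}

lemma annealed_succ (μ : Measure R) [IsProbabilityMeasure μ] (P : R → Polynomial ℝ) (f : ℂ → ℂ)
    (t : ℕ) (z : ℂ) :
    annealed μ P f (t + 1) z = ∑ r, (μ.real {r} : ℂ) * annealed μ P f t (gen P r z) := by
  rw [annealed, integral_fintype (Integrable.of_finite)]
  simp [Complex.real_smul]

/-- All points reached from `z` after `t` steps lie in `S`. -/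
def Reaches (P : R → Polynomial ℝ) (S : Set ℂ) (t : ℕ) (z : ℂ) : Prop :=
  ∀ e : ℕ → R, orbit P e z t ∈ S

lemma reaches_succ {S : Set ℂ} {t : ℕ} {z : ℂ} :
    Reaches P S (t + 1) z ↔ ∀ r, Reaches P S t (gen P r z) := by
  constructor
  · intro h r e
    have := h (fun s => Nat.casesOn s r e)
    rwa [orbit_succ'] at this
  · intro h e
    rw [orbit_succ']
    exact h _ _

lemma reaches_zero [Nonempty R] {S : Set ℂ} {z : ℂ} : Reaches P S 0 z ↔ z ∈ S :=
  ⟨fun h => h (fun _ => Classical.arbitrary R), fun h _ => h⟩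

lemma nonempty_of_measure (μ : Measure R) [IsProbabilityMeasure μ] : Nonempty R :=
  (inferInstance : NeZero μ).out |> fun h => by
    by_contra hR
    rw [not_nonempty_iff] at hR
    exact h (Measure.eq_zero_of_isEmpty μ)

lemma annealed_congr (μ : Measure R) [IsProbabilityMeasure μ] {f g : ℂ → ℂ} {S : Set ℂ}
    (hfg : Set.EqOn f g S) {t : ℕ} : ∀ {z : ℂ}, Reaches P S t z →
    annealed μ P f t z = annealed μ P g t z := by
  have := nonempty_of_measure μ
  induction t with
  | zero => intro z hz; exact hfg (reaches_zero.1 hz)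
  | succ t ih =>
    intro z hz
    rw [annealed_succ, annealed_succ]
    exact Finset.sum_congr rfl fun r _ => by rw [ih (reaches_succ.1 hz r)]

lemma norm_annealed_le (μ : Measure R) [IsProbabilityMeasure μ] {f : ℂ → ℂ} {S : Set ℂ} {B : ℝ}
    (hf : ∀ z ∈ S, ‖f z‖ ≤ B) {t : ℕ} : ∀ {z : ℂ}, Reaches P S t z →
    ‖annealed μ P f t z‖ ≤ B := by
  have := nonempty_of_measure μ
  induction t with
  | zero => intro z hz; exact hf _ (reaches_zero.1 hz)
  | succ t ih =>
    intro z hz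
    rw [annealed_succ]
    calc _ ≤ ∑ r, μ.real {r} * B := by
          refine (norm_sum_le _ _).trans (Finset.sum_le_sum fun r _ => ?_)
          rw [norm_mul, Complex.norm_real, Real.norm_of_nonneg measureReal_nonneg]
          exact mul_le_mul_of_nonneg_left (ih (reaches_succ.1 hz r)) measureReal_nonneg
      _ = B := by rw [← Finset.sum_mul, sum_measureReal_singleton, one_mul]

lemma hasSum_annealed (μ : Measure R) [IsProbabilityMeasure μ] {ι : Type*} {F : ι → ℂ → ℂ}
    {f : ℂ → ℂ} {S : Set ℂ} (hf : ∀ z ∈ S, HasSum (fun i => F i z) (f z)) {t : ℕ} :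
    ∀ {z : ℂ}, Reaches P S t z →
    HasSum (fun i => annealed μ P (F i) t z) (annealed μ P f t z) := by
  have := nonempty_of_measure μ
  induction t with
  | zero => intro z hz; exact hf _ (reaches_zero.1 hz)
  | succ t ih =>
    intro z hz
    simp only [annealed_succ]
    exact hasSum_sum fun r _ => (ih (reaches_succ.1 hz r)).mul_left _

lemma differentiableAt_annealed (μ : Measure R) [IsProbabilityMeasure μ] {f : ℂ → ℂ} {S : Set ℂ}
    (hf : ∀ z ∈ S, DifferentiableAt ℂ f z) {t : ℕ} : ∀ {z : ℂ}, Reaches P S t z →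
    DifferentiableAt ℂ (annealed μ P f t) z := by
  have := nonempty_of_measure μ
  induction t with
  | zero => intro z hz; exact hf _ (reaches_zero.1 hz)
  | succ t ih =>
    intro z hz
    have : annealed μ P f (t + 1) = fun z => ∑ r, (μ.real {r} : ℂ) * annealed μ P f t (gen P r z) :=
      funext fun z => annealed_succ μ P f t z
    rw [this]
    refine DifferentiableAt.fun_sum fun r _ => DifferentiableAt.const_mul ?_ _
    exact (ih (reaches_succ.1 hz r)).comp z (differentiable_gen P r z)

lemma annealed_mul_left (μ : Measure R) [IsProbabilityMeasure μ] (c : ℂ) (f : ℂ → ℂ) (t : ℕ) :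
    ∀ z, annealed μ P (fun w => c * f w) t z = c * annealed μ P f t z := by
  induction t with
  | zero => intro z; rfl
  | succ t ih =>
    intro z
    rw [annealed_succ, annealed_succ, Finset.mul_sum]
    exact Finset.sum_congr rfl fun r _ => by rw [ih]; ring

lemma annealed_add (μ : Measure R) [IsProbabilityMeasure μ] (f : ℂ → ℂ) (s t : ℕ) :
    ∀ z, annealed μ P f (s + t) z = annealed μ P (annealed μ P f s) t z := by
  induction t with
  | zero => intro z; rfl
  | succ t ih =>
    intro z
    rw [← add_assoc, annealed_succ, annealed_succ]
    exact Finset.sum_congr rfl fun r _ => by rw [ih]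

lemma annealed_conj (μ : Measure R) [IsProbabilityMeasure μ] {f : ℂ → ℂ}
    (hf : ∀ z, f (starRingEnd ℂ z) = starRingEnd ℂ (f z)) (t : ℕ) :
    ∀ z, annealed μ P f t (starRingEnd ℂ z) = starRingEnd ℂ (annealed μ P f t z) := by
  induction t with
  | zero => exact hf
  | succ t ih =>
    intro z
    rw [annealed_succ, annealed_succ, map_sum]
    refine Finset.sum_congr rfl fun r _ => ?_
    rw [map_mul, Complex.conj_ofReal, ← ih, gen, gen, Polynomial.aeval_conj]

/-- A function that the averaging operator multiplies by `c` on `S` is multiplied by `c`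
in each step that starts in `S`. -/
lemma annealed_eigen (μ : Measure R) [IsProbabilityMeasure μ] {f : ℂ → ℂ} {S : Set ℂ} {c : ℂ}
    (hf : ∀ z ∈ S, annealed μ P f 1 z = c * f z) {t : ℕ} {z : ℂ} (hz : Reaches P S t z) :
    annealed μ P f (t + 1) z = c * annealed μ P f t z := by
  rw [add_comm, annealed_add, annealed_congr μ (g := fun w => c * f w) hf hz,
    annealed_mul_left]

lemma Reaches.mono {S S' : Set ℂ} (hS : S ⊆ S') {t : ℕ} {z : ℂ} (h : Reaches P S t z) :
    Reaches P S' t z := fun e => hS (h e)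

/-- Balls in the closed unit disk are forward invariant. -/
lemma OffspringLaws.reaches_ball_mono (h : OffspringLaws μ P E) {ρ : ℝ} (hρ : ρ ≤ 1) {s t : ℕ}
    (hst : s ≤ t) {z : ℂ} (hz : Reaches P (Metric.ball 0 ρ) s z) :
    Reaches P (Metric.ball 0 ρ) t z := by
  intro e
  obtain ⟨d, rfl⟩ := Nat.exists_eq_add_of_le hst
  have := hz e
  rw [mem_ball_zero_iff] at this ⊢
  rw [orbit_add]
  exact (h.norm_orbit_le _ (this.le.trans hρ) d).trans_lt this

end Annealed

/-! ### The transition probabilities as coefficients of averaged polynomials -/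

section Coefficients

variable {R : Type*} [Fintype R] [MeasurableSpace R] [MeasurableSingletonClass R]
  {μ : Measure R} [IsProbabilityMeasure μ] {P : R → Polynomial ℝ} {E : ℝ}

/-- The coefficient of `zⁿ` in `∫ P_r(z)ᵐ μ(dr)`: the probability that `m` individuals have
altogether `n` children. -/
noncomputable def trans (μ : Measure R) (P : R → Polynomial ℝ) (n m : ℕ) : ℝ :=
  ∑ r, μ.real {r} * ((P r) ^ m).coeff n

/-- The generating polynomial `∫ ⋯ ∫ (P_{r_1} ∘ ⋯ ∘ P_{r_t})ʲ` of the population at time `t`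
that descends from `j` individuals. -/
noncomputable def genPoly (μ : Measure R) (P : R → Polynomial ℝ) (j : ℕ) : ℕ → Polynomial ℝ
  | 0 => Polynomial.X ^ j
  | t + 1 => ∑ r, Polynomial.C (μ.real {r}) * (genPoly μ P j t).comp (P r)

lemma aeval_genPoly (μ : Measure R) [IsProbabilityMeasure μ] (P : R → Polynomial ℝ) (j t : ℕ) :
    ∀ z : ℂ, Polynomial.aeval z (genPoly μ P j t) = annealed μ P (fun w => w ^ j) t z := by
  induction t with
  | zero => intro z; simp [genPoly, annealed]
  | succ t ih =>
    intro z
    rw [annealed_succ, genPoly, map_sum]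
    refine Finset.sum_congr rfl fun r _ => ?_
    rw [map_mul, Polynomial.aeval_C, Polynomial.aeval_comp, ← ih]
    rfl

lemma eval_genPoly_succ (μ : Measure R) (P : R → Polynomial ℝ) (j t : ℕ) (x : ℝ) :
    (genPoly μ P j (t + 1)).eval x =
      ∑ r, μ.real {r} * (genPoly μ P j t).eval ((P r).eval x) := by
  simp [genPoly, Polynomial.eval_finsetSum, Polynomial.eval_comp]

lemma OffspringLaws.coeff_pow_nonneg (h : OffspringLaws μ P E) (r : R) (m n : ℕ) :
    0 ≤ ((P r) ^ m).coeff n := by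
  induction m generalizing n with
  | zero => rw [pow_zero, Polynomial.coeff_one]; split_ifs <;> norm_num
  | succ m ih =>
    rw [pow_succ, Polynomial.coeff_mul]
    exact Finset.sum_nonneg fun x _ => mul_nonneg (ih _) (h.nonneg _ _)

lemma OffspringLaws.X_dvd (h : OffspringLaws μ P E) (r : R) : Polynomial.X ∣ P r :=
  Polynomial.X_dvd_iff.2 (h.coeff_zero r)

lemma OffspringLaws.coeff_pow_of_lt (h : OffspringLaws μ P E) (r : R) {m n : ℕ} (hnm : n < m) :
    ((P r) ^ m).coeff n = 0 :=
  Polynomial.X_pow_dvd_iff.1 (pow_dvd_pow_of_dvd (h.X_dvd r) m) n hnm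

lemma OffspringLaws.coeff_pow_self (h : OffspringLaws μ P E) (r : R) (m : ℕ) :
    ((P r) ^ m).coeff m = (P r).coeff 1 ^ m := by
  obtain ⟨Q, hQ⟩ := h.X_dvd r
  rw [hQ, mul_pow, mul_comm, Polynomial.coeff_mul_X_pow', if_pos le_rfl, Nat.sub_self,
    mul_comm, Polynomial.coeff_mul_X, Polynomial.coeff_zero_eq_eval_zero, Polynomial.eval_pow,
    ← Polynomial.coeff_zero_eq_eval_zero]

lemma OffspringLaws.trans_nonneg (h : OffspringLaws μ P E) (n m : ℕ) : 0 ≤ trans μ P n m :=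
  Finset.sum_nonneg fun r _ => mul_nonneg measureReal_nonneg (h.coeff_pow_nonneg r m n)

lemma OffspringLaws.trans_of_lt (h : OffspringLaws μ P E) {n m : ℕ} (hnm : n < m) :
    trans μ P n m = 0 :=
  Finset.sum_eq_zero fun r _ => by rw [h.coeff_pow_of_lt r hnm, mul_zero]

lemma OffspringLaws.trans_self (h : OffspringLaws μ P E) (m : ℕ) :
    trans μ P m m = q μ P m := by
  rw [q_eq_sum]
  exact Finset.sum_congr rfl fun r _ => by rw [h.coeff_pow_self]

/-- The Chapman–Kolmogorov equation. -/
lemma OffspringLaws.coeff_genPoly_succ (h : OffspringLaws μ P E) (j t n : ℕ) :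
    (genPoly μ P j (t + 1)).coeff n =
      ∑ m ∈ Finset.range (n + 1), (genPoly μ P j t).coeff m * trans μ P n m := by
  set Q := genPoly μ P j t with hQ
  have key : ∀ r, (Q.comp (P r)).coeff n =
      ∑ m ∈ Finset.range (n + 1), Q.coeff m * ((P r) ^ m).coeff n := by
    intro r
    rw [Polynomial.comp, Polynomial.eval₂_eq_sum_range' _ (n := Q.natDegree + 1 + (n + 1))
      (by omega), Polynomial.finsetSum_coeff]
    simp only [Polynomial.coeff_C_mul]
    symm
    refine Finset.sum_subset (by intro i; simp only [Finset.mem_range]; omega) fun m _ hm => ?_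
    rw [h.coeff_pow_of_lt r (by simpa [Nat.lt_succ_iff] using hm), mul_zero]
  rw [genPoly, Polynomial.finsetSum_coeff]
  simp only [Polynomial.coeff_C_mul, ← hQ, key, Finset.mul_sum, trans]
  rw [Finset.sum_comm]
  exact Finset.sum_congr rfl fun m _ => Finset.sum_congr rfl fun r _ => by ring

lemma OffspringLaws.coeff_genPoly_nonneg (h : OffspringLaws μ P E) (j t n : ℕ) :
    0 ≤ (genPoly μ P j t).coeff n := by
  induction t generalizing n with
  | zero => rw [genPoly, Polynomial.coeff_X_pow]; split_ifs <;> norm_num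
  | succ t ih =>
    rw [h.coeff_genPoly_succ]
    exact Finset.sum_nonneg fun m _ => mul_nonneg (ih m) (h.trans_nonneg n m)

lemma OffspringLaws.coeff_genPoly_of_lt (h : OffspringLaws μ P E) {j n : ℕ} (hn : n < j) (t : ℕ) :
    (genPoly μ P j t).coeff n = 0 := by
  induction t generalizing n with
  | zero => rw [genPoly, Polynomial.coeff_X_pow, if_neg hn.ne]
  | succ t ih =>
    rw [h.coeff_genPoly_succ]
    refine Finset.sum_eq_zero fun m hm => ?_
    rw [ih (lt_of_le_of_lt (Nat.lt_succ_iff.1 (Finset.mem_range.1 hm)) hn), zero_mul]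

lemma OffspringLaws.coeff_genPoly_self (h : OffspringLaws μ P E) (j t : ℕ) :
    (genPoly μ P j t).coeff j = q μ P j ^ t := by
  induction t with
  | zero => rw [genPoly, Polynomial.coeff_X_pow, if_pos rfl, pow_zero]
  | succ t ih =>
    rw [h.coeff_genPoly_succ, Finset.sum_range_succ, Finset.sum_eq_zero, zero_add, ih,
      h.trans_self, pow_succ]
    intro m hm
    rw [h.coeff_genPoly_of_lt (Finset.mem_range.1 hm), zero_mul]

lemma OffspringLaws.q_mul_coeff_genPoly_le (h : OffspringLaws μ P E) (j t n : ℕ) :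
    q μ P j * (genPoly μ P j t).coeff n ≤ (genPoly μ P j (t + 1)).coeff n := by
  induction t generalizing n with
  | zero =>
    rw [genPoly, Polynomial.coeff_X_pow]
    split_ifs with hn
    · rw [hn, h.coeff_genPoly_self]; simp
    · simpa using h.coeff_genPoly_nonneg j 1 n
  | succ t ih =>
    rw [h.coeff_genPoly_succ j (t + 1), h.coeff_genPoly_succ j t, Finset.mul_sum]
    refine Finset.sum_le_sum fun m _ => ?_
    rw [← mul_assoc]
    exact mul_le_mul_of_nonneg_right (ih m) (h.trans_nonneg n m)

lemma OffspringLaws.eval_genPoly_le_pow (h : OffspringLaws μ P E) (j t : ℕ) {δ : ℝ}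
    (hδ : δ ≤ 1) {x : ℝ} (h0 : 0 ≤ x) (hx : x ≤ δ) :
    (genPoly μ P j t).eval x ≤
      (∑ r, μ.real {r} * ((P r).coeff 1 + (1 - (P r).coeff 1) * δ) ^ j) ^ t * x ^ j := by
  induction t generalizing x with
  | zero => simp [genPoly]
  | succ t ih =>
    set κ := ∑ r, μ.real {r} * ((P r).coeff 1 + (1 - (P r).coeff 1) * δ) ^ j with hκ
    have hδ0 : 0 ≤ δ := h0.trans hx
    have hb : ∀ r, 0 ≤ (P r).coeff 1 + (1 - (P r).coeff 1) * δ := fun r =>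
      add_nonneg (h.nonneg r 1) (mul_nonneg (by linarith [h.coeff_one_le_one r]) hδ0)
    have hκ0 : 0 ≤ κ := Finset.sum_nonneg fun r _ =>
      mul_nonneg measureReal_nonneg (pow_nonneg (hb r) j)
    rw [eval_genPoly_succ]
    calc _ ≤ ∑ r, μ.real {r} * (κ ^ t *
            (((P r).coeff 1 + (1 - (P r).coeff 1) * δ) ^ j * x ^ j)) := by
          refine Finset.sum_le_sum fun r _ => mul_le_mul_of_nonneg_left ?_ measureReal_nonneg
          have h1 := h.eval_le r h0 (hx.trans hδ)
          have h2 := h.eval_nonneg r h0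
          refine (ih h2 ((h.eval_le_self r h0 (hx.trans hδ)).trans hx)).trans ?_
          rw [← mul_pow]
          refine mul_le_mul_of_nonneg_left (pow_le_pow_left₀ h2 (h1.trans ?_) j) (pow_nonneg hκ0 t)
          rw [mul_comm]
          refine mul_le_mul_of_nonneg_right ?_ h0
          have := mul_le_mul_of_nonneg_left hx (by linarith [h.coeff_one_le_one r] :
            0 ≤ 1 - (P r).coeff 1)
          linarith
      _ = κ ^ (t + 1) * x ^ j := by
          rw [pow_succ, hκ, mul_assoc, ← hκ, Finset.sum_mul, Finset.mul_sum]
          exact Finset.sum_congr rfl fun r _ => by ring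

/-- Powers of a chord lie below their chord. -/
lemma chord_pow_le {p x : ℝ} (hp0 : 0 ≤ p) (hx0 : 0 ≤ x) (hx1 : x ≤ 1) (j : ℕ) :
    (p + (1 - p) * x) ^ j ≤ p ^ j + x := by
  have := (convexOn_pow j).2 (x := p) (y := 1) hp0 (by norm_num : (0:ℝ) ≤ 1)
    (sub_nonneg.2 hx1) hx0 (by ring)
  simp only [smul_eq_mul, one_pow, mul_one] at this
  calc (p + (1 - p) * x) ^ j = ((1 - x) * p + x) ^ j := by ring
    _ ≤ (1 - x) * p ^ j + x := this
    _ ≤ p ^ j + x := by nlinarith [pow_nonneg hp0 j]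

/-- The averaging operator maps `xʲ` to `q_j xʲ` up to an error of higher order. -/
lemma OffspringLaws.eval_genPoly_succ_le (h : OffspringLaws μ P E) (j t : ℕ) {x : ℝ}
    (h0 : 0 ≤ x) (h1 : x ≤ 1) :
    (genPoly μ P j (t + 1)).eval x ≤
      q μ P j * (genPoly μ P j t).eval x + (genPoly μ P (j + 1) t).eval x := by
  induction t generalizing x with
  | zero =>
    rw [eval_genPoly_succ]
    simp only [genPoly, Polynomial.eval_pow, Polynomial.eval_X]
    calc _ ≤ ∑ r, μ.real {r} * (x ^ j * ((P r).coeff 1 ^ j + x)) := by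
          refine Finset.sum_le_sum fun r _ => mul_le_mul_of_nonneg_left ?_ measureReal_nonneg
          refine (pow_le_pow_left₀ (h.eval_nonneg r h0) (h.eval_le r h0 h1) j).trans ?_
          rw [mul_pow]
          exact mul_le_mul_of_nonneg_left
            (chord_pow_le (h.nonneg r 1) h0 h1 j) (pow_nonneg h0 j)
      _ = q μ P j * x ^ j + (∑ r, μ.real {r}) * x ^ (j + 1) := by
          rw [q_eq_sum, Finset.sum_mul, Finset.sum_mul, ← Finset.sum_add_distrib]
          exact Finset.sum_congr rfl fun r _ => by ring
      _ = _ := by rw [sum_measureReal_singleton, one_mul]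
  | succ t ih =>
    rw [eval_genPoly_succ μ P j (t + 1), eval_genPoly_succ μ P j t, eval_genPoly_succ μ P (j + 1) t,
      Finset.mul_sum, ← Finset.sum_add_distrib]
    refine Finset.sum_le_sum fun r _ => ?_
    have := mul_le_mul_of_nonneg_left (ih (h.eval_nonneg r h0)
      ((h.eval_le_self r h0 h1).trans h1)) (measureReal_nonneg (μ := μ) (s := {r}))
    linarith

/-- Near `0` the generating polynomials decay like `q_jᵗ`: the contribution of the populations
that do not stay at `j` decays at the strictly smaller rate of `j + 1` individuals. -/
lemma OffspringLaws.exists_eval_genPoly_le_near_zero (h : OffspringLaws μ P E) (j : ℕ) :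
    ∃ δ > 0, ∃ B, ∀ t x, 0 ≤ x → x ≤ δ → (genPoly μ P j t).eval x ≤ B * q μ P j ^ t := by
  have hcont : Tendsto (fun δ : ℝ =>
      ∑ r, μ.real {r} * ((P r).coeff 1 + (1 - (P r).coeff 1) * δ) ^ (j + 1)) (𝓝[>] 0)
      (𝓝 (q μ P (j + 1))) := by
    have : Continuous (fun δ : ℝ =>
      ∑ r, μ.real {r} * ((P r).coeff 1 + (1 - (P r).coeff 1) * δ) ^ (j + 1)) := by fun_prop
    have h2 := this.tendsto 0
    simp only [mul_zero, add_zero] at h2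
    rw [q_eq_sum]
    exact h2.mono_left nhdsWithin_le_nhds
  have h1 := hcont.eventually (gt_mem_nhds (h.q_succ_lt j))
  obtain ⟨δ, ⟨hκ, hδ1⟩, hδ0⟩ := ((h1.and (mem_nhdsWithin_of_mem_nhds (Iic_mem_nhds one_pos))).and
    self_mem_nhdsWithin).exists
  set κ := ∑ r, μ.real {r} * ((P r).coeff 1 + (1 - (P r).coeff 1) * δ) ^ (j + 1) with hκdef
  have hδ1 : δ ≤ 1 := hδ1
  have hδ0 : 0 < δ := hδ0
  have hq := h.q_pos' j
  have hκ0 : 0 ≤ κ := Finset.sum_nonneg fun r _ => mul_nonneg measureReal_nonneg (pow_nonneg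
    (add_nonneg (h.nonneg r 1) (mul_nonneg (by linarith [h.coeff_one_le_one r]) hδ0.le)) _)
  refine ⟨δ, hδ0, 1 + 1 / (q μ P j - κ), fun t x hx0 hx => ?_⟩
  have hx1 := hx.trans hδ1
  have key : ∀ t, (genPoly μ P j t).eval x ≤
      q μ P j ^ t + (q μ P j ^ t - κ ^ t) / (q μ P j - κ) := by
    intro t
    induction t with
    | zero => simpa [genPoly] using pow_le_one₀ hx0 hx1
    | succ t ih =>
      have e1 := h.eval_genPoly_succ_le j t hx0 hx1
      have e2 := h.eval_genPoly_le_pow (j + 1) t hδ1 hx0 hx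
      rw [← hκdef] at e2
      have e3 : κ ^ t * x ^ (j + 1) ≤ κ ^ t := mul_le_of_le_one_right (pow_nonneg hκ0 t)
        (pow_le_one₀ hx0 hx1)
      have e4 : q μ P j ^ (t + 1) + (q μ P j ^ (t + 1) - κ ^ (t + 1)) / (q μ P j - κ) =
          q μ P j * (q μ P j ^ t + (q μ P j ^ t - κ ^ t) / (q μ P j - κ)) + κ ^ t := by
        have : q μ P j - κ ≠ 0 := by linarith
        field_simp
        ring
      rw [e4]
      nlinarith
  refine (key t).trans ?_
  rw [add_mul, one_mul, div_mul_eq_mul_div, one_mul]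
  have : 0 < q μ P j - κ := by linarith
  gcongr
  linarith [pow_nonneg hκ0 t]

/-- After normalization by `q_jᵗ` the generating polynomials are bounded at every point of
`[0, 1)`. -/
lemma OffspringLaws.exists_eval_genPoly_le (h : OffspringLaws μ P E) (j : ℕ) {ρ : ℝ}
    (hρ0 : 0 ≤ ρ) (hρ : ρ < 1) :
    ∃ B, ∀ t, (genPoly μ P j t).eval ρ ≤ B * q μ P j ^ t := by
  obtain ⟨δ, hδ, B₀, hB₀⟩ := h.exists_eval_genPoly_le_near_zero j
  have hq := h.q_pos' j
  -- the contraction factor of all generating functions on `[0, ρ]`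
  obtain ⟨κ, hκ0, hκ1, hκ⟩ : ∃ κ : ℝ, 0 ≤ κ ∧ κ < 1 ∧
      ∀ r, (P r).coeff 1 + (1 - (P r).coeff 1) * ρ ≤ κ := by
    have hne := nonempty_of_measure μ
    obtain ⟨r₀, hr₀⟩ := Finite.exists_max fun r => (P r).coeff 1 + (1 - (P r).coeff 1) * ρ
    refine ⟨_, add_nonneg (h.nonneg r₀ 1) (mul_nonneg (by linarith [h.coeff_one_le_one r₀]) hρ0),
      ?_, hr₀⟩
    nlinarith [h.coeff_one_lt_one r₀]
  have step : ∀ m : ℕ, ∃ B, ∀ x, 0 ≤ x → x ≤ ρ → κ ^ m * x ≤ δ → ∀ t,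
      (genPoly μ P j t).eval x ≤ B * q μ P j ^ t := by
    intro m
    induction m with
    | zero => exact ⟨B₀, fun x hx0 _ hx t => hB₀ t x hx0 (by simpa using hx)⟩
    | succ m ih =>
      obtain ⟨B, hB⟩ := ih
      refine ⟨max 1 (B / q μ P j), fun x hx0 hxρ hx t => ?_⟩
      rcases t with _ | t
      · simp only [genPoly, Polynomial.eval_pow, Polynomial.eval_X, pow_zero, mul_one]
        exact (pow_le_one₀ hx0 (hxρ.trans hρ.le)).trans (le_max_left _ _)
      · rw [eval_genPoly_succ]
        have hx1 := hxρ.trans hρ.le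
        calc _ ≤ ∑ r, μ.real {r} * (B * q μ P j ^ t) := by
              refine Finset.sum_le_sum fun r _ => mul_le_mul_of_nonneg_left ?_ measureReal_nonneg
              refine hB _ (h.eval_nonneg r hx0) ((h.eval_le_self r hx0 hx1).trans hxρ) ?_ t
              refine le_trans ?_ hx
              rw [pow_succ, mul_assoc]
              refine mul_le_mul_of_nonneg_left ((h.eval_le r hx0 hx1).trans ?_) (pow_nonneg hκ0 m)
              rw [mul_comm]
              refine mul_le_mul_of_nonneg_right (le_trans ?_ (hκ r)) hx0
              have := mul_le_mul_of_nonneg_left hxρ (by linarith [h.coeff_one_le_one r] :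
                0 ≤ 1 - (P r).coeff 1)
              linarith
          _ = B / q μ P j * q μ P j ^ (t + 1) := by
              rw [← Finset.sum_mul, sum_measureReal_singleton, pow_succ]
              field_simp
          _ ≤ _ := by gcongr; exact le_max_right _ _
  obtain ⟨m, hm⟩ := exists_pow_lt_of_lt_one hδ hκ1
  obtain ⟨B, hB⟩ := step m
  refine ⟨B, fun t => hB ρ hρ0 le_rfl ?_ t⟩
  nlinarith [pow_nonneg hκ0 m]

lemma OffspringLaws.monotone_ratio (h : OffspringLaws μ P E) (n j : ℕ) :
    Monotone fun t => (genPoly μ P j t).coeff n / q μ P j ^ t := by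
  refine monotone_nat_of_le_succ fun t => ?_
  have hq := h.q_pos' j
  rw [div_le_div_iff₀ (by positivity) (by positivity), pow_succ]
  have := mul_le_mul_of_nonneg_left (h.q_mul_coeff_genPoly_le j t n) (pow_nonneg hq.le t)
  linarith

lemma OffspringLaws.sum_ratio_le (h : OffspringLaws μ P E) (j : ℕ) {ρ : ℝ} (hρ0 : 0 ≤ ρ)
    (hρ : ρ < 1) : ∃ B, ∀ t, ∀ s : Finset ℕ,
      ∑ n ∈ s, (genPoly μ P j t).coeff n / q μ P j ^ t * ρ ^ n ≤ B := by
  obtain ⟨B, hB⟩ := h.exists_eval_genPoly_le j hρ0 hρ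
  refine ⟨B, fun t s => ?_⟩
  have hq := h.q_pos' j
  obtain ⟨N, hN⟩ : ∃ N, s ⊆ Finset.range N ∧ (genPoly μ P j t).natDegree < N := by
    obtain ⟨M, hM⟩ := s.exists_nat_subset_range
    exact ⟨M + ((genPoly μ P j t).natDegree + 1), hM.trans (Finset.range_mono (by omega)), by omega⟩
  have h1 : ∑ n ∈ s, (genPoly μ P j t).coeff n * ρ ^ n ≤ B * q μ P j ^ t := by
    refine le_trans ?_ (hB t)
    rw [Polynomial.eval_eq_sum_range' hN.2]
    exact Finset.sum_le_sum_of_subset_of_nonneg hN.1 fun n _ _ =>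
      mul_nonneg (h.coeff_genPoly_nonneg j t n) (by positivity)
  calc _ = (∑ n ∈ s, (genPoly μ P j t).coeff n * ρ ^ n) / q μ P j ^ t := by
        rw [Finset.sum_div]; exact Finset.sum_congr rfl fun n _ => by ring
    _ ≤ B := by rw [div_le_iff₀ (by positivity)]; exact h1

lemma OffspringLaws.exists_tendsto_ratio (h : OffspringLaws μ P E) (n j : ℕ) :
    ∃ l, Tendsto (fun t => (genPoly μ P j t).coeff n / q μ P j ^ t) atTop (𝓝 l) := by
  refine ⟨_, tendsto_atTop_ciSup (h.monotone_ratio n j) ?_⟩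
  obtain ⟨B, hB⟩ := h.sum_ratio_le j (ρ := 1 / 2) (by norm_num) (by norm_num)
  refine ⟨B / (1 / 2) ^ n, ?_⟩
  rintro _ ⟨t, rfl⟩
  have := hB t {n}
  rw [Finset.sum_singleton] at this
  rwa [le_div_iff₀ (by positivity)]

end Coefficients

/-! ### The law of the branching process -/

lemma hasSum_of_forall_notMem {ι : Type*} {f : ι → ℝ} (s : Finset ι) (hf : ∀ v ∉ s, f v = 0) :
    HasSum f (∑ v ∈ s, f v) :=
  hasSum_sum_of_ne_finset_zero hf

section Fibers

variable {Ω α : Type*} [MeasurableSpace Ω] [MeasurableSpace α] [MeasurableSingletonClass α]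
  [Countable α] (ℙ : Measure Ω) [IsProbabilityMeasure ℙ]

lemma hasSum_measureReal_inter_fiber {f : Ω → α} (hf : Measurable f) (A : Set Ω) :
    HasSum (fun v => ℙ.real (A ∩ f ⁻¹' {v})) (ℙ.real A) := by
  have h1 : ∑' v, (ℙ.restrict A) (f ⁻¹' {v}) = ℙ A := by
    rw [← measure_iUnion (fun a b hab => Disjoint.preimage f (by simpa using hab))
      (fun v => hf (measurableSet_singleton v)), ← Set.preimage_iUnion, Set.iUnion_of_singleton,
      Set.preimage_univ, Measure.restrict_apply_univ]
  have h2 : ∀ v, (ℙ.restrict A) (f ⁻¹' {v}) = ℙ (A ∩ f ⁻¹' {v}) := fun v => by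
    rw [Measure.restrict_apply (hf (measurableSet_singleton v)), Set.inter_comm]
  simp only [h2] at h1
  have := ENNReal.hasSum_toReal (f := fun v => ℙ (A ∩ f ⁻¹' {v})) (by rw [h1]; finiteness)
  simp only [Measure.real]
  rw [← h1, ENNReal.tsum_toReal_eq (fun v => by finiteness)]
  exact this

/-- If an event `B` has the same conditional probability `c` on all fibres of `Y` that make up the
event `A`, then it has this conditional probability on `A`. -/
lemma measureReal_inter_of_fibers {Y : Ω → α} (hY : Measurable Y) {A B : Set Ω} {c : ℝ}
    (hA : ∀ ω ω', Y ω = Y ω' → ω ∈ A → ω' ∈ A)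
    (hB : ∀ ω ∈ A, ℙ.real (Y ⁻¹' {Y ω} ∩ B) = ℙ.real (Y ⁻¹' {Y ω}) * c) :
    ℙ.real (A ∩ B) = ℙ.real A * c := by
  refine (hasSum_measureReal_inter_fiber ℙ hY (A ∩ B)).unique ?_
  refine ((hasSum_measureReal_inter_fiber ℙ hY A).mul_right c).congr_fun fun y => ?_
  by_cases hy : ∃ ω ∈ A, Y ω = y
  · obtain ⟨ω, hω, rfl⟩ := hy
    have : A ∩ Y ⁻¹' {Y ω} = Y ⁻¹' {Y ω} :=
      Set.inter_eq_right.2 fun ω' hω' => hA ω ω' (Eq.symm hω') hω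
    rw [this, ← hB ω hω, Set.inter_right_comm, this]
  · have : A ∩ Y ⁻¹' {y} = ∅ := by
      ext ω
      simp only [Set.mem_inter_iff, Set.mem_preimage, Set.mem_singleton_iff,
        Set.mem_empty_iff_false, iff_false]
      exact fun hω => hy ⟨ω, hω⟩
    rw [this, Set.inter_right_comm, this]
    simp

end Fibers

section BranchingLaw

variable {R Ω : Type*} [Fintype R] [MeasurableSpace R] [MeasurableSingletonClass R]
  [MeasurableSpace Ω] {μ : Measure R} [IsProbabilityMeasure μ] {P : R → Polynomial ℝ} {E : ℝ}
  {ℙ : Measure Ω} [IsProbabilityMeasure ℙ] {env : ℕ → Ω → R} {ξ : ℕ → ℕ → Ω → ℕ}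

/-- The data of the first `N` individuals of the generations before `t`, with their environments,
of the environment at time `t`, and of the first `l` individuals of generation `t`. -/
def history (env : ℕ → Ω → R) (ξ : ℕ → ℕ → Ω → ℕ) (t N l : ℕ) (ω : Ω) :
    (Fin t → R × (Fin N → ℕ)) × R × (Fin l → ℕ) :=
  (fun s => (env s ω, fun i => ξ i s ω), env t ω, fun i => ξ i t ω)

/-- The part of `history` that concerns the generations before `t`. -/
def past (env : ℕ → Ω → R) (ξ : ℕ → ℕ → Ω → ℕ) (t N : ℕ) (ω : Ω) : Fin t → R × (Fin N → ℕ) :=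
  fun s => (env s ω, fun i => ξ i s ω)

lemma past_eq_iff {t N : ℕ} {ω ω' : Ω} : past env ξ t N ω = past env ξ t N ω' ↔
    ∀ s < t, env s ω = env s ω' ∧ ∀ i < N, ξ i s ω = ξ i s ω' := by
  simp only [past, funext_iff, Prod.ext_iff, Fin.forall_iff]

lemma history_eq_iff {t N l : ℕ} {ω ω' : Ω} :
    history env ξ t N l ω = history env ξ t N l ω' ↔
    past env ξ t N ω = past env ξ t N ω' ∧ env t ω = env t ω' ∧
      ∀ i < l, ξ i t ω = ξ i t ω' := by
  rw [history, history, Prod.ext_iff, Prod.ext_iff]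
  simp only [past, funext_iff, Fin.forall_iff]

lemma IsOffspringFamily.measurable_past (hξ : IsOffspringFamily μ P ℙ env ξ) (t N : ℕ) :
    Measurable (past env ξ t N) :=
  measurable_pi_lambda _ fun s => (hξ.measurable_env s).prodMk
    (measurable_pi_lambda _ fun i => hξ.measurable_offspring i s)

lemma IsOffspringFamily.measurable_history (hξ : IsOffspringFamily μ P ℙ env ξ) (t N l : ℕ) :
    Measurable (history env ξ t N l) :=
  (hξ.measurable_past t N).prodMk ((hξ.measurable_env t).prodMk
    (measurable_pi_lambda _ fun i => hξ.measurable_offspring i t))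

lemma IsOffspringFamily.measureReal_past (hξ : IsOffspringFamily μ P ℙ env ξ) (t N : ℕ) (ω : Ω) :
    ℙ.real (past env ξ t N ⁻¹' {past env ξ t N ω}) =
      ∏ s ∈ Finset.range t, (μ.real {env s ω} *
        ∏ i ∈ Finset.range N, (P (env s ω)).coeff (ξ i s ω)) := by
  rw [← hξ.law t N (fun s => env s ω) (fun i s => ξ i s ω)]
  congr 1
  ext ω'
  exact past_eq_iff

/-- The finite-dimensional distributions when only the first `l ≤ N` individuals of the last
generation are taken into account. -/
lemma IsOffspringFamily.law_partial (hξ : IsOffspringFamily μ P ℙ env ξ)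
    (h : OffspringLaws μ P E) (t : ℕ) (e : ℕ → R) (d l : ℕ) : ∀ k : ℕ → ℕ → ℕ,
    ℙ.real {ω | (∀ s < t, env s ω = e s ∧ ∀ i < l + d, ξ i s ω = k i s) ∧ env t ω = e t ∧
        ∀ i < l, ξ i t ω = k i t} =
      (∏ s ∈ Finset.range t, (μ.real {e s} * ∏ i ∈ Finset.range (l + d), (P (e s)).coeff (k i s))) *
        (μ.real {e t} * ∏ i ∈ Finset.range l, (P (e t)).coeff (k i t)) := by
  induction d generalizing l with
  | zero =>
    intro k
    have := hξ.law (t + 1) l e k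
    rw [Finset.prod_range_succ] at this
    rw [add_zero, ← this]
    congr 1
    ext ω
    simp only [Set.mem_ofPred_eq]
    constructor
    · rintro ⟨h1, h2⟩ s hs
      rcases Nat.lt_succ_iff_lt_or_eq.1 hs with hs | rfl
      · exact h1 s hs
      · exact h2
    · exact fun hs => ⟨fun s hst => hs s (by omega), hs t (by omega)⟩
  | succ d ih =>
    intro k
    refine (hasSum_measureReal_inter_fiber ℙ (hξ.measurable_offspring l t) _).unique ?_
    have hsum : HasSum (fun v => (P (e t)).coeff v) 1 := by
      have := hasSum_of_forall_notMem (f := fun v => (P (e t)).coeff v)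
        (Finset.range ((P (e t)).natDegree + 1)) fun v hv =>
          Polynomial.coeff_eq_zero_of_natDegree_lt (by simpa [Nat.lt_succ_iff] using hv)
      rwa [h.sum_coeff (e t) (by omega)] at this
    have hmul := hsum.mul_left ((∏ s ∈ Finset.range t, (μ.real {e s} *
      ∏ i ∈ Finset.range (l + (d + 1)), (P (e s)).coeff (k i s))) *
        (μ.real {e t} * ∏ i ∈ Finset.range l, (P (e t)).coeff (k i t)))
    rw [mul_one] at hmul
    refine hmul.congr_fun fun v => ?_
    set k' : ℕ → ℕ → ℕ := fun i s => if i = l ∧ s = t then v else k i s with hk'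
    have e1 := ih (l + 1) k'
    have e2 : ∀ i < l, k' i t = k i t := fun i hi => by
      rw [hk']; simp only; rw [if_neg (by omega)]
    have e3 : ∀ s < t, ∀ i, k' i s = k i s := fun s hs i => by
      rw [hk']; simp only; rw [if_neg (by omega)]
    have e4 : k' l t = v := by rw [hk']; simp
    have e5 : l + 1 + d = l + (d + 1) := by omega
    rw [e5] at e1
    calc _ = ℙ.real {ω | (∀ s < t, env s ω = e s ∧ ∀ i < l + (d + 1), ξ i s ω = k' i s) ∧
          env t ω = e t ∧ ∀ i < l + 1, ξ i t ω = k' i t} := by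
          congr 1
          ext ω
          simp only [Set.mem_inter_iff, Set.mem_ofPred_eq, Set.mem_preimage,
            Set.mem_singleton_iff]
          constructor
          · rintro ⟨⟨h1, h2, h3⟩, h4⟩
            refine ⟨fun s hs => ⟨(h1 s hs).1, fun i hi => ?_⟩, h2, fun i hi => ?_⟩
            · rw [e3 s hs]; exact (h1 s hs).2 i hi
            · rcases Nat.lt_succ_iff_lt_or_eq.1 hi with hi | rfl
              · rw [e2 i hi]; exact h3 i hi
              · rw [e4, h4]
          · rintro ⟨h1, h2, h3⟩
            refine ⟨⟨fun s hs => ⟨(h1 s hs).1, fun i hi => ?_⟩, h2, fun i hi => ?_⟩, ?_⟩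
            · rw [← e3 s hs]; exact (h1 s hs).2 i hi
            · rw [← e2 i hi]; exact h3 i (by omega)
            · rw [h3 l (by omega), e4]
      _ = _ := by
          rw [e1, Finset.prod_range_succ _ l, e4]
          have f1 : ∏ i ∈ Finset.range l, (P (e t)).coeff (k' i t) =
              ∏ i ∈ Finset.range l, (P (e t)).coeff (k i t) :=
            Finset.prod_congr rfl fun i hi => by rw [e2 i (Finset.mem_range.1 hi)]
          have f2 : ∏ s ∈ Finset.range t, (μ.real {e s} *
              ∏ i ∈ Finset.range (l + (d + 1)), (P (e s)).coeff (k' i s)) =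
              ∏ s ∈ Finset.range t, (μ.real {e s} *
              ∏ i ∈ Finset.range (l + (d + 1)), (P (e s)).coeff (k i s)) :=
            Finset.prod_congr rfl fun s hs => by
              congr 1
              exact Finset.prod_congr rfl fun i _ => by rw [e3 s (Finset.mem_range.1 hs)]
          rw [f1, f2]
          ring

lemma IsOffspringFamily.measureReal_history (hξ : IsOffspringFamily μ P ℙ env ξ)
    (h : OffspringLaws μ P E) {t N l : ℕ} (hl : l ≤ N) (ω : Ω) :
    ℙ.real (history env ξ t N l ⁻¹' {history env ξ t N l ω}) =
      ℙ.real (past env ξ t N ⁻¹' {past env ξ t N ω}) *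
        (μ.real {env t ω} * ∏ i ∈ Finset.range l, (P (env t ω)).coeff (ξ i t ω)) := by
  obtain ⟨d, rfl⟩ := Nat.exists_eq_add_of_le hl
  rw [hξ.measureReal_past, ← hξ.law_partial h t (fun s => env s ω) d l (fun i s => ξ i s ω)]
  congr 1
  ext ω'
  simp only [Set.mem_preimage, Set.mem_singleton_iff, Set.mem_ofPred_eq, history_eq_iff,
    past_eq_iff]

/-- The environment at time `t` is independent of the past. -/
lemma IsOffspringFamily.measureReal_inter_env (hξ : IsOffspringFamily μ P ℙ env ξ)
    (h : OffspringLaws μ P E) (t N : ℕ) (r : R) {A : Set Ω}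
    (hA : ∀ ω ω', past env ξ t N ω = past env ξ t N ω' → ω ∈ A → ω' ∈ A) :
    ℙ.real (A ∩ {ω | env t ω = r}) = ℙ.real A * μ.real {r} := by
  refine measureReal_inter_of_fibers ℙ (hξ.measurable_past t N) hA fun ω _ => ?_
  rw [hξ.measureReal_past]
  have := hξ.law_partial h t (fun s => if s = t then r else env s ω) N 0 (fun i s => ξ i s ω)
  simp only [zero_add, if_true, Finset.range_zero, Finset.prod_empty, mul_one] at this
  convert this using 1
  · congr 1
    ext ω'
    simp only [Set.mem_inter_iff, Set.mem_preimage, Set.mem_singleton_iff, past_eq_iff,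
      Set.mem_ofPred_eq, not_lt_zero, false_imp_iff, implies_true, and_true]
    refine and_congr_left fun _ => forall₂_congr fun s hs => ?_
    rw [if_neg hs.ne]
  · congr 1
    refine Finset.prod_congr rfl fun s hs => ?_
    rw [if_neg (Finset.mem_range.1 hs).ne]

/-- Given the environment `r` at time `t`, the offspring number of the `l`-th individual of
generation `t` is independent of the past and of its predecessors. -/
lemma IsOffspringFamily.measureReal_inter_offspring (hξ : IsOffspringFamily μ P ℙ env ξ)
    (h : OffspringLaws μ P E) (t : ℕ) {N l : ℕ} (hl : l < N) (r : R) (v : ℕ) {A : Set Ω}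
    (hA : ∀ ω ω', history env ξ t N l ω = history env ξ t N l ω' → ω ∈ A → ω' ∈ A)
    (hr : ∀ ω ∈ A, env t ω = r) :
    ℙ.real (A ∩ {ω | ξ l t ω = v}) = ℙ.real A * (P r).coeff v := by
  refine measureReal_inter_of_fibers ℙ (hξ.measurable_history t N l) hA fun ω hω => ?_
  rw [hξ.measureReal_history h hl.le, hξ.measureReal_past, hr ω hω]
  obtain ⟨d, rfl⟩ := Nat.exists_eq_add_of_lt hl
  have e5 : l + d + 1 = l + 1 + d := by omega
  have := hξ.law_partial h t (fun s => env s ω) d (l + 1)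
    (fun i s => if i = l ∧ s = t then v else ξ i s ω)
  rw [e5]
  have e3 : ∀ s < t, ∀ i, (if i = l ∧ s = t then v else ξ i s ω) = ξ i s ω := fun s hs i =>
    if_neg (by omega)
  have e2 : ∀ i < l, (if i = l ∧ t = t then v else ξ i t ω) = ξ i t ω := fun i hi =>
    if_neg (by omega)
  calc _ = _ := by
        congr 1
        ext ω'
        simp only [Set.mem_inter_iff, Set.mem_preimage, Set.mem_singleton_iff, history_eq_iff,
          past_eq_iff, Set.mem_ofPred_eq]
        constructor
        · rintro ⟨⟨h1, h2, h3⟩, h4⟩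
          refine ⟨fun s hs => ⟨(h1 s hs).1, fun i hi => ?_⟩, h2, fun i hi => ?_⟩
          · rw [e3 s hs]; exact (h1 s hs).2 i hi
          · rcases Nat.lt_succ_iff_lt_or_eq.1 hi with hi | rfl
            · rw [if_neg (by omega)]; exact h3 i hi
            · simpa using h4
        · rintro ⟨h1, h2, h3⟩
          refine ⟨⟨fun s hs => ⟨(h1 s hs).1, fun i hi => ?_⟩, h2, fun i hi => ?_⟩, ?_⟩
          · rw [← e3 s hs i]; exact (h1 s hs).2 i hi
          · rw [h3 i (by omega), if_neg (by omega)]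
          · simpa using h3 l (by omega)
    _ = _ := this
    _ = _ := by
        rw [Finset.prod_range_succ _ l, mul_assoc, mul_assoc (μ.real {r})]
        congr 1
        · refine Finset.prod_congr rfl fun s hs => ?_
          congr 1
          exact Finset.prod_congr rfl fun i _ => by rw [e3 s (Finset.mem_range.1 hs)]
        · rw [hr ω hω]
          congr 2
          · exact Finset.prod_congr rfl fun i hi => by rw [e2 i (Finset.mem_range.1 hi)]
          · simp

lemma IsOffspringFamily.measurable_population (hξ : IsOffspringFamily μ P ℙ env ξ) (j t : ℕ) :
    Measurable (population ξ j t) := by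
  induction t with
  | zero => exact measurable_const
  | succ t ih =>
    have : population ξ j (t + 1) =
        fun ω => (fun p : ℕ × Ω => ∑ i ∈ Finset.range p.1, ξ i t p.2) (population ξ j t ω, ω) := rfl
    rw [this]
    have hm : Measurable fun p : ℕ × Ω => ∑ i ∈ Finset.range p.1, ξ i t p.2 :=
      measurable_from_prod_countable_right fun n =>
        Finset.measurable_sum (Finset.range n) fun i _ => hξ.measurable_offspring i t
    exact hm.comp (ih.prodMk measurable_id)

lemma population_congr {N t j : ℕ} {ω ω' : Ω} (h : past env ξ t N ω = past env ξ t N ω')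
    (hω : ∀ s ≤ t, population ξ j s ω ≤ N) :
    ∀ s ≤ t, population ξ j s ω' = population ξ j s ω := by
  rw [past_eq_iff] at h
  intro s
  induction s with
  | zero => intro _; rfl
  | succ s ih =>
    intro hs
    simp only [population]
    rw [ih (by omega)]
    refine Finset.sum_congr rfl fun i hi => ((h s (by omega)).2 i ?_).symm
    exact (Finset.mem_range.1 hi).trans_le (hω s (by omega))

/-- The joint law of the population at time `t`, the environment at time `t`, and the offspring
of the first `l` individuals. -/
lemma IsOffspringFamily.measureReal_population_env_sum (hξ : IsOffspringFamily μ P ℙ env ξ)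
    (h : OffspringLaws μ P E) (j t m l n : ℕ) (r : R) :
    ℙ.real {ω | population ξ j t ω = m ∧ env t ω = r ∧ ∑ i ∈ Finset.range l, ξ i t ω = n} =
      ℙ.real {ω | population ξ j t ω = m} * (μ.real {r} * ((P r) ^ l).coeff n) := by
  set A : ℕ → Set Ω := fun N => {ω | (∀ s ≤ t, population ξ j s ω ≤ N) ∧ population ξ j t ω = m}
    with hA
  have hAsat : ∀ N ω ω', past env ξ t N ω = past env ξ t N ω' → ω ∈ A N → ω' ∈ A N := by
    rintro N ω ω' hp ⟨h1, h2⟩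
    have := population_congr hp h1
    exact ⟨fun s hs => (this s hs).trans_le (h1 s hs), (this t le_rfl).trans h2⟩
  have key : ∀ N l, l ≤ N → ∀ n,
      ℙ.real (A N ∩ {ω | env t ω = r ∧ ∑ i ∈ Finset.range l, ξ i t ω = n}) =
        ℙ.real (A N) * (μ.real {r} * ((P r) ^ l).coeff n) := by
    intro N l
    induction l with
    | zero =>
      intro _ n
      rw [pow_zero, Polynomial.coeff_one]
      simp only [Finset.range_zero, Finset.sum_empty]
      split_ifs with hn
      · rw [mul_one, ← hξ.measureReal_inter_env h t N r (hAsat N)]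
        simp [hn]
      · simp [Ne.symm hn]
    | succ l ih =>
      intro hl n
      have hsum := hasSum_measureReal_inter_fiber ℙ (hξ.measurable_offspring l t)
        (A N ∩ {ω | env t ω = r ∧ ∑ i ∈ Finset.range (l + 1), ξ i t ω = n})
      refine hsum.unique ?_
      have hterm : ∀ v, ℙ.real ((A N ∩ {ω | env t ω = r ∧
          ∑ i ∈ Finset.range (l + 1), ξ i t ω = n}) ∩ ξ l t ⁻¹' {v}) =
          if v ≤ n then ℙ.real (A N) * (μ.real {r} * (((P r) ^ l).coeff (n - v) * (P r).coeff v))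
            else 0 := by
        intro v
        split_ifs with hv
        · have := hξ.measureReal_inter_offspring h t (Nat.lt_of_succ_le hl) r v
            (A := A N ∩ {ω | env t ω = r ∧ ∑ i ∈ Finset.range l, ξ i t ω = n - v}) ?_ ?_
          · rw [ih (by omega)] at this
            rw [← mul_assoc (μ.real {r}), ← mul_assoc, ← this]
            congr 1
            ext ω
            simp only [Set.mem_inter_iff, Set.mem_ofPred_eq, Set.mem_preimage,
              Set.mem_singleton_iff, Finset.sum_range_succ]
            constructor
            · rintro ⟨⟨h1, h2, h3⟩, h4⟩
              exact ⟨⟨h1, h2, by omega⟩, h4⟩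
            · rintro ⟨⟨h1, h2, h3⟩, h4⟩
              exact ⟨⟨h1, h2, by omega⟩, h4⟩
          · rintro ω ω' hh ⟨h1, h2, h3⟩
            obtain ⟨g1, g2, g3⟩ := history_eq_iff.1 hh
            refine ⟨hAsat N ω ω' g1 h1, g2.symm.trans h2, ?_⟩
            rw [← h3]
            exact Finset.sum_congr rfl fun i hi => (g3 i (Finset.mem_range.1 hi)).symm
          · rintro ω ⟨_, h2, _⟩
            exact h2
        · have : (A N ∩ {ω | env t ω = r ∧
              ∑ i ∈ Finset.range (l + 1), ξ i t ω = n}) ∩ ξ l t ⁻¹' {v} = ∅ := by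
            ext ω
            simp only [Set.mem_inter_iff, Set.mem_ofPred_eq, Set.mem_preimage,
              Set.mem_singleton_iff, Finset.sum_range_succ, Set.mem_empty_iff_false, iff_false]
            rintro ⟨⟨h1, h2, h3⟩, h4⟩
            omega
          rw [this]; simp
      simp only [hterm]
      have := hasSum_of_forall_notMem (f := fun v => if v ≤ n then
        ℙ.real (A N) * (μ.real {r} * (((P r) ^ l).coeff (n - v) * (P r).coeff v)) else 0)
        (Finset.range (n + 1)) fun v hv => by
          rw [if_neg (by simpa [Nat.lt_succ_iff] using hv)]
      convert this using 1
      rw [pow_succ, Polynomial.coeff_mul, Finset.Nat.sum_antidiagonal_eq_sum_range_succ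
        (fun a b => ((P r) ^ l).coeff a * (P r).coeff b), Finset.mul_sum, Finset.mul_sum,
        ← Finset.sum_range_reflect]
      refine Finset.sum_congr rfl fun v hv => ?_
      have hv' := Finset.mem_range.1 hv
      rw [if_pos (by omega)]
      congr 4; omega
  have hmono : Monotone A := fun N N' hN ω hω => ⟨fun s hs => (hω.1 s hs).trans hN, hω.2⟩
  have hU : ⋃ N, A N = {ω | population ξ j t ω = m} := by
    ext ω
    simp only [hA, Set.mem_iUnion, Set.mem_ofPred_eq]
    refine ⟨fun ⟨_, _, h2⟩ => h2, fun h2 => ⟨∑ s ∈ Finset.range (t + 1), population ξ j s ω,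
      fun s hs => ?_, h2⟩⟩
    exact Finset.single_le_sum (f := fun s => population ξ j s ω) (fun _ _ => Nat.zero_le _)
      (Finset.mem_range.2 (by omega))
  have hreal : ∀ {B : ℕ → Set Ω}, Monotone B →
      Tendsto (fun N => ℙ.real (B N)) atTop (𝓝 (ℙ.real (⋃ N, B N))) := fun hB =>
    (ENNReal.tendsto_toReal (measure_ne_top ℙ _)).comp (tendsto_measure_iUnion_atTop hB)
  have l1 := (hreal hmono).mul_const (μ.real {r} * ((P r) ^ l).coeff n)
  have l2 := hreal (B := fun N => A N ∩ {ω | env t ω = r ∧ ∑ i ∈ Finset.range l, ξ i t ω = n})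
    fun N N' hN => Set.inter_subset_inter_left _ (hmono hN)
  rw [← Set.iUnion_inter, hU] at l2
  rw [hU] at l1
  refine tendsto_nhds_unique l2 (l1.congr' ?_)
  filter_upwards [eventually_ge_atTop l] with N hN
  exact (key N l hN n).symm

/-- The Markov property of the population process. -/
lemma IsOffspringFamily.measureReal_population_pair (hξ : IsOffspringFamily μ P ℙ env ξ)
    (h : OffspringLaws μ P E) (j t m n : ℕ) :
    ℙ.real {ω | population ξ j t ω = m ∧ population ξ j (t + 1) ω = n} =
      ℙ.real {ω | population ξ j t ω = m} * trans μ P n m := by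
  have := hasSum_measureReal_inter_fiber ℙ (hξ.measurable_env t)
    {ω | population ξ j t ω = m ∧ population ξ j (t + 1) ω = n}
  refine this.unique ?_
  rw [trans, Finset.mul_sum]
  refine (hasSum_fintype _).congr_fun fun r => ?_
  rw [← hξ.measureReal_population_env_sum h]
  congr 1
  ext ω
  simp only [Set.mem_inter_iff, Set.mem_ofPred_eq, Set.mem_preimage, Set.mem_singleton_iff,
    population]
  constructor
  · rintro ⟨⟨h1, h2⟩, h3⟩
    exact ⟨h1, h3, by rw [← h1]; exact h2⟩
  · rintro ⟨h1, h3, h2⟩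
    exact ⟨⟨h1, by rw [h1]; exact h2⟩, h3⟩

/-- The law of the population at time `t`. -/
lemma IsOffspringFamily.measureReal_population (hξ : IsOffspringFamily μ P ℙ env ξ)
    (h : OffspringLaws μ P E) (j t n : ℕ) :
    ℙ.real {ω | population ξ j t ω = n} = (genPoly μ P j t).coeff n := by
  induction t generalizing n with
  | zero =>
    simp only [population, genPoly, Polynomial.coeff_X_pow]
    split_ifs with hn
    · simp [hn]
    · simp [Ne.symm hn]
  | succ t ih =>
    rw [h.coeff_genPoly_succ]
    refine (hasSum_measureReal_inter_fiber ℙ (hξ.measurable_population j t)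
      {ω | population ξ j (t + 1) ω = n}).unique ?_
    convert hasSum_of_forall_notMem (Finset.range (n + 1)) ?_ using 1
    · refine Finset.sum_congr rfl fun m _ => ?_
      rw [← ih m, ← hξ.measureReal_population_pair h]
      congr 1
      ext ω
      simp [and_comm]
    · intro m hm
      have := hξ.measureReal_population_pair h j t m n
      rw [h.trans_of_lt (by simpa [Nat.lt_succ_iff] using hm), mul_zero] at this
      rw [← this]
      congr 1
      ext ω
      simp [and_comm]

end BranchingLaw

/-! ### The eigenfunctions `Φ_j` in the unit disk -/

section Eigenfunctions

variable {R Ω : Type*} [Fintype R] [MeasurableSpace R] [MeasurableSingletonClass R]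
  [MeasurableSpace Ω] {μ : Measure R} [IsProbabilityMeasure μ] {P : R → Polynomial ℝ} {E : ℝ}
  {ℙ : Measure Ω} [IsProbabilityMeasure ℙ] {env : ℕ → Ω → R} {ξ : ℕ → ℕ → Ω → ℕ}

lemma IsOffspringFamily.rareRatio_eq (hξ : IsOffspringFamily μ P ℙ env ξ)
    (h : OffspringLaws μ P E) (n j t : ℕ) :
    rareRatio ℙ ξ n j t = (genPoly μ P j t).coeff n / q μ P j ^ t := by
  rw [rareRatio, hξ.measureReal_population h, hξ.measureReal_population h, h.coeff_genPoly_self]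

lemma IsOffspringFamily.tendsto_rareRatio (hξ : IsOffspringFamily μ P ℙ env ξ)
    (h : OffspringLaws μ P E) (n j : ℕ) :
    Tendsto (rareRatio ℙ ξ n j) atTop (𝓝 (phi ℙ ξ n j)) := by
  refine tendsto_nhds_limUnder ?_
  obtain ⟨l, hl⟩ := h.exists_tendsto_ratio n j
  exact ⟨l, hl.congr fun t => (hξ.rareRatio_eq h n j t).symm⟩

lemma IsOffspringFamily.tendsto_ratio (hξ : IsOffspringFamily μ P ℙ env ξ)
    (h : OffspringLaws μ P E) (n j : ℕ) :
    Tendsto (fun t => (genPoly μ P j t).coeff n / q μ P j ^ t) atTop (𝓝 (phi ℙ ξ n j)) :=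
  (hξ.tendsto_rareRatio h n j).congr fun t => hξ.rareRatio_eq h n j t

lemma IsOffspringFamily.ratio_le_phi (hξ : IsOffspringFamily μ P ℙ env ξ)
    (h : OffspringLaws μ P E) (n j t : ℕ) :
    (genPoly μ P j t).coeff n / q μ P j ^ t ≤ phi ℙ ξ n j :=
  (h.monotone_ratio n j).ge_of_tendsto (hξ.tendsto_ratio h n j) t

lemma OffspringLaws.ratio_nonneg (h : OffspringLaws μ P E) (n j t : ℕ) :
    0 ≤ (genPoly μ P j t).coeff n / q μ P j ^ t :=
  div_nonneg (h.coeff_genPoly_nonneg j t n) (pow_nonneg (h.q_pos' j).le t)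

lemma IsOffspringFamily.phi_nonneg (hξ : IsOffspringFamily μ P ℙ env ξ)
    (h : OffspringLaws μ P E) (n j : ℕ) : 0 ≤ phi ℙ ξ n j :=
  (h.ratio_nonneg n j 0).trans (hξ.ratio_le_phi h n j 0)

lemma IsOffspringFamily.summable_phi_real (hξ : IsOffspringFamily μ P ℙ env ξ)
    (h : OffspringLaws μ P E) (j : ℕ) {ρ : ℝ} (hρ0 : 0 ≤ ρ) (hρ : ρ < 1) :
    Summable fun n => phi ℙ ξ (j + n) j * ρ ^ (j + n) := by
  obtain ⟨B, hB⟩ := h.sum_ratio_le j hρ0 hρ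
  have : Summable fun n => phi ℙ ξ n j * ρ ^ n := by
    refine summable_of_sum_le (c := B) (fun n => mul_nonneg (hξ.phi_nonneg h n j) (by positivity))
      fun s => ?_
    refine le_of_tendsto' (x := atTop) ?_ fun t => hB t s
    exact tendsto_finsetSum _ fun n _ => (hξ.tendsto_ratio h n j).mul_const _
  exact this.comp_injective (add_right_injective j)

lemma norm_phi_term (hξ : IsOffspringFamily μ P ℙ env ξ) (h : OffspringLaws μ P E) (n j : ℕ)
    (z : ℂ) : ‖(phi ℙ ξ n j : ℂ) * z ^ n‖ = phi ℙ ξ n j * ‖z‖ ^ n := by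
  rw [norm_mul, norm_pow, Complex.norm_real, Real.norm_of_nonneg (hξ.phi_nonneg h n j)]

lemma IsOffspringFamily.summable_phi (hξ : IsOffspringFamily μ P ℙ env ξ)
    (h : OffspringLaws μ P E) (j : ℕ) {z : ℂ} (hz : ‖z‖ < 1) :
    Summable fun n => (phi ℙ ξ (j + n) j : ℂ) * z ^ (j + n) := by
  refine Summable.of_norm ?_
  simp only [norm_phi_term hξ h]
  exact hξ.summable_phi_real h j (norm_nonneg z) hz

/-- The coefficients of `Φ_j` are non-negative and start with index `j`. -/
lemma IsOffspringFamily.norm_Phi_le (hξ : IsOffspringFamily μ P ℙ env ξ)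
    (h : OffspringLaws μ P E) (j : ℕ) {ρ : ℝ} (hρ0 : 0 < ρ) (hρ : ρ < 1) {z : ℂ} (hz : ‖z‖ ≤ ρ) :
    ‖Phi ℙ ξ j z‖ ≤ (‖z‖ / ρ) ^ j * ‖Phi ℙ ξ j ρ‖ := by
  have h1 : Phi ℙ ξ j ρ = ((∑' n, phi ℙ ξ (j + n) j * ρ ^ (j + n) : ℝ) : ℂ) := by
    rw [Phi, Complex.ofReal_tsum]
    exact tsum_congr fun n => by push_cast; ring
  have hnn : ∀ n, 0 ≤ phi ℙ ξ (j + n) j * ρ ^ (j + n) := fun n =>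
    mul_nonneg (hξ.phi_nonneg h _ j) (by positivity)
  rw [h1, Complex.norm_real, Real.norm_of_nonneg (tsum_nonneg hnn), ← tsum_mul_left]
  refine tsum_of_norm_bounded ((hξ.summable_phi_real h j hρ0.le hρ).mul_left _).hasSum fun n => ?_
  rw [norm_phi_term hξ h]
  calc phi ℙ ξ (j + n) j * ‖z‖ ^ (j + n) = (‖z‖ / ρ) ^ j *
        (phi ℙ ξ (j + n) j * (ρ ^ j * ‖z‖ ^ n)) := by
        rw [div_pow, pow_add]; field_simp
    _ ≤ _ := by
        rw [pow_add]
        have := hξ.phi_nonneg h (j + n) j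
        gcongr

lemma IsOffspringFamily.norm_Phi_le' (hξ : IsOffspringFamily μ P ℙ env ξ)
    (h : OffspringLaws μ P E) (j : ℕ) {ρ : ℝ} (hρ0 : 0 < ρ) (hρ : ρ < 1) {z : ℂ} (hz : ‖z‖ ≤ ρ) :
    ‖Phi ℙ ξ j z‖ ≤ ‖Phi ℙ ξ j ρ‖ := by
  refine (hξ.norm_Phi_le h j hρ0 hρ hz).trans (mul_le_of_le_one_left (norm_nonneg _) ?_)
  exact pow_le_one₀ (by positivity) (by rwa [div_le_one hρ0])

lemma IsOffspringFamily.differentiableAt_Phi (hξ : IsOffspringFamily μ P ℙ env ξ)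
    (h : OffspringLaws μ P E) (j : ℕ) {z : ℂ} (hz : z ∈ Metric.ball (0 : ℂ) 1) :
    DifferentiableAt ℂ (Phi ℙ ξ j) z := by
  rw [mem_ball_zero_iff] at hz
  obtain ⟨ρ, hzρ, hρ⟩ := exists_between hz
  have hρ0 : 0 ≤ ρ := (norm_nonneg z).trans hzρ.le
  have := Complex.differentiableOn_tsum_of_summable_norm
    (F := fun n (w : ℂ) => (phi ℙ ξ (j + n) j : ℂ) * w ^ (j + n))
    (hξ.summable_phi_real h j hρ0 hρ) (fun n => by fun_prop) (Metric.isOpen_ball (x := 0) (ε := ρ))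
    (fun n w hw => by
      rw [norm_phi_term hξ h]
      have := hξ.phi_nonneg h (j + n) j
      have := (mem_ball_zero_iff.1 hw).le
      gcongr)
  exact (this z (by simpa using hzρ)).differentiableAt
    (Metric.isOpen_ball.mem_nhds (by simpa using hzρ))

lemma IsOffspringFamily.tendsto_Phi (hξ : IsOffspringFamily μ P ℙ env ξ)
    (h : OffspringLaws μ P E) (j : ℕ) {z : ℂ} (hz : ‖z‖ < 1) :
    Tendsto (fun t => annealed μ P (fun w => w ^ j) t z / (q μ P j : ℂ) ^ t) atTop
      (𝓝 (Phi ℙ ξ j z)) := by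
  have hsum : ∀ t, annealed μ P (fun w => w ^ j) t z / (q μ P j : ℂ) ^ t =
      ∑' n, (((genPoly μ P j t).coeff (j + n) / q μ P j ^ t : ℝ) : ℂ) * z ^ (j + n) := by
    intro t
    have h1 : HasSum (fun n => ((genPoly μ P j t).coeff n : ℂ) * z ^ n)
        (Polynomial.aeval z (genPoly μ P j t)) := by
      have : HasSum (fun n => ((genPoly μ P j t).coeff n : ℂ) * z ^ n)
          (∑ n ∈ Finset.range ((genPoly μ P j t).natDegree + 1),
            ((genPoly μ P j t).coeff n : ℂ) * z ^ n) :=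
        hasSum_sum_of_ne_finset_zero fun n hn => by
          rw [Polynomial.coeff_eq_zero_of_natDegree_lt (by simpa [Nat.lt_succ_iff] using hn)]
          simp
      rw [Polynomial.aeval_eq_sum_range]
      simpa only [Complex.real_smul] using this
    have h2 := (hasSum_nat_add_iff' j).2 h1
    rw [Finset.sum_eq_zero fun n hn => by
      rw [h.coeff_genPoly_of_lt (Finset.mem_range.1 hn)]; simp, sub_zero] at h2
    rw [← aeval_genPoly, ← h2.tsum_eq, ← tsum_div_const]
    refine tsum_congr fun n => ?_
    rw [add_comm n j]
    push_cast
    ring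
  simp only [hsum]
  refine tendsto_tsum_of_dominated_convergence (hξ.summable_phi_real h j (norm_nonneg z) hz)
    (fun n => ?_) (Eventually.of_forall fun t n => ?_)
  · exact ((Complex.continuous_ofReal.tendsto _).comp (hξ.tendsto_ratio h (j + n) j)).mul_const _
  · rw [norm_mul, norm_pow, Complex.norm_real, Real.norm_of_nonneg (h.ratio_nonneg _ j t)]
    exact mul_le_mul_of_nonneg_right (hξ.ratio_le_phi h _ j t) (by positivity)

/-- The Schröder equation: `Φ_j` is an eigenfunction of the averaging operator. -/
lemma IsOffspringFamily.annealed_Phi (hξ : IsOffspringFamily μ P ℙ env ξ)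
    (h : OffspringLaws μ P E) (j : ℕ) {z : ℂ} (hz : z ∈ Metric.ball (0 : ℂ) 1) :
    annealed μ P (Phi ℙ ξ j) 1 z = q μ P j * Phi ℙ ξ j z := by
  rw [mem_ball_zero_iff] at hz
  have hq : (q μ P j : ℂ) ≠ 0 := by exact_mod_cast (h.q_pos' j).ne'
  have h1 := ((hξ.tendsto_Phi h j hz).comp (tendsto_add_atTop_nat 1)).const_mul (q μ P j : ℂ)
  refine tendsto_nhds_unique ?_ h1
  have h2 : Tendsto (fun t => ∑ r, (μ.real {r} : ℂ) *
      (annealed μ P (fun w => w ^ j) t (gen P r z) / (q μ P j : ℂ) ^ t)) atTop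
      (𝓝 (∑ r, (μ.real {r} : ℂ) * Phi ℙ ξ j (gen P r z))) :=
    tendsto_finsetSum _ fun r _ => (hξ.tendsto_Phi h j
      ((h.norm_gen_le_self r hz.le).trans_lt hz)).const_mul _
  rw [annealed_succ]
  refine h2.congr fun t => ?_
  rw [Function.comp, annealed_succ, pow_succ, Finset.sum_div, Finset.mul_sum]
  refine Finset.sum_congr rfl fun r _ => ?_
  field_simp

end Eigenfunctions

/-! ### The martingale limit -/

section Moments

variable {R Ω : Type*} [Fintype R] [MeasurableSpace R] [MeasurableSingletonClass R]
  [MeasurableSpace Ω] {μ : Measure R} [IsProbabilityMeasure μ] {P : R → Polynomial ℝ} {E : ℝ}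
  {ℙ : Measure Ω} [IsProbabilityMeasure ℙ] {env : ℕ → Ω → R} {ξ : ℕ → ℕ → Ω → ℕ}

lemma hasSum_coeff (p : Polynomial ℝ) : HasSum (fun n => p.coeff n) (p.eval 1) := by
  have := hasSum_of_forall_notMem (f := fun n => p.coeff n) (Finset.range (p.natDegree + 1))
    fun n hn => Polynomial.coeff_eq_zero_of_natDegree_lt (by simpa [Nat.lt_succ_iff] using hn)
  rw [Polynomial.eval_eq_sum_range]
  simpa using this

lemma coeff_X_mul_derivative (p : Polynomial ℝ) (n : ℕ) :
    (Polynomial.X * Polynomial.derivative p).coeff n = p.coeff n * n := by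
  rcases n with _ | n
  · simp
  · rw [Polynomial.coeff_X_mul, Polynomial.coeff_derivative]; push_cast; ring

lemma hasSum_coeff_mul (p : Polynomial ℝ) :
    HasSum (fun n => p.coeff n * n) ((Polynomial.derivative p).eval 1) := by
  have := hasSum_coeff (Polynomial.X * Polynomial.derivative p)
  simpa only [coeff_X_mul_derivative, Polynomial.eval_mul, Polynomial.eval_X, one_mul] using this

lemma hasSum_coeff_mul_sq (p : Polynomial ℝ) :
    HasSum (fun n => p.coeff n * (n : ℝ) ^ 2)
      ((Polynomial.derivative p).eval 1 + (Polynomial.derivative (Polynomial.derivative p)).eval 1)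
    := by
  have := hasSum_coeff_mul (Polynomial.X * Polynomial.derivative p)
  simp only [coeff_X_mul_derivative, Polynomial.derivative_mul, Polynomial.derivative_X, one_mul,
    Polynomial.eval_add, Polynomial.eval_mul, Polynomial.eval_X, mul_assoc, ← sq] at this
  exact this

/-- The variance of the number of children of `m` individuals. -/
lemma OffspringLaws.hasSum_variance (h : OffspringLaws μ P E) :
    ∃ V, 0 ≤ V ∧ ∀ m : ℕ, HasSum (fun n : ℕ => ((n : ℝ) - E * m) ^ 2 * trans μ P n m) (m * V) := by
  set v : R → ℝ := fun r => (Polynomial.derivative (Polynomial.derivative (P r))).eval 1 + E - E ^ 2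
    with hv
  have key : ∀ r (m : ℕ), HasSum (fun n : ℕ => ((n : ℝ) - E * m) ^ 2 * ((P r) ^ m).coeff n)
      (m * v r) := by
    intro r m
    have h0 := (hasSum_coeff ((P r) ^ m)).mul_left ((E * m) ^ 2)
    have h1 := (hasSum_coeff_mul ((P r) ^ m)).mul_left (2 * (E * m))
    have h2 := hasSum_coeff_mul_sq ((P r) ^ m)
    have hval : (Polynomial.derivative ((P r) ^ m)).eval 1 +
        (Polynomial.derivative (Polynomial.derivative ((P r) ^ m))).eval 1 -
        2 * (E * m) * (Polynomial.derivative ((P r) ^ m)).eval 1 +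
        (E * m) ^ 2 * ((P r) ^ m).eval 1 = m * v r := by
      rcases m with _ | k
      · simp
      · simp only [Polynomial.derivative_pow, Polynomial.derivative_mul, Polynomial.eval_add,
          Polynomial.eval_mul, Polynomial.eval_pow, h.eval_one, h.mean, one_pow,
          Polynomial.derivative_C, Polynomial.eval_C, Polynomial.eval_zero, hv]
        push_cast
        simp
        ring
    rw [← hval]
    exact ((h2.sub h1).add h0).congr_fun fun n => by ring
  refine ⟨∑ r, μ.real {r} * v r, Finset.sum_nonneg fun r _ => mul_nonneg measureReal_nonneg ?_,
    fun m => ?_⟩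
  · have := (key r 1).nonneg fun n => mul_nonneg (sq_nonneg _) (h.coeff_pow_nonneg r 1 n)
    simpa using this
  · have := hasSum_sum (s := Finset.univ) fun r (_ : r ∈ Finset.univ) =>
      (key r m).mul_left (μ.real {r})
    have hval : (m : ℝ) * ∑ r, μ.real {r} * v r = ∑ r, μ.real {r} * (m * v r) := by
      rw [Finset.mul_sum]
      exact Finset.sum_congr rfl fun r _ => by ring
    rw [hval]
    refine this.congr_fun fun n => ?_
    rw [trans, Finset.mul_sum]
    exact Finset.sum_congr rfl fun r _ => by ring

lemma OffspringLaws.derivative_genPoly (h : OffspringLaws μ P E) (t : ℕ) :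
    (Polynomial.derivative (genPoly μ P 1 t)).eval 1 = E ^ t := by
  induction t with
  | zero => simp [genPoly]
  | succ t ih =>
    simp only [genPoly, map_sum, Polynomial.derivative_mul, Polynomial.derivative_C, zero_mul,
      zero_add, Polynomial.derivative_comp, Polynomial.eval_finsetSum, Polynomial.eval_mul,
      Polynomial.eval_C, Polynomial.eval_comp, h.eval_one, h.mean, ih]
    rw [← Finset.sum_mul, sum_measureReal_singleton]
    ring

/-- In `E^{-t} X_t` the `t`-th increment thus has second moment `V E^{-t-2}`, which is summable. -/
lemma IsOffspringFamily.lintegral_increment (hξ : IsOffspringFamily μ P ℙ env ξ)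
    (h : OffspringLaws μ P E) : ∃ V, 0 ≤ V ∧ ∀ t : ℕ,
      ∫⁻ ω, ENNReal.ofReal (((population ξ 1 (t + 1) ω : ℝ) - E * population ξ 1 t ω) ^ 2) ∂ℙ =
        ENNReal.ofReal (V * E ^ t) := by
  obtain ⟨V, hV0, hV⟩ := h.hasSum_variance
  refine ⟨V, hV0, fun t => ?_⟩
  have hm : Measurable fun ω => (population ξ 1 t ω, population ξ 1 (t + 1) ω) :=
    (hξ.measurable_population 1 t).prodMk (hξ.measurable_population 1 (t + 1))
  have e1 : ∫⁻ ω, ENNReal.ofReal (((population ξ 1 (t + 1) ω : ℝ) - E * population ξ 1 t ω) ^ 2) ∂ℙ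
      = ∫⁻ p : ℕ × ℕ, ENNReal.ofReal (((p.2 : ℝ) - E * p.1) ^ 2)
        ∂(ℙ.map fun ω => (population ξ 1 t ω, population ξ 1 (t + 1) ω)) := by
    rw [lintegral_map (measurable_of_countable _) hm]
  have hterm : ∀ m n : ℕ, ENNReal.ofReal (((n : ℝ) - E * m) ^ 2) *
      (ℙ.map fun ω => (population ξ 1 t ω, population ξ 1 (t + 1) ω)) {(m, n)} =
      ENNReal.ofReal (((n : ℝ) - E * m) ^ 2 * trans μ P n m * (genPoly μ P 1 t).coeff m) := by
    intro m n
    rw [Measure.map_apply hm (measurableSet_singleton _)]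
    have : (fun ω => (population ξ 1 t ω, population ξ 1 (t + 1) ω)) ⁻¹' {(m, n)} =
        {ω | population ξ 1 t ω = m ∧ population ξ 1 (t + 1) ω = n} := by
      ext ω; simp
    rw [this, ← ofReal_measureReal, hξ.measureReal_population_pair h, hξ.measureReal_population h,
      ← ENNReal.ofReal_mul (sq_nonneg _)]
    congr 1
    ring
  rw [e1, lintegral_countable', ENNReal.tsum_prod']
  simp only [hterm]
  have hn : ∀ m n : ℕ, 0 ≤ ((n : ℝ) - E * m) ^ 2 * trans μ P n m * (genPoly μ P 1 t).coeff m :=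
    fun m n => mul_nonneg (mul_nonneg (sq_nonneg _) (h.trans_nonneg n m))
      (h.coeff_genPoly_nonneg 1 t m)
  have hinner : ∀ m : ℕ, ∑' n : ℕ, ENNReal.ofReal
      (((n : ℝ) - E * m) ^ 2 * trans μ P n m * (genPoly μ P 1 t).coeff m) =
      ENNReal.ofReal (V * ((genPoly μ P 1 t).coeff m * m)) := by
    intro m
    have hs := (hV m).mul_right ((genPoly μ P 1 t).coeff m)
    rw [← ENNReal.ofReal_tsum_of_nonneg (hn m) hs.summable, hs.tsum_eq]
    congr 1
    ring
  simp only [hinner]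
  have hs := (hasSum_coeff_mul (genPoly μ P 1 t)).mul_left V
  rw [← ENNReal.ofReal_tsum_of_nonneg (fun m => mul_nonneg hV0
    (mul_nonneg (h.coeff_genPoly_nonneg 1 t m) (Nat.cast_nonneg m))) hs.summable, hs.tsum_eq,
    h.derivative_genPoly]

/-- The normalized population converges almost surely: by the variance estimate the increments
decay geometrically along almost every path. -/
lemma IsOffspringFamily.ae_tendsto_martingaleLimit (hξ : IsOffspringFamily μ P ℙ env ξ)
    (h : OffspringLaws μ P E) :
    ∀ᵐ ω ∂ℙ, Tendsto (fun t : ℕ => (population ξ 1 t ω : ℝ) / E ^ t) atTop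
      (𝓝 (martingaleLimit E ξ ω)) := by
  obtain ⟨V, hV0, hV⟩ := hξ.lintegral_increment h
  have hE := h.one_lt
  have hE0 : 0 < E := by linarith
  -- a rate `c` strictly between `1` and `E`
  obtain ⟨c, hc1, hcE⟩ := exists_between hE
  have hc0 : 0 < c := by linarith
  set D : ℕ → Ω → ℝ := fun t ω =>
    ((population ξ 1 (t + 1) ω : ℝ) - E * population ξ 1 t ω) ^ 2 with hD
  have hDm : ∀ t, Measurable (D t) := fun t => by
    have h1 : Measurable fun ω => (population ξ 1 t ω : ℝ) :=
      (measurable_of_countable _).comp (hξ.measurable_population 1 t)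
    have h2 : Measurable fun ω => (population ξ 1 (t + 1) ω : ℝ) :=
      (measurable_of_countable _).comp (hξ.measurable_population 1 (t + 1))
    exact (h2.sub (h1.const_mul E)).pow_const 2
  have hfin : ∫⁻ ω, ∑' t, ENNReal.ofReal ((c / E ^ 2) ^ t * D t ω) ∂ℙ ≠ ⊤ := by
    rw [lintegral_tsum fun t => ((hDm t).const_mul _).ennreal_ofReal.aemeasurable]
    have : ∀ t, ∫⁻ ω, ENNReal.ofReal ((c / E ^ 2) ^ t * D t ω) ∂ℙ =
        ENNReal.ofReal (V * (c / E) ^ t) := by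
      intro t
      simp_rw [ENNReal.ofReal_mul (show (0 : ℝ) ≤ (c / E ^ 2) ^ t by positivity)]
      rw [lintegral_const_mul _ (hDm t).ennreal_ofReal, hV t,
        ← ENNReal.ofReal_mul (by positivity)]
      congr 1
      rw [mul_left_comm, ← mul_pow]
      congr 2
      field_simp
    simp only [this]
    have hs : Summable fun t : ℕ => V * (c / E) ^ t :=
      (summable_geometric_of_lt_one (by positivity) (by rwa [div_lt_one hE0])).mul_left V
    rw [← ENNReal.ofReal_tsum_of_nonneg (fun t => by positivity) hs]
    exact ENNReal.ofReal_ne_top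
  have hae := ae_lt_top (Measurable.tsum fun t => ((hDm t).const_mul _).ennreal_ofReal) hfin
  filter_upwards [hae] with ω hω
  refine tendsto_nhds_limUnder ?_
  set B := (∑' t, ENNReal.ofReal ((c / E ^ 2) ^ t * D t ω)).toReal with hB
  have hbound : ∀ t, (c / E ^ 2) ^ t * D t ω ≤ B := by
    intro t
    rw [← ENNReal.ofReal_le_iff_le_toReal hω.ne]
    exact ENNReal.le_tsum t
  have hB0 : 0 ≤ B := ENNReal.toReal_nonneg
  refine cauchySeq_tendsto_of_complete (cauchySeq_of_le_geometric (1 / Real.sqrt c)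
    (Real.sqrt B / E) ?_ fun t => ?_)
  · rw [div_lt_one (Real.sqrt_pos.2 hc0), Real.lt_sqrt (by norm_num)]
    linarith
  · have e1 : (population ξ 1 t ω : ℝ) / E ^ t - (population ξ 1 (t + 1) ω : ℝ) / E ^ (t + 1) =
        -(((population ξ 1 (t + 1) ω : ℝ) - E * population ξ 1 t ω) / E ^ (t + 1)) := by
      field_simp; ring
    rw [Real.dist_eq, e1, abs_neg]
    refine abs_le_of_sq_le_sq ?_ (by positivity)
    have e2 : (Real.sqrt B / E * (1 / Real.sqrt c) ^ t) ^ 2 = B / E ^ 2 * (1 / c) ^ t := by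
      rw [mul_pow, div_pow, Real.sq_sqrt hB0, ← pow_mul, mul_comm t 2, pow_mul, div_pow,
        Real.sq_sqrt hc0.le, one_pow]
    rw [e2, div_pow]
    have e3 : D t ω ≤ B * (E ^ 2 / c) ^ t := by
      have := hbound t
      have hx : (c / E ^ 2) ^ t * (E ^ 2 / c) ^ t = 1 := by
        rw [← mul_pow]; field_simp; exact one_pow t
      calc D t ω = ((c / E ^ 2) ^ t * D t ω) * (E ^ 2 / c) ^ t := by
            rw [mul_right_comm, hx, one_mul]
        _ ≤ _ := by gcongr
    rw [div_le_iff₀ (by positivity)]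
    refine e3.trans (le_of_eq ?_)
    rw [div_pow, ← pow_mul, ← pow_mul, div_pow, one_pow]
    field_simp
    ring

lemma IsOffspringFamily.aemeasurable_martingaleLimit (hξ : IsOffspringFamily μ P ℙ env ξ)
    (h : OffspringLaws μ P E) : AEMeasurable (martingaleLimit E ξ) ℙ :=
  aemeasurable_of_tendsto_metrizable_ae atTop (fun t => by
    have h1 : Measurable fun ω => (population ξ 1 t ω : ℝ) :=
      (measurable_of_countable _).comp (hξ.measurable_population 1 t)
    exact (h1.div_const _).aemeasurable) (hξ.ae_tendsto_martingaleLimit h)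

lemma IsOffspringFamily.ae_martingaleLimit_nonneg (hξ : IsOffspringFamily μ P ℙ env ξ)
    (h : OffspringLaws μ P E) : ∀ᵐ ω ∂ℙ, 0 ≤ martingaleLimit E ξ ω := by
  have hE := h.one_lt
  filter_upwards [hξ.ae_tendsto_martingaleLimit h] with ω hω
  exact ge_of_tendsto' hω fun t => by positivity

lemma IsOffspringFamily.integral_pow_population (hξ : IsOffspringFamily μ P ℙ env ξ)
    (h : OffspringLaws μ P E) (t : ℕ) {y : ℂ} (hy : ‖y‖ ≤ 1) :
    ∫ ω, y ^ population ξ 1 t ω ∂ℙ = annealed μ P id t y := by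
  have hm := hξ.measurable_population 1 t
  have hprob : IsProbabilityMeasure (ℙ.map (population ξ 1 t)) :=
    Measure.isProbabilityMeasure_map hm.aemeasurable
  have e1 : ∫ ω, y ^ population ξ 1 t ω ∂ℙ = ∫ n : ℕ, y ^ n ∂(ℙ.map (population ξ 1 t)) := by
    rw [integral_map hm.aemeasurable (measurable_of_countable _).aestronglyMeasurable]
  have hint : Integrable (fun n : ℕ => y ^ n) (ℙ.map (population ξ 1 t)) :=
    Integrable.of_bound (measurable_of_countable _).aestronglyMeasurable 1
      (Eventually.of_forall fun n => by
        rw [norm_pow]; exact pow_le_one₀ (norm_nonneg _) hy)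
  have hid : annealed μ P id t y = annealed μ P (fun w => w ^ 1) t y := by
    simp only [pow_one]; rfl
  rw [e1, integral_countable hint, hid, ← aeval_genPoly, Polynomial.aeval_eq_sum_range]
  rw [tsum_eq_sum (s := Finset.range ((genPoly μ P 1 t).natDegree + 1))]
  · refine Finset.sum_congr rfl fun n _ => ?_
    rw [← hξ.measureReal_population h, map_measureReal_apply hm (measurableSet_singleton _)]
    rfl
  · intro n hn
    rw [map_measureReal_apply hm (measurableSet_singleton _)]
    have := hξ.measureReal_population h 1 t n
    rw [Polynomial.coeff_eq_zero_of_natDegree_lt (by simpa [Nat.lt_succ_iff] using hn)] at this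
    have h2 : ℙ.real (population ξ 1 t ⁻¹' {n}) = 0 := this
    rw [h2, zero_smul]

lemma tendsto_mul_log_one_sub {E : ℝ} (hE : 1 < E) (z : ℂ) :
    Tendsto (fun t : ℕ => (E : ℂ) ^ t * Complex.log (1 - z / (E : ℂ) ^ t)) atTop (𝓝 (-z)) := by
  have h1 : HasDerivAt (fun u : ℂ => Complex.log (1 - z * u)) (-z) 0 := by
    have h2 : HasDerivAt (fun u : ℂ => 1 - z * u) (-(z * 1)) 0 :=
      ((hasDerivAt_id (0 : ℂ)).const_mul z).const_sub 1
    have := h2.clog (by simp)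
    simpa using this
  have h3 := h1.tendsto_slope_zero
  have hlim : Tendsto (fun t : ℕ => ((E : ℂ) ^ t)⁻¹) atTop (𝓝[≠] 0) := by
    have hE0 : (E : ℂ) ≠ 0 := by exact_mod_cast (by linarith : E ≠ 0)
    refine tendsto_nhdsWithin_iff.2 ⟨?_, Eventually.of_forall fun t => by simp [hE0]⟩
    simp_rw [← inv_pow]
    refine tendsto_pow_atTop_nhds_zero_of_norm_lt_one ?_
    rw [norm_inv, Complex.norm_real, Real.norm_of_nonneg (by linarith)]
    exact inv_lt_one_of_one_lt₀ hE
  refine (h3.comp hlim).congr fun t => ?_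
  simp [div_eq_mul_inv]

lemma eventually_norm_one_sub_lt_one {E : ℝ} (hE : 1 < E) {z : ℂ} (hz : 0 < z.re) :
    ∀ᶠ t : ℕ in atTop, ‖1 - z / (E : ℂ) ^ t‖ < 1 := by
  have hz0 : 0 < ‖z‖ := norm_pos_iff.2 (by rintro rfl; simp at hz)
  filter_upwards [(tendsto_pow_atTop_atTop_of_one_lt hE).eventually_gt_atTop
    (‖z‖ ^ 2 / (2 * z.re))] with t ht
  set s : ℝ := E ^ t with hs
  have hs0 : 0 < s := by positivity
  have e : z / (E : ℂ) ^ t = ((s⁻¹ : ℝ) : ℂ) * z := by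
    rw [hs]; push_cast; rw [div_eq_inv_mul]
  rw [← sq_lt_one_iff₀ (norm_nonneg _), e, Complex.sq_norm, Complex.normSq_apply]
  rw [Complex.sq_norm, Complex.normSq_apply, div_lt_iff₀ (by positivity)] at ht
  simp only [Complex.sub_re, Complex.one_re, Complex.re_ofReal_mul, Complex.sub_im,
    Complex.one_im, Complex.im_ofReal_mul, zero_sub]
  have : s⁻¹ * s = 1 := inv_mul_cancel₀ hs0.ne'
  have hi : 0 < s⁻¹ := by positivity
  have h5 : s⁻¹ * (s⁻¹ * (z.re * z.re + z.im * z.im)) < s⁻¹ * (2 * z.re) := by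
    refine mul_lt_mul_of_pos_left ?_ hi
    rw [inv_mul_lt_iff₀ hs0]; exact ht
  nlinarith

/-- The function `Π` is the Laplace transform of the martingale limit. -/
lemma IsOffspringFamily.tendsto_annealed_id (hξ : IsOffspringFamily μ P ℙ env ξ)
    (h : OffspringLaws μ P E) {z : ℂ} (hz : 0 < z.re) :
    Tendsto (fun t : ℕ => annealed μ P id t (1 - z / (E : ℂ) ^ t)) atTop
      (𝓝 (∫ ω, Complex.exp (-z * martingaleLimit E ξ ω) ∂ℙ)) := by
  have hE := h.one_lt
  have hev := eventually_norm_one_sub_lt_one hE hz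
  have hlog := tendsto_mul_log_one_sub hE z
  have hne : ∀ᶠ t : ℕ in atTop, 1 - z / (E : ℂ) ^ t ≠ 0 := by
    have hdiv : Tendsto (fun t : ℕ => 1 - z / (E : ℂ) ^ t) atTop (𝓝 (1 - 0)) := by
      refine tendsto_const_nhds.sub ?_
      have : Tendsto (fun t : ℕ => z * ((E : ℂ)⁻¹) ^ t) atTop (𝓝 (z * 0)) := by
        refine (tendsto_pow_atTop_nhds_zero_of_norm_lt_one ?_).const_mul z
        rw [norm_inv, Complex.norm_real, Real.norm_of_nonneg (by linarith)]
        exact inv_lt_one_of_one_lt₀ hE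
      rw [mul_zero] at this
      refine this.congr fun t => ?_
      rw [inv_pow, div_eq_mul_inv]
    exact hdiv.eventually_ne (by simp)
  have hmain : Tendsto (fun t : ℕ => ∫ ω, (1 - z / (E : ℂ) ^ t) ^ population ξ 1 t ω ∂ℙ) atTop
      (𝓝 (∫ ω, Complex.exp (-z * martingaleLimit E ξ ω) ∂ℙ)) := by
    refine tendsto_integral_filter_of_dominated_convergence (fun _ => 1) ?_ ?_
      (integrable_const _) ?_
    · exact Eventually.of_forall fun t => ((measurable_of_countable _).comp
        (hξ.measurable_population 1 t)).aestronglyMeasurable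
    · filter_upwards [hev] with t ht
      exact Eventually.of_forall fun ω => by
        rw [norm_pow]; exact pow_le_one₀ (norm_nonneg _) ht.le
    · filter_upwards [hξ.ae_tendsto_martingaleLimit h] with ω hω
      have h1 := hlog.mul ((Complex.continuous_ofReal.tendsto _).comp hω)
      refine ((Complex.continuous_exp.tendsto _).comp h1).congr' ?_
      filter_upwards [hne] with t ht
      have hE0 : (E : ℂ) ≠ 0 := by exact_mod_cast (by linarith : E ≠ 0)
      simp only [Function.comp]
      have : (E : ℂ) ^ t * Complex.log (1 - z / (E : ℂ) ^ t) *
          (((population ξ 1 t ω : ℝ) / E ^ t : ℝ) : ℂ) =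
          (population ξ 1 t ω : ℕ) * Complex.log (1 - z / (E : ℂ) ^ t) := by
        push_cast
        field_simp
      rw [this, Complex.exp_nat_mul, Complex.exp_log ht]
  refine hmain.congr' ?_
  filter_upwards [hev] with t ht
  exact hξ.integral_pow_population h t ht.le

end Moments

/-! ### Renormalization at the repelling fixed point -/

/-- The renormalized limit `lim ∫ ⋯ ∫ f (P_{r_t} ∘ ⋯ ∘ P_{r_1} (1 - z / Eᵗ))`. Both `PiFun` (with
`f = id`) and `K` (with `f = Φ_j`) are of this form. -/
noncomputable def renorm {R : Type*} [MeasurableSpace R] (μ : Measure R) (P : R → Polynomial ℝ)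
    (E : ℝ) (f : ℂ → ℂ) (z : ℂ) : ℂ :=
  limUnder atTop fun t : ℕ => annealed μ P f t (1 - z / (E : ℂ) ^ t)

section Renormalization

variable {R : Type*} [Fintype R] [MeasurableSpace R] [MeasurableSingletonClass R]
  {μ : Measure R} [IsProbabilityMeasure μ] {P : R → Polynomial ℝ} {E : ℝ}

/-- One more step changes the approximation at `w` to an average of its values at points within
`O(E⁻ᵗ)` of `w`; by the Schwarz lemma a locally bounded family of approximations therefore
converges geometrically fast. -/
lemma OffspringLaws.tendstoUniformlyOn_renorm (h : OffspringLaws μ P E) {f : ℂ → ℂ} {w₀ : ℂ}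
    {δ C : ℝ} {t₀ : ℕ} (hδ : 0 < δ)
    (hd : ∀ t ≥ t₀, DifferentiableOn ℂ (fun w => annealed μ P f t (1 - w / (E : ℂ) ^ t))
      (Metric.ball w₀ (2 * δ)))
    (hb : ∀ t ≥ t₀, ∀ w ∈ Metric.ball w₀ (2 * δ), ‖annealed μ P f t (1 - w / (E : ℂ) ^ t)‖ ≤ C) :
    TendstoUniformlyOn (fun (t : ℕ) w => annealed μ P f t (1 - w / (E : ℂ) ^ t))
      (renorm μ P E f) atTop (Metric.ball w₀ δ) := by
  have hE := h.one_lt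
  have hE0 : 0 < E := by linarith
  have hEc : (E : ℂ) ≠ 0 := by exact_mod_cast hE0.ne'
  obtain ⟨C', hC'0, hC'⟩ := h.exists_taylor
  set H : ℕ → ℂ → ℂ := fun t w => annealed μ P f t (1 - w / (E : ℂ) ^ t) with hH
  set B := ‖w₀‖ + δ with hB
  have hB0 : 0 < B := by positivity
  obtain ⟨t₁, ht₁⟩ : ∃ t₁ : ℕ, t₀ ≤ t₁ ∧ ∀ t ≥ t₁, B ≤ E ^ t ∧ C' * B ^ 2 < δ * E ^ t := by
    have h1 := (tendsto_pow_atTop_atTop_of_one_lt hE).eventually_ge_atTop B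
    have h2 := (tendsto_pow_atTop_atTop_of_one_lt hE).eventually_gt_atTop (C' * B ^ 2 / δ)
    obtain ⟨t₁, ht₁⟩ := eventually_atTop.1 ((h1.and h2).and (eventually_ge_atTop t₀))
    refine ⟨t₁, (ht₁ t₁ le_rfl).2, fun t ht => ⟨(ht₁ t ht).1.1, ?_⟩⟩
    have := (ht₁ t ht).1.2
    rw [div_lt_iff₀ hδ] at this
    linarith
  have hC0 : 0 ≤ C := (norm_nonneg _).trans (hb t₀ le_rfl w₀ (Metric.mem_ball_self (by positivity)))
  -- the increments
  have hstep : ∀ w ∈ Metric.ball w₀ δ, ∀ n : ℕ,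
      dist (H (t₁ + n) w) (H (t₁ + (n + 1)) w) ≤ 2 * C / δ * (C' * B ^ 2) * (1 / E) ^ n := by
    intro w hw n
    set t := t₁ + n with ht
    have htt : t₁ ≤ t := by omega
    obtain ⟨k1, k2⟩ := ht₁.2 t htt
    have hwB : ‖w‖ ≤ B := by
      have h1 := norm_add_le (w - w₀) w₀
      rw [sub_add_cancel] at h1
      have h2 : ‖w - w₀‖ < δ := by simpa [dist_eq_norm] using hw
      linarith
    have hEt : 0 < E ^ t := by positivity
    set u := w / (E : ℂ) ^ (t + 1) with hu
    have hun : ‖u‖ = ‖w‖ / E ^ (t + 1) := by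
      rw [hu, norm_div, norm_pow, Complex.norm_real, Real.norm_of_nonneg hE0.le]
    have hEt1 : E ^ t ≤ E ^ (t + 1) := pow_le_pow_right₀ hE.le (Nat.le_succ t)
    have hu1 : ‖u‖ ≤ 1 := by
      rw [hun, div_le_one (by positivity)]
      linarith
    have hclose : ∀ r, ‖(E : ℂ) ^ t * (1 - gen P r (1 - u)) - w‖ ≤ C' * B ^ 2 / E ^ t := by
      intro r
      have e1 : (E : ℂ) ^ t * (1 - gen P r (1 - u)) - w =
          (E : ℂ) ^ t * (1 - gen P r (1 - u) - E * u) := by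
        rw [hu, pow_succ]; field_simp
      rw [e1, norm_mul, norm_pow, Complex.norm_real, Real.norm_of_nonneg hE0.le]
      calc E ^ t * ‖1 - gen P r (1 - u) - E * u‖ ≤ E ^ t * (C' * ‖u‖ ^ 2) := by
            gcongr; exact hC' r u hu1
        _ ≤ E ^ t * (C' * (B / E ^ t) ^ 2) := by
            rw [hun]; gcongr
        _ = C' * B ^ 2 / E ^ t := by field_simp
    have hlt : C' * B ^ 2 / E ^ t < δ := by rwa [div_lt_iff₀ hEt]
    have hsub : Metric.ball w δ ⊆ Metric.ball w₀ (2 * δ) := by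
      refine Metric.ball_subset_ball' ?_
      have : dist w w₀ < δ := hw
      linarith
    have hLip : ∀ w' ∈ Metric.ball w δ, dist (H t w') (H t w) ≤ 2 * C / δ * dist w' w := by
      intro w' hw'
      refine Complex.dist_le_div_mul_dist_of_mapsTo_ball
        ((hd t (ht₁.1.trans htt)).mono hsub) (fun v hv => ?_) hw'
      rw [mem_closedBall_iff_norm]
      have h1 := hb t (ht₁.1.trans htt) v (hsub hv)
      have h2 := hb t (ht₁.1.trans htt) w (hsub (Metric.mem_ball_self hδ))
      calc _ ≤ ‖H t v‖ + ‖H t w‖ := norm_sub_le _ _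
        _ ≤ 2 * C := by rw [two_mul]; exact add_le_add h1 h2
    have hHsucc : H (t + 1) w = ∑ r, (μ.real {r} : ℂ) *
        H t ((E : ℂ) ^ t * (1 - gen P r (1 - u))) := by
      rw [hH]
      simp only
      rw [annealed_succ]
      refine Finset.sum_congr rfl fun r _ => ?_
      rw [mul_div_cancel_left₀ _ (pow_ne_zero t hEc), sub_sub_cancel]
    have hHt : H t w = ∑ r, (μ.real {r} : ℂ) * H t w := by
      rw [← Finset.sum_mul]
      have := sum_measureReal_singleton μ
      rw [← Complex.ofReal_sum, this, Complex.ofReal_one, one_mul]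
    have e2 : t₁ + (n + 1) = t + 1 := by omega
    rw [e2, dist_comm, dist_eq_norm, hHsucc]
    rw [hHt, ← Finset.sum_sub_distrib]
    calc _ ≤ ∑ r, μ.real {r} * (2 * C / δ * (C' * B ^ 2 / E ^ t)) := by
          refine (norm_sum_le _ _).trans (Finset.sum_le_sum fun r _ => ?_)
          rw [← mul_sub, norm_mul, Complex.norm_real, Real.norm_of_nonneg measureReal_nonneg]
          refine mul_le_mul_of_nonneg_left ?_ measureReal_nonneg
          rw [← dist_eq_norm]
          have hd1 : dist ((E : ℂ) ^ t * (1 - gen P r (1 - u))) w ≤ C' * B ^ 2 / E ^ t := by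
            rw [dist_eq_norm]; exact hclose r
          refine (hLip _ (hd1.trans_lt hlt)).trans ?_
          gcongr
      _ = 2 * C / δ * (C' * B ^ 2 / E ^ t) := by
          rw [← Finset.sum_mul, sum_measureReal_singleton, one_mul]
      _ ≤ 2 * C / δ * (C' * B ^ 2) * (1 / E) ^ n := by
          rw [mul_assoc]
          refine mul_le_mul_of_nonneg_left ?_ (by positivity)
          rw [one_div, inv_pow, ← div_eq_mul_inv]
          refine div_le_div_of_nonneg_left (by positivity) (by positivity) ?_
          exact pow_le_pow_right₀ hE.le (by omega)
  have hr1 : 1 / E < 1 := by rwa [div_lt_one hE0]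
  have hlim : ∀ w ∈ Metric.ball w₀ δ, Tendsto (fun t => H t w) atTop (𝓝 (renorm μ P E f w)) := by
    intro w hw
    refine tendsto_nhds_limUnder ?_
    obtain ⟨l, hl⟩ := cauchySeq_tendsto_of_complete
      (cauchySeq_of_le_geometric (1 / E) _ hr1 (hstep w hw))
    refine ⟨l, (tendsto_add_atTop_iff_nat t₁).1 ?_⟩
    simpa only [add_comm t₁] using hl
  rw [Metric.tendstoUniformlyOn_iff]
  intro ε hε
  set A := 2 * C / δ * (C' * B ^ 2) with hA
  have hgeo : Tendsto (fun n : ℕ => A * (1 / E) ^ n / (1 - 1 / E)) atTop (𝓝 0) := by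
    have := ((tendsto_pow_atTop_nhds_zero_of_lt_one (by positivity) hr1).const_mul A).div_const
      (1 - 1 / E)
    simpa using this
  obtain ⟨n₀, hn₀⟩ := eventually_atTop.1 (hgeo.eventually (gt_mem_nhds hε))
  filter_upwards [eventually_ge_atTop (t₁ + n₀)] with t ht w hw
  obtain ⟨n, rfl⟩ := Nat.exists_eq_add_of_le (show t₁ ≤ t by omega)
  have hl : Tendsto (fun n => H (t₁ + n) w) atTop (𝓝 (renorm μ P E f w)) := by
    have := (tendsto_add_atTop_iff_nat t₁).2 (hlim w hw)
    simpa only [add_comm t₁] using this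
  have := dist_le_of_le_geometric_of_tendsto (1 / E) A hr1 (hstep w hw) hl n
  rw [dist_comm]
  exact this.trans_lt (hn₀ n (by omega))

lemma differentiableAt_approx (μ : Measure R) [IsProbabilityMeasure μ] {f : ℂ → ℂ} {S : Set ℂ}
    (hf : ∀ z ∈ S, DifferentiableAt ℂ f z) {t : ℕ} {w : ℂ}
    (hw : Reaches P S t (1 - w / (E : ℂ) ^ t)) :
    DifferentiableAt ℂ (fun w => annealed μ P f t (1 - w / (E : ℂ) ^ t)) w := by
  have h1 : DifferentiableAt ℂ (fun w : ℂ => 1 - w / (E : ℂ) ^ t) w := by fun_prop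
  exact (differentiableAt_annealed μ hf hw).comp w h1

lemma exists_bound_gen (P : R → Polynomial ℝ) (B : ℝ) :
    ∃ B', ∀ r, ∀ z : ℂ, ‖z‖ ≤ B → ‖gen P r z‖ ≤ B' := by
  have : ∀ r, ∃ C, ∀ z : ℂ, ‖z‖ ≤ B → ‖gen P r z‖ ≤ C := fun r => by
    obtain ⟨C, hC⟩ := (isCompact_closedBall (0 : ℂ) B).exists_bound_of_continuousOn
      (continuous_gen P r).continuousOn
    exact ⟨C, fun z hz => hC z (by simpa using hz)⟩
  choose C hC using this
  refine ⟨∑ r, |C r|, fun r z hz => (hC r z hz).trans ((le_abs_self _).trans ?_)⟩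
  exact Finset.single_le_sum (f := fun r => |C r|) (fun i _ => abs_nonneg _) (Finset.mem_univ r)

lemma exists_bound_orbit (P : R → Polynomial ℝ) (m : ℕ) (B : ℝ) :
    ∃ B', ∀ (e : ℕ → R) (z : ℂ), ‖z‖ ≤ B → ‖orbit P e z m‖ ≤ B' := by
  induction m with
  | zero => exact ⟨B, fun e z hz => hz⟩
  | succ m ih =>
    obtain ⟨B₁, hB₁⟩ := ih
    obtain ⟨B₂, hB₂⟩ := exists_bound_gen P B₁
    exact ⟨B₂, fun e z hz => hB₂ _ _ (hB₁ e z hz)⟩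

/-- `Π` is the case `f = id` of the renormalized limit at a point `w₀` of the plane; no assumption
on the critical angle is needed, since near `1` the iterates are close to their linearization. -/
lemma OffspringLaws.tendstoUniformlyOn_PiFun (h : OffspringLaws μ P E) (w₀ : ℂ) :
    TendstoUniformlyOn (fun (t : ℕ) w => annealed μ P id t (1 - w / (E : ℂ) ^ t))
      (PiFun μ P E) atTop (Metric.ball w₀ 1) := by
  have hE := h.one_lt
  have hE0 : 0 < E := by linarith
  have hEc : (E : ℂ) ≠ 0 := by exact_mod_cast hE0.ne'
  obtain ⟨c, hc0, hc⟩ := h.exists_linearization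
  obtain ⟨m, hm⟩ := ((tendsto_pow_atTop_atTop_of_one_lt hE).eventually_ge_atTop
    ((‖w₀‖ + 2) * c)).exists
  obtain ⟨B, hB⟩ := exists_bound_orbit P m (1 + 1 / c + 1 / c)
  refine h.tendstoUniformlyOn_renorm (t₀ := m) (C := B) one_pos (fun t _ w _ => ?_)
    fun t ht w hw => ?_
  · exact (differentiableAt_approx μ (S := Set.univ) (fun z _ => differentiableAt_id)
      fun e => Set.mem_univ _).differentiableWithinAt
  · refine norm_annealed_le μ (S := Metric.closedBall 0 B) (fun z hz => by simpa using hz)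
      fun e => ?_
    obtain ⟨k, rfl⟩ := Nat.exists_eq_add_of_le ht
    rw [mem_closedBall_zero_iff, add_comm m k, orbit_add]
    refine hB _ _ ?_
    set u := w / (E : ℂ) ^ (k + m) with hu
    have hwn : ‖w‖ ≤ ‖w₀‖ + 2 := by
      have h1 := norm_add_le (w - w₀) w₀
      rw [sub_add_cancel] at h1
      have h2 : ‖w - w₀‖ < 2 * 1 := by simpa [dist_eq_norm] using hw
      linarith
    have hun : E ^ k * ‖u‖ = ‖w‖ / E ^ m := by
      rw [hu, norm_div, norm_pow, Complex.norm_real, Real.norm_of_nonneg hE0.le, pow_add]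
      field_simp
    have hsmall : ‖w‖ / E ^ m * c ≤ 1 := by
      rw [div_mul_eq_mul_div, div_le_one (by positivity)]
      nlinarith
    have h1 := hc e u k (by rw [hun]; exact hsmall)
    have h2 : ‖(E : ℂ) ^ k * u‖ ≤ 1 / c := by
      rw [norm_mul, norm_pow, Complex.norm_real, Real.norm_of_nonneg hE0.le, hun]
      rwa [le_div_iff₀ hc0]
    have h3 : c * (E ^ k * ‖u‖) ^ 2 ≤ 1 / c := by
      rw [hun]
      set v := ‖w‖ / E ^ m
      have hv : 0 ≤ v := by positivity
      rw [le_div_iff₀ hc0]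
      calc c * v ^ 2 * c = (v * c) ^ 2 := by ring
        _ ≤ 1 := pow_le_one₀ (by positivity) hsmall
    have e1 : orbit P e (1 - u) k =
        1 - (1 - orbit P e (1 - u) k - (E : ℂ) ^ k * u) - (E : ℂ) ^ k * u := by ring
    rw [e1]
    refine (norm_sub_le _ _).trans (add_le_add ((norm_sub_le _ _).trans ?_) h2)
    rw [norm_one]
    exact add_le_add_right (h1.trans h3) _

lemma OffspringLaws.tendsto_PiFun (h : OffspringLaws μ P E) (z : ℂ) :
    Tendsto (fun t : ℕ => annealed μ P id t (1 - z / (E : ℂ) ^ t)) atTop (𝓝 (PiFun μ P E z)) :=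
  (h.tendstoUniformlyOn_PiFun z).tendsto_at (Metric.mem_ball_self one_pos)

/-- The function `Π` is entire. -/
lemma OffspringLaws.differentiable_PiFun (h : OffspringLaws μ P E) :
    Differentiable ℂ (PiFun μ P E) := fun z =>
  ((h.tendstoUniformlyOn_PiFun z).tendstoLocallyUniformlyOn.differentiableOn
    (Eventually.of_forall fun _ _ _ => (differentiableAt_approx μ (S := Set.univ)
      (fun _ _ => differentiableAt_id) fun _ => Set.mem_univ _).differentiableWithinAt)
    Metric.isOpen_ball z (Metric.mem_ball_self one_pos)).differentiableAt
      (Metric.ball_mem_nhds z one_pos)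

/-! ### Uniform attraction in sectors -/

lemma isOpen_reaches (P : R → Polynomial ℝ) [Nonempty R] {S : Set ℂ} (hS : IsOpen S) (t : ℕ) :
    IsOpen {z | Reaches P S t z} := by
  induction t with
  | zero =>
    have : {z | Reaches P S 0 z} = S := Set.ext fun z => reaches_zero
    rwa [this]
  | succ t ih =>
    simp only [reaches_succ, Set.ofPred_forall]
    exact isOpen_iInter_of_finite fun r => ih.preimage (continuous_gen P r)

/-- Every point of the common basin is attracted at a uniform rate: by compactness of the space
of environment sequences, a single time works for all of them. -/
lemma OffspringLaws.exists_reaches_of_mem_basin (h : OffspringLaws μ P E) {ρ : ℝ} (hρ0 : 0 < ρ)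
    (hρ : ρ ≤ 1) {z : ℂ} (hz : z ∈ basin P) : ∃ N, Reaches P (Metric.ball 0 ρ) N z := by
  by_contra! hN
  let _ : TopologicalSpace R := ⊥
  have : DiscreteTopology R := ⟨rfl⟩
  have hcont : ∀ t, Continuous fun e : ℕ → R => orbit P e z t := by
    intro t
    induction t with
    | zero => exact continuous_const
    | succ t ih =>
      have h1 : Continuous fun p : R × ℂ => gen P p.1 p.2 :=
        continuous_prod_of_discrete_left.2 fun r => continuous_gen P r
      exact h1.comp ((continuous_apply t).prodMk ih)
  have hclosed : ∀ t, IsClosed {e : ℕ → R | orbit P e z t ∉ Metric.ball (0 : ℂ) ρ} := fun t =>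
    (Metric.isOpen_ball.preimage (hcont t)).isClosed_compl
  have hanti : ∀ t, {e : ℕ → R | orbit P e z (t + 1) ∉ Metric.ball (0 : ℂ) ρ} ⊆
      {e : ℕ → R | orbit P e z t ∉ Metric.ball (0 : ℂ) ρ} := by
    intro t e he hmem
    refine he ?_
    rw [mem_ball_zero_iff] at hmem ⊢
    exact (h.norm_gen_le_self _ (hmem.le.trans hρ)).trans_lt hmem
  have hne : ∀ t, {e : ℕ → R | orbit P e z t ∉ Metric.ball (0 : ℂ) ρ}.Nonempty := by
    intro t
    have := hN t
    simp only [Reaches, not_forall] at this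
    exact this
  obtain ⟨e, he⟩ := IsCompact.nonempty_iInter_of_sequence_nonempty_isCompact_isClosed _
    hanti hne (hclosed 0).isCompact hclosed
  obtain ⟨t, ht⟩ := ((hz e).eventually (Metric.ball_mem_nhds (0 : ℂ) hρ0)).exists
  exact Set.mem_iInter.1 he t ht

/-- On compact subsets of the basin of `0` a single time serves all environments and all points. -/
lemma OffspringLaws.exists_reaches_of_isCompact (h : OffspringLaws μ P E) {ρ : ℝ} (hρ0 : 0 < ρ)
    (hρ : ρ ≤ 1) {C : Set ℂ} (hC : IsCompact C) (hCb : C ⊆ basin P) :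
    ∃ N, ∀ z ∈ C, Reaches P (Metric.ball 0 ρ) N z := by
  have := nonempty_of_measure μ
  obtain ⟨N, hN⟩ := hC.elim_directed_cover (fun N => {z | Reaches P (Metric.ball 0 ρ) N z})
    (fun N => isOpen_reaches P Metric.isOpen_ball N)
    (fun z hz => Set.mem_iUnion.2 (h.exists_reaches_of_mem_basin hρ0 hρ (hCb hz)))
    (directed_of_isDirected_le fun s t hst z hz => h.reaches_ball_mono hρ hst hz)
  exact ⟨N, hN⟩

/-- The truncated sector `|z| > M`, `|arg z| < φ`. -/
def sector (φ M : ℝ) : Set ℂ := {w | M < ‖w‖ ∧ |w.arg| < φ}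

lemma isOpen_sector {φ M : ℝ} (hφ : φ ≤ Real.pi) (hM : 0 ≤ M) : IsOpen (sector φ M) := by
  rw [isOpen_iff_mem_nhds]
  rintro w ⟨h1, h2⟩
  have hw : w ∈ Complex.slitPlane := by
    rw [Complex.mem_slitPlane_iff_arg]
    refine ⟨fun ha => ?_, norm_pos_iff.1 (hM.trans_lt h1)⟩
    rw [ha, abs_of_pos Real.pi_pos] at h2
    linarith
  exact (continuous_norm.continuousAt.eventually (lt_mem_nhds h1)).and
    ((Complex.continuousAt_arg hw).abs.eventually (gt_mem_nhds h2))

/-- The common basin of attraction contains the sector of half-opening `ψ` at `1`, near `1`. -/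
def AttractsSector (P : R → Polynomial ℝ) (ψ : ℝ) : Prop :=
  ∃ ε > 0, ∀ u : ℂ, 0 < ‖u‖ → ‖u‖ < ε → |u.arg| < ψ → 1 - u ∈ basin P

lemma exists_attractsSector (hangle : Real.pi < criticalAngle P) :
    ∃ ψ, Real.pi / 2 < ψ ∧ ψ ≤ Real.pi ∧ AttractsSector P ψ := by
  rw [criticalAngle] at hangle
  have hne : {θ : ℝ | 0 < θ ∧ θ ≤ 2 * Real.pi ∧ ∃ ε > 0, ∀ u : ℂ,
      0 < ‖u‖ → ‖u‖ < ε → |u.arg| < θ / 2 → 1 - u ∈ basin P}.Nonempty := by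
    by_contra hne
    rw [Set.not_nonempty_iff_eq_empty.1 hne, Real.sSup_empty] at hangle
    linarith [Real.pi_pos]
  obtain ⟨θ, ⟨_, h2, h3⟩, hθ⟩ := exists_lt_of_lt_csSup hne hangle
  exact ⟨θ / 2, by linarith, by linarith, h3⟩

/-- In a smaller sector, the rescaled orbits of all points of large modulus come uniformly close
to `0` by the time at which the scale is resolved. -/
lemma OffspringLaws.exists_reaches_sector (h : OffspringLaws μ P E) {ψ φ ρ : ℝ}
    (hψ : ψ ≤ Real.pi) (hP : AttractsSector P ψ) (hφ : φ < ψ) (hρ0 : 0 < ρ)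
    (hρ : ρ ≤ 1) :
    ∃ M > 0, ∃ κ > 0, ∀ w : ℂ, M ≤ ‖w‖ → |w.arg| ≤ φ → ∀ t : ℕ, κ * ‖w‖ ≤ E ^ t →
      Reaches P (Metric.ball 0 ρ) t (1 - w / (E : ℂ) ^ t) := by
  obtain ⟨ε, hε, hsec⟩ := hP
  have hE := h.one_lt
  have hE0 : 0 < E := by linarith
  have hEc : (E : ℂ) ≠ 0 := by exact_mod_cast hE0.ne'
  obtain ⟨c, hc0, hc⟩ := h.exists_linearization
  -- a fundamental domain for the scaling by `E`
  set C : Set ℂ := (fun p : ℝ × ℝ => (p.1 : ℂ) * Complex.exp (p.2 * Complex.I)) ''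
    (Set.Icc 1 E ×ˢ Set.Icc (-φ) φ) with hCdef
  have hC : IsCompact C := (isCompact_Icc.prod isCompact_Icc).image (by fun_prop)
  have hCS : C ⊆ sector ψ 0 := by
    rintro _ ⟨⟨s, θ⟩, ⟨⟨hs1, _⟩, hθ1, hθ2⟩, rfl⟩
    have hs0 : 0 < s := by simp only at hs1; linarith
    simp only at hθ1 hθ2
    refine ⟨?_, ?_⟩
    · simp [Complex.norm_exp_ofReal_mul_I, hs0.ne']
    · simp only
      rw [Complex.arg_real_mul _ hs0, Complex.arg_exp_mul_I,
        (toIocMod_eq_self _).2 ⟨by linarith, by linarith⟩]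
      exact (abs_le.2 ⟨hθ1, hθ2⟩).trans_lt hφ
  have hCE : ∀ w ∈ C, ‖w‖ ≤ E := by
    rintro _ ⟨⟨s, θ⟩, ⟨⟨hs1, hs2⟩, _⟩, rfl⟩
    simp only at hs1 hs2
    simpa [Complex.norm_exp_ofReal_mul_I, abs_of_nonneg (show (0 : ℝ) ≤ s by linarith)] using hs2
  obtain ⟨η, hη, hthick⟩ := hC.exists_cthickening_subset_open (isOpen_sector hψ le_rfl) hCS
  have hK : IsCompact (Metric.cthickening η C) := hC.cthickening
  obtain ⟨B, hB⟩ := hK.isBounded.exists_norm_le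
  obtain ⟨m, ⟨hm1, hm2⟩, hm3⟩ : ∃ m : ℕ, (B / ε < E ^ m ∧ c * E ^ 2 / η ≤ E ^ m) ∧ E * c ≤ E ^ m :=
    have ht := tendsto_pow_atTop_atTop_of_one_lt hE
    (((ht.eventually_gt_atTop _).and (ht.eventually_ge_atTop _)).and
      (ht.eventually_ge_atTop _)).exists
  have hEm : 0 < E ^ m := by positivity
  obtain ⟨N, hN⟩ := h.exists_reaches_of_isCompact hρ0 hρ
    (C := (fun v : ℂ => 1 - v / (E : ℂ) ^ m) '' Metric.cthickening η C)
    (hK.image (by fun_prop)) (by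
      rintro _ ⟨v, hv, rfl⟩
      obtain ⟨g1, g2⟩ := hthick hv
      have e1 : v / (E : ℂ) ^ m = (((E ^ m)⁻¹ : ℝ) : ℂ) * v := by
        push_cast; rw [div_eq_inv_mul]
      have e2 : ‖v / (E : ℂ) ^ m‖ = ‖v‖ / E ^ m := by
        rw [norm_div, norm_pow, Complex.norm_real, Real.norm_of_nonneg hE0.le]
      refine hsec _ ?_ ?_ ?_
      · rw [e2]; positivity
      · rw [e2, div_lt_iff₀ hEm]
        rw [div_lt_iff₀ hε] at hm1
        linarith [hB v hv]
      · rw [e1, Complex.arg_real_mul _ (by positivity)]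
        exact g2)
  have hfund : ∀ w ∈ C, ∀ t ≥ m, Reaches P (Metric.ball 0 ρ) (t + N) (1 - w / (E : ℂ) ^ t) := by
    intro w hw t ht
    obtain ⟨k, rfl⟩ := Nat.exists_eq_add_of_le ht
    refine h.reaches_ball_mono hρ (s := k + N) (by omega) fun e => ?_
    rw [orbit_add]
    refine hN _ ?_ _
    set u := w / (E : ℂ) ^ (m + k) with hu
    have hwE := hCE w hw
    have hun : E ^ k * ‖u‖ = ‖w‖ / E ^ m := by
      rw [hu, norm_div, norm_pow, Complex.norm_real, Real.norm_of_nonneg hE0.le, pow_add]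
      field_simp
    have h1 := hc e u k (by
      rw [hun, div_mul_eq_mul_div, div_le_one hEm]
      nlinarith)
    rw [hun] at h1
    refine ⟨(E : ℂ) ^ m * (1 - orbit P e (1 - u) k), ?_, ?_⟩
    · refine Metric.mem_cthickening_of_dist_le _ w _ _ hw ?_
      have e1 : (E : ℂ) ^ m * (1 - orbit P e (1 - u) k) - w =
          (E : ℂ) ^ m * (1 - orbit P e (1 - u) k - (E : ℂ) ^ k * u) := by
        rw [hu, pow_add]; field_simp
      rw [dist_eq_norm, e1, norm_mul, norm_pow, Complex.norm_real, Real.norm_of_nonneg hE0.le]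
      calc _ ≤ E ^ m * (c * (‖w‖ / E ^ m) ^ 2) := by gcongr
        _ ≤ E ^ m * (c * (E / E ^ m) ^ 2) := by gcongr
        _ = c * E ^ 2 / E ^ m := by field_simp
        _ ≤ η := by
          rw [div_le_iff₀ hη] at hm2
          rw [div_le_iff₀ hEm]; linarith
    · simp only
      rw [mul_div_cancel_left₀ _ (pow_ne_zero m hEc), sub_sub_cancel]
  refine ⟨E ^ N, by positivity, E ^ m, hEm, fun w hw harg t ht => ?_⟩
  obtain ⟨k, hk1, hk2⟩ := exists_nat_pow_near ((one_le_pow₀ hE.le).trans hw) hE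
  have hNk : N ≤ k := by
    have := (pow_lt_pow_iff_right₀ hE).1 (hw.trans_lt hk2)
    omega
  have hmk : m + k ≤ t := by
    rw [← pow_le_pow_iff_right₀ hE, pow_add]
    exact (mul_le_mul_of_nonneg_left hk1 hEm.le).trans ht
  obtain ⟨t', rfl⟩ := Nat.exists_eq_add_of_le (show k ≤ t by omega)
  have hEk : 0 < E ^ k := by positivity
  have hw0 : w / (E : ℂ) ^ k ∈ C := by
    refine ⟨(‖w‖ / E ^ k, w.arg), ⟨⟨?_, ?_⟩, abs_le.1 harg⟩, ?_⟩
    · simp only; rwa [le_div_iff₀ hEk, one_mul]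
    · simp only; rw [div_le_iff₀ hEk, mul_comm, ← pow_succ]; exact hk2.le
    · simp only
      push_cast
      rw [div_mul_eq_mul_div, Complex.norm_mul_exp_arg_mul_I]
  have := h.reaches_ball_mono hρ (t := k + t') (by omega) (hfund _ hw0 t' (by omega))
  rwa [div_div, ← pow_add] at this

end Renormalization

section SectorLimits

variable {R : Type*} [Fintype R] [MeasurableSpace R] [MeasurableSingletonClass R]
  {μ : Measure R} [IsProbabilityMeasure μ] {P : R → Polynomial ℝ} {E : ℝ}

/-- Existence of the renormalized limits far out in a sector: there `1 - w / Eᵗ` is driven into the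
ball on which `f` is holomorphic and bounded, and the bound passes to the limit. The radius `M` does
not depend on `f`, so that infinitely many functions can be treated at once. -/
lemma OffspringLaws.exists_sector_renorm (h : OffspringLaws μ P E) {ψ φ ρ : ℝ}
    (hψ : ψ ≤ Real.pi) (hP : AttractsSector P ψ) (hφ : φ < ψ) (hρ0 : 0 < ρ) (hρ : ρ ≤ 1) :
    ∃ M > 0, (∀ w ∈ sector φ M, ∀ᶠ t : ℕ in atTop,
        Reaches P (Metric.ball 0 ρ) t (1 - w / (E : ℂ) ^ t)) ∧
      ∀ (f : ℂ → ℂ) (B : ℝ), (∀ z ∈ Metric.ball (0 : ℂ) ρ, DifferentiableAt ℂ f z) →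
        (∀ z ∈ Metric.ball (0 : ℂ) ρ, ‖f z‖ ≤ B) →
        (∀ w ∈ sector φ M, Tendsto (fun t : ℕ => annealed μ P f t (1 - w / (E : ℂ) ^ t)) atTop
          (𝓝 (renorm μ P E f w))) ∧
        DifferentiableOn ℂ (renorm μ P E f) (sector φ M) ∧
        ∀ w ∈ sector φ M, ‖renorm μ P E f w‖ ≤ B := by
  obtain ⟨M, hM, κ, hκ, hreach⟩ := h.exists_reaches_sector hψ hP hφ hρ0 hρ
  have hE := h.one_lt
  have hopen := isOpen_sector (hφ.le.trans hψ) hM.le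
  have hev : ∀ w ∈ sector φ M, ∀ᶠ t : ℕ in atTop,
      Reaches P (Metric.ball 0 ρ) t (1 - w / (E : ℂ) ^ t) := fun w hw => by
    filter_upwards [(tendsto_pow_atTop_atTop_of_one_lt hE).eventually_ge_atTop (κ * ‖w‖)] with t ht
    exact hreach w hw.1.le hw.2.le t ht
  refine ⟨M, hM, hev, fun f B hfd hfB => ?_⟩
  have hloc : ∀ w ∈ sector φ M, ∃ δ > 0, Metric.ball w δ ⊆ sector φ M ∧
      (∃ t₀ : ℕ, ∀ t ≥ t₀, DifferentiableOn ℂ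
        (fun w => annealed μ P f t (1 - w / (E : ℂ) ^ t)) (Metric.ball w δ)) ∧
      TendstoUniformlyOn (fun (t : ℕ) w => annealed μ P f t (1 - w / (E : ℂ) ^ t))
        (renorm μ P E f) atTop (Metric.ball w δ) := by
    intro w hw
    obtain ⟨δ, hδ, hsub⟩ := Metric.isOpen_iff.1 hopen w hw
    obtain ⟨t₀, ht₀⟩ := eventually_atTop.1
      ((tendsto_pow_atTop_atTop_of_one_lt hE).eventually_ge_atTop
      (κ * (‖w‖ + δ)))
    have hr : ∀ t ≥ t₀, ∀ v ∈ Metric.ball w δ,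
        Reaches P (Metric.ball 0 ρ) t (1 - v / (E : ℂ) ^ t) := by
      intro t ht v hv
      have hv' := hsub hv
      refine hreach v hv'.1.le hv'.2.le t (le_trans ?_ (ht₀ t ht))
      have h1 := norm_add_le (v - w) w
      rw [sub_add_cancel] at h1
      have h2 : ‖v - w‖ < δ := by simpa [dist_eq_norm] using hv
      gcongr
      linarith
    have hd : ∀ t ≥ t₀, DifferentiableOn ℂ
        (fun w => annealed μ P f t (1 - w / (E : ℂ) ^ t)) (Metric.ball w δ) := fun t ht v hv =>
      (differentiableAt_approx μ hfd (hr t ht v hv)).differentiableWithinAt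
    have e2 : 2 * (δ / 2) = δ := by ring
    refine ⟨δ / 2, half_pos hδ, (Metric.ball_subset_ball (by linarith)).trans hsub,
      ⟨t₀, fun t ht => (hd t ht).mono (Metric.ball_subset_ball (by linarith))⟩,
      h.tendstoUniformlyOn_renorm (C := B) (t₀ := t₀) (half_pos hδ) ?_ ?_⟩
    · rw [e2]; exact hd
    · rw [e2]; exact fun t ht v hv => norm_annealed_le μ hfB (hr t ht v hv)
  have htend : ∀ w ∈ sector φ M, Tendsto (fun t : ℕ => annealed μ P f t (1 - w / (E : ℂ) ^ t))
      atTop (𝓝 (renorm μ P E f w)) := fun w hw => by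
    obtain ⟨δ, hδ, _, _, hu⟩ := hloc w hw
    exact hu.tendsto_at (Metric.mem_ball_self hδ)
  refine ⟨htend, fun w hw => ?_, fun w hw => ?_⟩
  · obtain ⟨δ, hδ, _, ⟨t₀, ht₀⟩, hu⟩ := hloc w hw
    exact ((hu.tendstoLocallyUniformlyOn.differentiableOn
      (eventually_atTop.2 ⟨t₀, ht₀⟩) Metric.isOpen_ball w
      (Metric.mem_ball_self hδ)).differentiableAt
      (Metric.ball_mem_nhds w hδ)).differentiableWithinAt
  · refine le_of_tendsto (htend w hw).norm ?_
    filter_upwards [hev w hw] with t ht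
    exact norm_annealed_le μ hfB ht

lemma OffspringLaws.eventually_reaches (h : OffspringLaws μ P E) {z : ℂ} (hz : 0 < z.re) :
    ∀ᶠ t : ℕ in atTop, Reaches P (Metric.ball 0 1) t (1 - z / (E : ℂ) ^ t) := by
  filter_upwards [eventually_norm_one_sub_lt_one h.one_lt hz] with t ht e
  rw [mem_ball_zero_iff]
  exact (h.norm_orbit_le e ht.le t).trans_lt ht

/-- The approximations of the renormalized limit of an eigenfunction at `E w` are multiples of
those at `w`. -/
lemma OffspringLaws.approx_mul (h : OffspringLaws μ P E) {f : ℂ → ℂ} {c : ℂ}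
    (hf : ∀ z ∈ Metric.ball (0 : ℂ) 1, annealed μ P f 1 z = c * f z) {w : ℂ}
    (hw : ∀ᶠ t : ℕ in atTop, Reaches P (Metric.ball 0 1) t (1 - w / (E : ℂ) ^ t)) :
    ∀ᶠ t : ℕ in atTop, annealed μ P f (t + 1) (1 - (E * w) / (E : ℂ) ^ (t + 1)) =
      c * annealed μ P f t (1 - w / (E : ℂ) ^ t) := by
  have hEc : (E : ℂ) ≠ 0 := by exact_mod_cast (by linarith [h.one_lt] : E ≠ 0)
  filter_upwards [hw] with t ht
  rw [pow_succ', mul_div_mul_left _ _ hEc]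
  exact annealed_eigen μ hf ht

lemma OffspringLaws.renorm_mul (h : OffspringLaws μ P E) {f : ℂ → ℂ} {c : ℂ}
    (hf : ∀ z ∈ Metric.ball (0 : ℂ) 1, annealed μ P f 1 z = c * f z) {w : ℂ}
    (hw : ∀ᶠ t : ℕ in atTop, Reaches P (Metric.ball 0 1) t (1 - w / (E : ℂ) ^ t))
    (hl : Tendsto (fun t : ℕ => annealed μ P f t (1 - w / (E : ℂ) ^ t)) atTop
      (𝓝 (renorm μ P E f w))) :
    renorm μ P E f (E * w) = c * renorm μ P E f w := by
  refine Tendsto.limUnder_eq ((tendsto_add_atTop_iff_nat 1).1 ?_)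
  exact (hl.const_mul c).congr' ((h.approx_mul hf hw).mono fun t ht => ht.symm)

/-- The functional equation carries existence of the limit from `E w` back to `w`, hence from the
far part of a sector to the whole half-plane. -/
lemma OffspringLaws.exists_tendsto_of_mul (h : OffspringLaws μ P E) {f : ℂ → ℂ} {c : ℂ}
    (hc : c ≠ 0) (hf : ∀ z ∈ Metric.ball (0 : ℂ) 1, annealed μ P f 1 z = c * f z) {w : ℂ}
    (hw : ∀ᶠ t : ℕ in atTop, Reaches P (Metric.ball 0 1) t (1 - w / (E : ℂ) ^ t))
    (hl : ∃ l, Tendsto (fun t : ℕ => annealed μ P f t (1 - (E * w) / (E : ℂ) ^ t)) atTop (𝓝 l)) :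
    ∃ l, Tendsto (fun t : ℕ => annealed μ P f t (1 - w / (E : ℂ) ^ t)) atTop (𝓝 l) := by
  obtain ⟨l, hl⟩ := hl
  refine ⟨c⁻¹ * l, (((tendsto_add_atTop_iff_nat 1).2 hl).const_mul c⁻¹).congr' ?_⟩
  filter_upwards [h.approx_mul hf hw] with t ht
  rw [ht, inv_mul_cancel_left₀ hc]

/-- The renormalized limit of an eigenfunction exists in the right half-plane: multiplication by a
power of `E` moves every point to the region of the sector where the limit is known to exist. -/
lemma OffspringLaws.tendsto_renorm_of_re_pos (h : OffspringLaws μ P E) {φ M : ℝ} {f : ℂ → ℂ} {c : ℂ}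
    (hc : c ≠ 0) (hφ : Real.pi / 2 < φ)
    (hf : ∀ z ∈ Metric.ball (0 : ℂ) 1, annealed μ P f 1 z = c * f z)
    (hl : ∀ w ∈ sector φ M, Tendsto (fun t : ℕ => annealed μ P f t (1 - w / (E : ℂ) ^ t)) atTop
      (𝓝 (renorm μ P E f w))) {z : ℂ} (hz : 0 < z.re) :
    Tendsto (fun t : ℕ => annealed μ P f t (1 - z / (E : ℂ) ^ t)) atTop
      (𝓝 (renorm μ P E f z)) := by
  refine tendsto_nhds_limUnder ?_
  have hE := h.one_lt
  have hE0 : 0 < E := by linarith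
  have hz0 : 0 < ‖z‖ := norm_pos_iff.2 (by rintro rfl; simp at hz)
  have key : ∀ m : ℕ, ∀ z : ℂ, 0 < z.re → M < E ^ m * ‖z‖ →
      ∃ l, Tendsto (fun t : ℕ => annealed μ P f t (1 - z / (E : ℂ) ^ t)) atTop (𝓝 l) := by
    intro m
    induction m with
    | zero =>
      intro z hz hM
      refine ⟨_, hl z ⟨by simpa using hM, lt_of_le_of_lt ?_ hφ⟩⟩
      exact (Complex.abs_arg_le_pi_div_two_iff.2 hz.le)
    | succ m ih =>
      intro z hz hM
      refine h.exists_tendsto_of_mul hc hf (h.eventually_reaches hz) (ih _ ?_ ?_)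
      · rw [Complex.re_ofReal_mul]; positivity
      · rw [norm_mul, Complex.norm_real, Real.norm_of_nonneg hE0.le, ← mul_assoc, ← pow_succ]
        exact hM
  obtain ⟨m, hm⟩ := ((tendsto_pow_atTop_atTop_of_one_lt hE).eventually_gt_atTop (M / ‖z‖)).exists
  exact key m z hz (by rwa [div_lt_iff₀ hz0] at hm)

end SectorLimits

/-! ### The pseudo-inverse series -/

section PseudoInverse

variable {R Ω : Type*} [Fintype R] [MeasurableSpace R] [MeasurableSingletonClass R]
  [MeasurableSpace Ω] {μ : Measure R} [IsProbabilityMeasure μ] {P : R → Polynomial ℝ} {E : ℝ}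
  {ℙ : Measure Ω} [IsProbabilityMeasure ℙ] {env : ℕ → Ω → R} {ξ : ℕ → ℕ → Ω → ℕ}

/-- Since `Φ_j` vanishes to order `j` at `0`, convergence of the pseudo-inverse series at one
positive point forces geometric decay of its terms in a smaller disk. -/
lemma IsOffspringFamily.exists_pseudoInverse (hξ : IsOffspringFamily μ P ℙ env ξ)
    (h : OffspringLaws μ P E)
    (hinv : ∃ ρ > 0, ∀ z : ℂ, ‖z‖ < ρ →
      Tendsto (fun J : ℕ => ∑ j ∈ Finset.Icc 1 J, (bCoeff ℙ ξ j : ℂ) * Phi ℙ ξ j z)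
        atTop (𝓝 z)) :
    ∃ ρ, 0 < ρ ∧ ρ < 1 ∧ ∃ u : ℕ → ℝ, Summable u ∧ ∀ z : ℂ, ‖z‖ ≤ ρ →
      (∀ j, ‖(bCoeff ℙ ξ (j + 1) : ℂ) * Phi ℙ ξ (j + 1) z‖ ≤ u j) ∧
      HasSum (fun j => (bCoeff ℙ ξ (j + 1) : ℂ) * Phi ℙ ξ (j + 1) z) z := by
  obtain ⟨ρ₀, hρ₀, hinv⟩ := hinv
  set ρ₁ := min ρ₀ 1 / 2 with hρ₁
  have h1 : 0 < ρ₁ := by positivity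
  have h2 : ρ₁ < ρ₀ := by
    have := min_le_left ρ₀ 1; linarith
  have h3 : ρ₁ < 1 := by
    have := min_le_right ρ₀ 1; linarith
  have hconv : ∀ z : ℂ, ‖z‖ < ρ₀ → Tendsto (fun J : ℕ => ∑ j ∈ Finset.range J,
      (bCoeff ℙ ξ (j + 1) : ℂ) * Phi ℙ ξ (j + 1) z) atTop (𝓝 z) := by
    intro z hz
    refine (hinv z hz).congr fun J => ?_
    rw [Finset.range_eq_Ico, Finset.sum_Ico_add' (fun j => (bCoeff ℙ ξ j : ℂ) * Phi ℙ ξ j z) 0 J 1]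
    rfl
  have hz0 : Tendsto (fun j : ℕ => (bCoeff ℙ ξ (j + 1) : ℂ) * Phi ℙ ξ (j + 1) ρ₁) atTop (𝓝 0) := by
    have hc := hconv ρ₁ (by rwa [Complex.norm_real, Real.norm_of_nonneg h1.le])
    have := ((tendsto_add_atTop_iff_nat 1).2 hc).sub hc
    rw [sub_self] at this
    refine this.congr fun J => ?_
    rw [Finset.sum_range_succ, add_sub_cancel_left]
  obtain ⟨D, hD⟩ := hz0.norm.bddAbove_range
  have hD' : ∀ j, ‖(bCoeff ℙ ξ (j + 1) : ℂ) * Phi ℙ ξ (j + 1) ρ₁‖ ≤ D := fun j => hD ⟨j, rfl⟩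
  have hs : Summable fun j : ℕ => D * (1 / 2 : ℝ) ^ (j + 1) := by
    have := (summable_geometric_of_lt_one (r := (1 / 2 : ℝ)) (by norm_num) (by norm_num))
    exact ((summable_nat_add_iff 1).2 this).mul_left D
  refine ⟨ρ₁ / 2, by positivity, by linarith, _, hs, fun z hz => ?_⟩
  have hb : ∀ j, ‖(bCoeff ℙ ξ (j + 1) : ℂ) * Phi ℙ ξ (j + 1) z‖ ≤ D * (1 / 2 : ℝ) ^ (j + 1) := by
    intro j
    rw [norm_mul]
    calc _ ≤ ‖(bCoeff ℙ ξ (j + 1) : ℂ)‖ * ((‖z‖ / ρ₁) ^ (j + 1) * ‖Phi ℙ ξ (j + 1) ρ₁‖) := by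
          gcongr
          exact hξ.norm_Phi_le h _ h1 h3 (by linarith)
      _ = ‖(bCoeff ℙ ξ (j + 1) : ℂ) * Phi ℙ ξ (j + 1) ρ₁‖ * (‖z‖ / ρ₁) ^ (j + 1) := by
          rw [norm_mul]; ring
      _ ≤ _ := by
          have : ‖z‖ / ρ₁ ≤ 1 / 2 := by rw [div_le_iff₀ h1]; linarith
          have hD0 : 0 ≤ D := (norm_nonneg _).trans (hD' 0)
          gcongr
          exact hD' j
  refine ⟨hb, ?_⟩
  have hsum : Summable fun j => (bCoeff ℙ ξ (j + 1) : ℂ) * Phi ℙ ξ (j + 1) z :=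
    Summable.of_norm_bounded hs hb
  rw [hsum.hasSum_iff_tendsto_nat]
  exact hconv z (by linarith)

/-- Everything about the functions `Π` and `K_j` in a truncated sector that contains the right
half-plane near infinity. -/
lemma IsOffspringFamily.exists_sector_expansion (hξ : IsOffspringFamily μ P ℙ env ξ)
    (h : OffspringLaws μ P E) {ψ φ : ℝ} (hψ : ψ ≤ Real.pi) (hP : AttractsSector P ψ) (hφ : φ < ψ)
    (hinv : ∃ ρ > 0, ∀ z : ℂ, ‖z‖ < ρ →
      Tendsto (fun J : ℕ => ∑ j ∈ Finset.Icc 1 J, (bCoeff ℙ ξ j : ℂ) * Phi ℙ ξ j z)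
        atTop (𝓝 z)) :
    ∃ M > 0, (∀ j, 1 ≤ j → (∀ w ∈ sector φ M, Tendsto (KApprox μ P E ℙ ξ j w) atTop
          (𝓝 (K μ P E ℙ ξ j w))) ∧
        (∀ w ∈ sector φ M, K μ P E ℙ ξ j (E * w) = q μ P j * K μ P E ℙ ξ j w) ∧
        DifferentiableOn ℂ (K μ P E ℙ ξ j) (sector φ M)) ∧
      ∃ u : ℕ → ℝ, Summable u ∧ ∀ w ∈ sector φ M,
        (∀ j, ‖(bCoeff ℙ ξ (j + 1) : ℂ) * K μ P E ℙ ξ (j + 1) w‖ ≤ u j) ∧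
        HasSum (fun j => (bCoeff ℙ ξ (j + 1) : ℂ) * K μ P E ℙ ξ (j + 1) w) (PiFun μ P E w) := by
  obtain ⟨ρ, hρ0, hρ1, u, hu, hρu⟩ := hξ.exists_pseudoInverse h hinv
  obtain ⟨M, hM, hreach, hren⟩ := h.exists_sector_renorm hψ hP hφ hρ0 hρ1.le
  have hball : Metric.ball (0 : ℂ) ρ ⊆ Metric.ball 0 1 := Metric.ball_subset_ball hρ1.le
  have hK : ∀ j, _ := fun j => hren (Phi ℙ ξ j) ‖Phi ℙ ξ j ρ‖
    (fun z hz => hξ.differentiableAt_Phi h j (hball hz))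
    (fun z hz => hξ.norm_Phi_le' h j hρ0 hρ1 (by simpa using (mem_ball_zero_iff.1 hz).le))
  have hlim : ∀ j, ∀ w ∈ sector φ M, Tendsto (KApprox μ P E ℙ ξ j w) atTop
      (𝓝 (K μ P E ℙ ξ j w)) := fun j => (hK j).1
  have happrox : ∀ w ∈ sector φ M, ∀ᶠ t : ℕ in atTop, ∀ j,
      ‖(bCoeff ℙ ξ (j + 1) : ℂ) * KApprox μ P E ℙ ξ (j + 1) w t‖ ≤ u j := by
    intro w hw
    filter_upwards [hreach w hw] with t ht j
    rw [KApprox, ← annealed_mul_left]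
    exact norm_annealed_le μ (fun z hz => (hρu z (mem_ball_zero_iff.1 hz).le).1 j) ht
  have hbound : ∀ w ∈ sector φ M, ∀ j,
      ‖(bCoeff ℙ ξ (j + 1) : ℂ) * K μ P E ℙ ξ (j + 1) w‖ ≤ u j := fun w hw j =>
    le_of_tendsto ((hlim (j + 1) w hw).const_mul _).norm ((happrox w hw).mono fun t ht => ht j)
  refine ⟨M, hM, fun j _ => ⟨hlim j, fun w hw => ?_, (hK j).2.1⟩, u, hu,
    fun w hw => ⟨hbound w hw, ?_⟩⟩
  · exact h.renorm_mul (fun z hz => hξ.annealed_Phi h j hz)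
      ((hreach w hw).mono fun t ht => ht.mono hball) (hlim j w hw)
  · have hsum : Summable fun j => (bCoeff ℙ ξ (j + 1) : ℂ) * K μ P E ℙ ξ (j + 1) w :=
      Summable.of_norm_bounded hu (hbound w hw)
    have h1 := tendsto_tsum_of_dominated_convergence (β := ℕ)
      (f := fun (t j : ℕ) => (bCoeff ℙ ξ (j + 1) : ℂ) * KApprox μ P E ℙ ξ (j + 1) w t)
      (𝓕 := atTop) hu (fun j => (hlim (j + 1) w hw).const_mul _) (happrox w hw)
    have h2 := h.tendsto_PiFun w
    have h3 : ∀ᶠ t : ℕ in atTop, ∑' j, (bCoeff ℙ ξ (j + 1) : ℂ) * KApprox μ P E ℙ ξ (j + 1) w t =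
        annealed μ P id t (1 - w / (E : ℂ) ^ t) := by
      filter_upwards [hreach w hw] with t ht
      rw [← (hasSum_annealed μ (f := id)
        (F := fun j z => (bCoeff ℙ ξ (j + 1) : ℂ) * Phi ℙ ξ (j + 1) z)
        (fun z hz => (hρu z (mem_ball_zero_iff.1 hz).le).2) ht).tsum_eq]
      exact tsum_congr fun j => by rw [KApprox, annealed_mul_left]
    rw [← tendsto_nhds_unique (h1.congr' h3) h2]
    exact hsum.hasSum

/-- The function `Π` tends to `0` at infinity, uniformly in the sector. -/
lemma OffspringLaws.exists_norm_PiFun_le (h : OffspringLaws μ P E) {ψ φ : ℝ} (hψ : ψ ≤ Real.pi)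
    (hP : AttractsSector P ψ) (hφ : φ < ψ) {ρ : ℝ} (hρ0 : 0 < ρ) :
    ∃ M > 0, ∀ w ∈ sector φ M, ‖PiFun μ P E w‖ ≤ ρ := by
  obtain ⟨M, hM, _, hren⟩ := h.exists_sector_renorm hψ hP hφ (lt_min hρ0 one_pos)
    (min_le_right ρ 1)
  exact ⟨M, hM, fun w hw => (hren id ρ (fun z _ => differentiableAt_id)
    (fun z hz => (mem_ball_zero_iff.1 hz).le.trans (min_le_left _ _))).2.2 w hw⟩

lemma IsOffspringFamily.tendsto_KApprox (hξ : IsOffspringFamily μ P ℙ env ξ)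
    (h : OffspringLaws μ P E) {φ M : ℝ} (hφ : Real.pi / 2 < φ) {j : ℕ}
    (hl : ∀ w ∈ sector φ M, Tendsto (KApprox μ P E ℙ ξ j w) atTop (𝓝 (K μ P E ℙ ξ j w)))
    {z : ℂ} (hz : 0 < z.re) : Tendsto (KApprox μ P E ℙ ξ j z) atTop (𝓝 (K μ P E ℙ ξ j z)) :=
  h.tendsto_renorm_of_re_pos (by exact_mod_cast (h.q_pos' j).ne') hφ
    (fun _ hz => hξ.annealed_Phi h j hz) hl hz

lemma IsOffspringFamily.K_mul (hξ : IsOffspringFamily μ P ℙ env ξ)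
    (h : OffspringLaws μ P E) {j : ℕ} {z : ℂ} (hz : 0 < z.re)
    (hl : Tendsto (KApprox μ P E ℙ ξ j z) atTop (𝓝 (K μ P E ℙ ξ j z))) :
    K μ P E ℙ ξ j (E * z) = q μ P j * K μ P E ℙ ξ j z :=
  h.renorm_mul (fun _ hz => hξ.annealed_Phi h j hz) (h.eventually_reaches hz) hl

end PseudoInverse

/-! ### Fourier series of periodic holomorphic functions on a half-strip -/

section HalfStrip

/-- The half-strip `Re w > X`, `|Im w| < s`. -/
def halfStrip (X s : ℝ) : Set ℂ := {w | X < w.re ∧ |w.im| < s}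

lemma mem_halfStrip {X s x c : ℝ} (hx : X < x) (hc : |c| < s) :
    (x : ℂ) + c * Complex.I ∈ halfStrip X s := by
  constructor <;> simpa

/-- The Fourier coefficient over a unit interval of the function restricted to the real axis. -/
noncomputable def stripCoeff (g : ℂ → ℂ) (n : ℤ) : ℂ :=
  ∫ x in (0 : ℝ)..1, g x * Complex.exp (-(2 * Real.pi * Complex.I * n * x))

variable {g : ℂ → ℂ} {X s : ℝ}

lemma exp_int_periodic (n : ℤ) (w : ℂ) :
    Complex.exp (-(2 * Real.pi * Complex.I * n * (w + 1))) =
      Complex.exp (-(2 * Real.pi * Complex.I * n * w)) := by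
  have : -(2 * Real.pi * Complex.I * n * (w + 1)) =
      -(2 * Real.pi * Complex.I * n * w) + ((-n : ℤ) : ℂ) * (2 * Real.pi * Complex.I) := by
    push_cast; ring
  rw [this, Complex.exp_add, Complex.exp_int_mul_two_pi_mul_I, mul_one]

/-- By Cauchy's theorem the Fourier coefficients may be computed along every horizontal line of
the half-strip. -/
lemma stripCoeff_eq (hd : DifferentiableOn ℂ g (halfStrip X s))
    (hper : ∀ w ∈ halfStrip X s, g (w + 1) = g w) (hre : ∀ x : ℝ, g ((x : ℂ) + 1) = g x)
    {x₀ c : ℝ} (hx₀ : X < x₀) (hc : |c| < s) (n : ℤ) :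
    ∫ x in x₀..(x₀ + 1), g (x + c * Complex.I) *
      Complex.exp (-(2 * Real.pi * Complex.I * n * (x + c * Complex.I))) = stripCoeff g n := by
  have hs : 0 < s := (abs_nonneg c).trans_lt hc
  set G : ℂ → ℂ := fun w => g w * Complex.exp (-(2 * Real.pi * Complex.I * n * w)) with hG
  have hGd : DifferentiableOn ℂ G (halfStrip X s) := hd.mul (by fun_prop)
  have hGper : ∀ w ∈ halfStrip X s, G (w + 1) = G w := fun w hw => by
    simp only [hG, hper w hw, exp_int_periodic]
  have hGre : Function.Periodic (fun x : ℝ => G x) 1 := fun x => by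
    simp only [hG]
    push_cast
    rw [hre, exp_int_periodic]
  have hrect := Complex.integral_boundary_rect_eq_zero_of_differentiableOn G (x₀ : ℂ)
    ((x₀ + 1 : ℝ) + c * Complex.I) (hGd.mono fun w hw => by
      simp only [Complex.mem_reProdIm, Complex.add_re, Complex.ofReal_re, Complex.mul_re,
        Complex.I_re, mul_zero, Complex.ofReal_im, Complex.I_im, mul_one, sub_self, add_zero,
        Complex.add_im, Complex.mul_im, zero_add] at hw
      obtain ⟨h1, h2⟩ := hw
      rw [Set.uIcc_of_le (by linarith)] at h1
      refine ⟨hx₀.trans_le h1.1, lt_of_le_of_lt ?_ hc⟩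
      have := Set.abs_sub_left_of_mem_uIcc h2
      simpa using this)
  simp only [Complex.add_re, Complex.ofReal_re, Complex.mul_re, Complex.I_re, mul_zero,
    Complex.ofReal_im, Complex.I_im, mul_one, sub_self, add_zero, Complex.add_im, Complex.mul_im,
    zero_add, Complex.ofReal_zero, zero_mul] at hrect
  have hvert : ∫ y in (0 : ℝ)..c, G (((x₀ + 1 : ℝ) : ℂ) + y * Complex.I) =
      ∫ y in (0 : ℝ)..c, G ((x₀ : ℂ) + y * Complex.I) := by
    refine intervalIntegral.integral_congr fun y hy => ?_
    have hy' : |y| < s := by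
      have := Set.abs_sub_left_of_mem_uIcc hy
      simp only [sub_zero] at this
      exact this.trans_lt hc
    rw [← hGper _ (mem_halfStrip hx₀ hy')]
    congr 1
    push_cast
    ring
  rw [hvert, add_sub_cancel_right, sub_eq_zero] at hrect
  rw [← hrect, hGre.intervalIntegral_add_eq x₀ 0, zero_add]
  rfl

lemma exists_norm_stripCoeff_le (hd : DifferentiableOn ℂ g (halfStrip X s))
    (hper : ∀ w ∈ halfStrip X s, g (w + 1) = g w) (hre : ∀ x : ℝ, g ((x : ℂ) + 1) = g x)
    {c : ℝ} (hc0 : 0 ≤ c) (hc : c < s) :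
    ∃ B, ∀ n, ‖stripCoeff g n‖ ≤ B * Real.exp (-(2 * Real.pi * |(n : ℝ)| * c)) := by
  have hseg : ∀ σ : ℝ, |σ| ≤ c → ∃ B, ∀ n : ℤ,
      ‖stripCoeff g n‖ ≤ B * Real.exp (2 * Real.pi * n * σ) := by
    intro σ hσ
    have hcont : ContinuousOn (fun x : ℝ => g (x + σ * Complex.I)) (Set.Icc (X + 1) (X + 2)) := by
      refine hd.continuousOn.comp (by fun_prop) fun x hx => mem_halfStrip ?_ (hσ.trans_lt hc)
      linarith [hx.1]
    obtain ⟨B, hB⟩ := isCompact_Icc.exists_bound_of_continuousOn hcont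
    refine ⟨B, fun n => ?_⟩
    rw [← stripCoeff_eq hd hper hre (show X < X + 1 by linarith) (hσ.trans_lt hc) n]
    refine (intervalIntegral.norm_integral_le_of_norm_le_const (C := B * Real.exp
      (2 * Real.pi * n * σ)) fun x hx => ?_).trans (by simp)
    rw [Set.uIoc_of_le (by linarith)] at hx
    rw [norm_mul, Complex.norm_exp]
    refine mul_le_mul (hB x ⟨hx.1.le, by linarith [hx.2]⟩) (le_of_eq ?_) (Real.exp_pos _).le
      ((norm_nonneg _).trans (hB x ⟨hx.1.le, by linarith [hx.2]⟩))
    congr 1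
    simp
  obtain ⟨B₁, hB₁⟩ := hseg c (abs_of_nonneg hc0).le
  obtain ⟨B₂, hB₂⟩ := hseg (-c) (by rw [abs_neg, abs_of_nonneg hc0])
  refine ⟨max B₁ B₂, fun n => ?_⟩
  rcases le_total 0 n with hn | hn
  · refine (hB₂ n).trans ?_
    have h0 : (0 : ℝ) ≤ n := by exact_mod_cast hn
    have e : 2 * Real.pi * n * -c = -(2 * Real.pi * |(n : ℝ)| * c) := by
      rw [abs_of_nonneg h0]; ring
    rw [e]
    exact mul_le_mul_of_nonneg_right (le_max_right _ _) (Real.exp_pos _).le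
  · refine (hB₁ n).trans ?_
    have h0 : (n : ℝ) ≤ 0 := by exact_mod_cast hn
    have e : 2 * Real.pi * n * c = -(2 * Real.pi * |(n : ℝ)| * c) := by
      rw [abs_of_nonpos h0]; ring
    rw [e]
    exact mul_le_mul_of_nonneg_right (le_max_left _ _) (Real.exp_pos _).le

lemma summable_exp_neg_abs_int {a : ℝ} (ha : 0 < a) :
    Summable fun n : ℤ => Real.exp (-(a * |(n : ℝ)|)) := by
  have h1 : Summable fun n : ℕ => Real.exp (-(a * n)) := by
    have := Real.summable_exp_nat_mul_iff.2 (neg_lt_zero.2 ha)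
    refine this.congr fun n => ?_
    congr 1
    ring
  refine Summable.of_nat_of_neg ?_ ?_
  · simpa using h1
  · simpa using h1

/-- The Fourier series converges to the function throughout the half-strip. -/
lemma hasSum_stripCoeff (hd : DifferentiableOn ℂ g (halfStrip X s))
    (hper : ∀ w ∈ halfStrip X s, g (w + 1) = g w) (hre : ∀ x : ℝ, g ((x : ℂ) + 1) = g x)
    {w : ℂ} (hw : w ∈ halfStrip X s) :
    HasSum (fun n : ℤ => stripCoeff g n * Complex.exp (2 * Real.pi * Complex.I * n * w)) (g w) := by
  obtain ⟨hx, hc⟩ := hw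
  set a := w.re with ha
  set c := w.im with hcdef
  have hwe : (a : ℂ) + c * Complex.I = w := Complex.re_add_im w
  set f : ℝ → ℂ := fun x => g (x + c * Complex.I) with hf
  have hcont : ContinuousOn f (Set.Icc a (a + 1)) :=
    hd.continuousOn.comp (by fun_prop) fun x hx' => mem_halfStrip (hx.trans_le hx'.1) hc
  have hend : f a = f (a + 1) := by
    simp only [hf]
    rw [← hper _ (mem_halfStrip hx hc)]
    congr 1
    push_cast
    ring
  set F : C(AddCircle (1 : ℝ), ℂ) := ⟨AddCircle.liftIco 1 a f,
    AddCircle.liftIco_continuous hend hcont⟩ with hF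
  have hcoeff : ∀ n : ℤ, fourierCoeff F n =
      stripCoeff g n * Complex.exp (-(2 * Real.pi * n * c)) := by
    intro n
    have e1 : fourierCoeff F n = fourierCoeff (AddCircle.liftIco 1 a f) n := rfl
    rw [e1, fourierCoeff_liftIco_eq, fourierCoeffOn_eq_integral,
      ← stripCoeff_eq hd hper hre hx hc n, ← intervalIntegral.integral_mul_const]
    simp only [add_sub_cancel_left, div_one, one_smul]
    refine intervalIntegral.integral_congr fun x _ => ?_
    simp only [hf, fourier_coe_apply, smul_eq_mul]
    conv_rhs => rw [mul_assoc, ← Complex.exp_add]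
    rw [mul_comm]
    congr 2
    push_cast
    ring_nf
    rw [Complex.I_sq]
    ring
  have hsum : Summable (fourierCoeff F) := by
    obtain ⟨c₁, h1, h2⟩ := exists_between hc
    obtain ⟨B, hB⟩ := exists_norm_stripCoeff_le hd hper hre ((abs_nonneg c).trans h1.le) h2
    refine Summable.of_norm_bounded
      ((summable_exp_neg_abs_int (a := 2 * Real.pi * (c₁ - |c|)) (by
        have := Real.pi_pos
        have : 0 < c₁ - |c| := by linarith
        positivity)).mul_left B) fun n => ?_
    rw [hcoeff, norm_mul, Complex.norm_exp]
    have hB0 : 0 ≤ B := by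
      have := (norm_nonneg _).trans (hB (0 : ℤ))
      simpa using this
    calc _ ≤ B * Real.exp (-(2 * Real.pi * |(n : ℝ)| * c₁)) *
          Real.exp (2 * Real.pi * |(n : ℝ)| * |c|) := by
          refine mul_le_mul (hB n) (Real.exp_le_exp.2 ?_) (Real.exp_pos _).le
            (mul_nonneg hB0 (Real.exp_pos _).le)
          have : (-(2 * (Real.pi : ℂ) * n * c)).re = -(2 * Real.pi * (n * c)) := by
            simp; ring
          rw [this, mul_assoc (2 * Real.pi), ← abs_mul, ← mul_neg]
          exact mul_le_mul_of_nonneg_left (neg_le_abs _) (by positivity)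
      _ = _ := by
          rw [mul_assoc, ← Real.exp_add]
          congr 2
          ring
  have hmain := has_pointwise_sum_fourier_series_of_summable hsum (a : AddCircle (1 : ℝ))
  have hval : F (a : AddCircle (1 : ℝ)) = g w := by
    have e1 : F (a : AddCircle (1 : ℝ)) = AddCircle.liftIco 1 a f a := rfl
    rw [e1, AddCircle.liftIco_coe_apply ⟨le_rfl, by linarith⟩]
    simp only [hf]
    rw [hwe]
  rw [hval] at hmain
  refine hmain.congr_fun fun n => ?_
  rw [hcoeff, fourier_coe_apply, smul_eq_mul, ← hwe]
  conv_rhs => rw [mul_assoc, ← Complex.exp_add]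
  congr 2
  push_cast
  ring_nf
  rw [Complex.I_sq]
  ring

end HalfStrip

/-! ### Multiplicatively periodic functions in a sector -/

section Multiplicative

variable {κ : ℂ → ℂ} {E q φ M : ℝ}

/-- The additively periodic form `q⁻ʷ κ(Eʷ)` of a function with `κ(E z) = q κ(z)`. -/
noncomputable def addForm (κ : ℂ → ℂ) (E q : ℝ) (w : ℂ) : ℂ :=
  Complex.exp (-(w * Real.log q)) * κ (Complex.exp (w * Real.log E))

lemma exp_mul_log_mem_sector (hE : 1 < E) (hφ : φ ≤ Real.pi) (hM : 0 < M) {w : ℂ}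
    (hw : w ∈ halfStrip (Real.log M / Real.log E) (φ / Real.log E)) :
    Complex.exp (w * Real.log E) ∈ sector φ M := by
  have hl : 0 < Real.log E := Real.log_pos hE
  obtain ⟨h1, h2⟩ := hw
  rw [div_lt_iff₀ hl] at h1
  rw [lt_div_iff₀ hl] at h2
  have him : |w.im * Real.log E| < φ := by rwa [abs_mul, abs_of_pos hl]
  have harg : (Complex.exp (w * Real.log E)).arg = w.im * Real.log E := by
    rw [Complex.arg_exp, Complex.im_mul_ofReal, toIocMod_eq_self]
    have := abs_lt.1 him
    constructor <;> linarith
  refine ⟨?_, by rw [harg]; exact him⟩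
  rw [Complex.norm_exp, Complex.re_mul_ofReal]
  rwa [← Real.log_lt_iff_lt_exp hM]

lemma addForm_add_one (hE : 1 < E) (hq : 0 < q) {w : ℂ}
    (hper : κ (E * Complex.exp (w * Real.log E)) = q * κ (Complex.exp (w * Real.log E))) :
    addForm κ E q (w + 1) = addForm κ E q w := by
  have hE0 : 0 < E := by linarith
  have e1 : Complex.exp ((w + 1) * Real.log E) = E * Complex.exp (w * Real.log E) := by
    rw [add_mul, one_mul, Complex.exp_add, mul_comm, ← Complex.ofReal_exp, Real.exp_log hE0]
  have e2 : Complex.exp (-((w + 1) * Real.log q)) * q = Complex.exp (-(w * Real.log q)) := by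
    have hqe : (q : ℂ) = Complex.exp (Real.log q) := by
      rw [← Complex.ofReal_exp, Real.exp_log hq]
    conv_lhs => rw [hqe, ← Complex.exp_add]
    congr 1
    ring
  rw [addForm, addForm, e1, hper, ← mul_assoc, e2]

lemma differentiableOn_addForm (hE : 1 < E) (hφ : φ ≤ Real.pi) (hM : 0 < M)
    (hd : DifferentiableOn ℂ κ (sector φ M)) :
    DifferentiableOn ℂ (addForm κ E q) (halfStrip (Real.log M / Real.log E) (φ / Real.log E)) :=
  DifferentiableOn.mul (by fun_prop) (hd.comp (by fun_prop) fun _ hw =>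
    exp_mul_log_mem_sector hE hφ hM hw)

lemma exp_log_div_mul {z : ℂ} (hE : 1 < E) (hz : z ≠ 0) :
    Complex.exp (Complex.log z / Real.log E * Real.log E) = z := by
  rw [div_mul_cancel₀ _ (by exact_mod_cast (Real.log_pos hE).ne'), Complex.exp_log hz]

lemma cpow_expo_eq {z : ℂ} (hz : z ≠ 0) (n : ℤ) :
    z ^ ((2 * Real.pi * Complex.I * n + Real.log q) / Real.log E : ℂ) =
      Complex.exp (2 * Real.pi * Complex.I * n * (Complex.log z / Real.log E)) *
        Complex.exp (Complex.log z / Real.log E * Real.log q) := by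
  rw [Complex.cpow_def_of_ne_zero hz, ← Complex.exp_add]
  congr 1
  ring

lemma norm_cpow_expo {z : ℂ} (hz : z ≠ 0) (n : ℤ) :
    ‖z ^ ((2 * Real.pi * Complex.I * n + Real.log q) / Real.log E : ℂ)‖ =
      ‖z‖ ^ (Real.log q / Real.log E) * Real.exp (-(2 * Real.pi * n * (z.arg / Real.log E))) := by
  rw [Complex.cpow_def_of_ne_zero hz, Complex.norm_exp,
    Real.rpow_def_of_pos (norm_pos_iff.2 hz), ← Real.exp_add]
  congr 1
  have : Complex.log z * ((2 * Real.pi * Complex.I * n + Real.log q) / Real.log E : ℂ) =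
      (((Real.log ‖z‖ + z.arg * Complex.I) * (Real.log q + (2 * Real.pi * n : ℝ) * Complex.I)) /
        (Real.log E : ℂ)) := by
    rw [Complex.log]
    push_cast
    ring
  rw [this, Complex.div_ofReal_re]
  simp
  ring

/-- The expansion of a holomorphic function with `κ(E z) = q κ(z)` in a sector, with a summable
majorant in every smaller sector. -/
lemma exists_multiplicative_expansion (hE : 1 < E) (hq : 0 < q) (hφ : φ ≤ Real.pi) (hM : 0 < M)
    (hd : DifferentiableOn ℂ κ (sector φ M))
    (hper : ∀ w ∈ sector φ M, κ (E * w) = q * κ w)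
    (hre : ∀ x : ℝ, 0 < x → κ (E * x) = q * κ x) :
    (∀ z ∈ sector φ M, HasSum (fun n : ℤ => stripCoeff (addForm κ E q) n *
      z ^ ((2 * Real.pi * Complex.I * n + Real.log q) / Real.log E : ℂ)) (κ z)) ∧
    ∀ φ₁, 0 ≤ φ₁ → φ₁ < φ → ∃ u : ℤ → ℝ, Summable u ∧ ∀ z : ℂ, z ≠ 0 → |z.arg| ≤ φ₁ → ∀ n,
      ‖stripCoeff (addForm κ E q) n *
        z ^ ((2 * Real.pi * Complex.I * n + Real.log q) / Real.log E : ℂ)‖ ≤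
        u n * ‖z‖ ^ (Real.log q / Real.log E) := by
  have hl : 0 < Real.log E := Real.log_pos hE
  have hd' := differentiableOn_addForm (q := q) hE hφ hM hd
  have hper' : ∀ w ∈ halfStrip (Real.log M / Real.log E) (φ / Real.log E),
      addForm κ E q (w + 1) = addForm κ E q w := fun w hw =>
    addForm_add_one hE hq (hper _ (exp_mul_log_mem_sector hE hφ hM hw))
  have hre' : ∀ x : ℝ, addForm κ E q ((x : ℂ) + 1) = addForm κ E q x := fun x => by
    refine addForm_add_one hE hq ?_
    have : Complex.exp (x * Real.log E) = (Real.exp (x * Real.log E) : ℝ) := by push_cast; rfl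
    rw [this]
    exact hre _ (Real.exp_pos _)
  refine ⟨fun z hz => ?_, fun φ₁ hφ₀ hφ₁ => ?_⟩
  · have hz0 : z ≠ 0 := norm_pos_iff.1 (hM.trans hz.1)
    have hmem : Complex.log z / Real.log E ∈
        halfStrip (Real.log M / Real.log E) (φ / Real.log E) := by
      refine ⟨?_, ?_⟩
      · rw [Complex.div_ofReal_re, Complex.log_re]
        exact div_lt_div_of_pos_right (Real.log_lt_log hM hz.1) hl
      · rw [Complex.div_ofReal_im, Complex.log_im, abs_div, abs_of_pos hl]
        exact div_lt_div_of_pos_right hz.2 hl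
    have := (hasSum_stripCoeff hd' hper' hre' hmem).mul_right
      (Complex.exp (Complex.log z / Real.log E * Real.log q))
    have hval : addForm κ E q (Complex.log z / Real.log E) *
        Complex.exp (Complex.log z / Real.log E * Real.log q) = κ z := by
      rw [addForm, exp_log_div_mul hE hz0, mul_right_comm, ← Complex.exp_add, neg_add_cancel,
        Complex.exp_zero, one_mul]
    rw [hval] at this
    exact this.congr_fun fun n => by rw [cpow_expo_eq hz0, ← mul_assoc]
  · obtain ⟨c, hc1, hc2⟩ := exists_between (div_lt_div_of_pos_right hφ₁ hl)
    obtain ⟨B, hB⟩ := exists_norm_stripCoeff_le hd' hper' hre'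
      ((div_nonneg hφ₀ hl.le).trans hc1.le) hc2
    refine ⟨fun n => B * Real.exp (-(2 * Real.pi * (c - φ₁ / Real.log E) * |(n : ℝ)|)),
      (summable_exp_neg_abs_int (a := 2 * Real.pi * (c - φ₁ / Real.log E)) ?_).mul_left B,
      fun z hz harg n => ?_⟩
    · have := Real.pi_pos
      have : 0 < c - φ₁ / Real.log E := by linarith
      positivity
    · have hB0 : 0 ≤ B := by
        have := (norm_nonneg _).trans (hB (0 : ℤ))
        simpa using this
      rw [norm_mul, norm_cpow_expo hz]
      have hexp : Real.exp (-(2 * Real.pi * n * (z.arg / Real.log E))) ≤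
          Real.exp (2 * Real.pi * |(n : ℝ)| * (φ₁ / Real.log E)) := by
        rw [Real.exp_le_exp, mul_assoc (2 * Real.pi), mul_assoc (2 * Real.pi), ← mul_neg]
        refine mul_le_mul_of_nonneg_left ?_ (by positivity)
        refine (neg_le_abs _).trans ?_
        rw [abs_mul, abs_div, abs_of_pos hl]
        gcongr
      calc _ ≤ B * Real.exp (-(2 * Real.pi * |(n : ℝ)| * c)) *
            (‖z‖ ^ (Real.log q / Real.log E) *
              Real.exp (2 * Real.pi * |(n : ℝ)| * (φ₁ / Real.log E))) := by
            gcongr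
            exact hB n
        _ = _ := by
            have : -(2 * Real.pi * (c - φ₁ / Real.log E) * |(n : ℝ)|) =
                -(2 * Real.pi * |(n : ℝ)| * c) + 2 * Real.pi * |(n : ℝ)| * (φ₁ / Real.log E) := by
              ring
            simp only []
            rw [this, Real.exp_add]
            ring

end Multiplicative

/-! ### Integrals along rays -/

section Rays

/-- The point at distance `s` from `a` in the direction `θ`. -/
noncomputable def rayPoint (a θ s : ℝ) : ℂ := a + s * Complex.exp (θ * Complex.I)

/-- The integral of `F` along the ray from `a` to infinity in the direction `θ`. -/
noncomputable def rayIntegral (F : ℂ → ℂ) (a θ : ℝ) : ℂ :=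
  ∫ s in Set.Ioi (0 : ℝ), F (rayPoint a θ s) * Complex.exp (θ * Complex.I)

/-- The integral `(1 / 2πi) ∫ F` along the path that comes in from infinity on the ray with
direction `-φ` to the vertex `a` and goes back to infinity on the ray with direction `φ`. -/
noncomputable def loopIntegral (F : ℂ → ℂ) (a φ : ℝ) : ℂ :=
  (rayIntegral F a φ - rayIntegral F a (-φ)) / (2 * Real.pi * Complex.I)

variable {F H : ℂ → ℂ} {a θ s k C : ℝ}

lemma rayPoint_eq : rayPoint a θ s = ((a + s * Real.cos θ : ℝ) : ℂ) +
    (s * Real.sin θ : ℝ) * Complex.I := by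
  rw [rayPoint, Complex.exp_mul_I]
  push_cast
  ring

@[simp] lemma rayPoint_re : (rayPoint a θ s).re = a + s * Real.cos θ := by
  rw [rayPoint_eq, Complex.add_re, Complex.ofReal_re, Complex.re_ofReal_mul, Complex.I_re,
    mul_zero, add_zero]

@[simp] lemma rayPoint_im : (rayPoint a θ s).im = s * Real.sin θ := by
  rw [rayPoint_eq, Complex.add_im, Complex.ofReal_im, Complex.im_ofReal_mul, Complex.I_im,
    mul_one, zero_add]

@[simp] lemma rayPoint_zero : rayPoint a θ 0 = a := by simp [rayPoint]

lemma rayPoint_zero_left : rayPoint 0 θ s = s * Complex.exp (θ * Complex.I) := by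
  simp [rayPoint]

lemma norm_exp_mul_I (θ : ℝ) : ‖Complex.exp (θ * Complex.I)‖ = 1 := Complex.norm_exp_ofReal_mul_I θ

lemma norm_rayPoint_le (ha : 0 ≤ a) (hs : 0 ≤ s) : ‖rayPoint a θ s‖ ≤ a + s := by
  refine (norm_add_le _ _).trans ?_
  rw [norm_mul, norm_exp_mul_I, mul_one, Complex.norm_real, Complex.norm_real,
    Real.norm_of_nonneg ha, Real.norm_of_nonneg hs]

lemma le_norm_rayPoint (hs : 0 ≤ s) : s - |a| ≤ ‖rayPoint a θ s‖ := by
  have h : (s : ℂ) * Complex.exp (θ * Complex.I) = rayPoint a θ s - a := by rw [rayPoint]; ring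
  have h' : ‖(s : ℂ) * Complex.exp (θ * Complex.I)‖ = s := by
    rw [norm_mul, norm_exp_mul_I, mul_one, Complex.norm_real, Real.norm_of_nonneg hs]
  have := norm_sub_le (rayPoint a θ s) a
  rw [← h, h', Complex.norm_real, Real.norm_eq_abs] at this
  linarith

lemma mul_sin_le_norm_rayPoint (ha : 0 ≤ a) : a * |Real.sin θ| ≤ ‖rayPoint a θ s‖ := by
  have h1 : |(rayPoint a θ s * Complex.exp (-(θ * Complex.I))).im| ≤ ‖rayPoint a θ s‖ := by
    refine (Complex.abs_im_le_norm _).trans ?_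
    rw [norm_mul, ← neg_mul, ← Complex.ofReal_neg, norm_exp_mul_I, mul_one]
  have h2 : (rayPoint a θ s * Complex.exp (-(θ * Complex.I))).im = -(a * Real.sin θ) := by
    rw [rayPoint, add_mul, mul_assoc, ← Complex.exp_add, add_neg_cancel, Complex.exp_zero,
      ← neg_mul, ← Complex.ofReal_neg, mul_one, Complex.add_im, Complex.ofReal_im, add_zero,
      Complex.im_ofReal_mul, Complex.exp_ofReal_mul_I_im, Real.sin_neg, mul_neg]
  rwa [h2, abs_neg, abs_mul, abs_of_nonneg ha] at h1

lemma abs_arg_rayPoint_le (ha : 0 < a) (hs : 0 ≤ s) (h0 : Real.sin θ ≠ 0) :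
    |(rayPoint a θ s).arg| ≤ |θ| := by
  have hpos : 0 < ‖rayPoint a θ s‖ :=
    (mul_pos ha (abs_pos.2 h0)).trans_le (mul_sin_le_norm_rayPoint ha.le)
  have hz : rayPoint a θ s ≠ 0 := norm_pos_iff.1 hpos
  by_contra hlt
  rw [not_le] at hlt
  have h1 := Real.cos_lt_cos_of_nonneg_of_le_pi (abs_nonneg θ) (Complex.abs_arg_le_pi _) hlt
  rw [Real.cos_abs, Real.cos_abs, Complex.cos_arg hz, div_lt_iff₀ hpos, rayPoint_re] at h1
  have h2 : |s - ‖rayPoint a θ s‖| ≤ a := by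
    have := norm_rayPoint_le (θ := θ) ha.le hs
    have h3 := le_norm_rayPoint (a := a) (θ := θ) hs
    rw [abs_of_pos ha] at h3
    rw [abs_le]
    constructor <;> linarith
  have h4 : |(s - ‖rayPoint a θ s‖) * Real.cos θ| ≤ a * 1 := by
    rw [abs_mul]
    exact mul_le_mul h2 (Real.abs_cos_le_one θ) (abs_nonneg _) ha.le
  have := neg_abs_le ((s - ‖rayPoint a θ s‖) * Real.cos θ)
  linarith

lemma hasDerivAt_rayPoint : HasDerivAt (rayPoint a θ) (Complex.exp (θ * Complex.I)) s := by
  have := ((hasDerivAt_id s).ofReal_comp.mul_const (Complex.exp (θ * Complex.I))).const_add (a : ℂ)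
  rwa [Complex.ofReal_one, one_mul] at this

lemma continuous_rayPoint : Continuous (rayPoint a θ) := by
  unfold rayPoint
  fun_prop

lemma integrableOn_exp_neg_mul (hk : 0 < k) :
    IntegrableOn (fun s : ℝ => Real.exp (-(k * s))) (Set.Ioi 0) := by
  simpa only [neg_mul] using exp_neg_integrableOn_Ioi 0 hk

lemma integrableOn_ray (hk : 0 < k)
    (hc : ContinuousOn (fun s => F (rayPoint a θ s)) (Set.Ioi 0))
    (hb : ∀ s, 0 < s → ‖F (rayPoint a θ s)‖ ≤ C * Real.exp (-(k * s))) :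
    IntegrableOn (fun s => F (rayPoint a θ s) * Complex.exp (θ * Complex.I)) (Set.Ioi 0) := by
  refine ((integrableOn_exp_neg_mul hk).const_mul C).mono'
    ((hc.mul continuousOn_const).aestronglyMeasurable measurableSet_Ioi)
    ((ae_restrict_iff' measurableSet_Ioi).2 (ae_of_all _ fun s hs => ?_))
  rw [norm_mul, norm_exp_mul_I, mul_one]
  exact hb s hs

lemma hasSum_rayIntegral {ι : Type*} [Countable ι] {f : ι → ℂ → ℂ} {u : ι → ℝ} (hk : 0 < k)
    (hu : Summable u)
    (hc : ∀ i, ContinuousOn (fun s => f i (rayPoint a θ s)) (Set.Ioi 0))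
    (hb : ∀ i s, 0 < s → ‖f i (rayPoint a θ s)‖ ≤ u i * Real.exp (-(k * s)))
    (hs : ∀ s, 0 < s → HasSum (fun i => f i (rayPoint a θ s)) (F (rayPoint a θ s))) :
    HasSum (fun i => rayIntegral (f i) a θ) (rayIntegral F a θ) := by
  refine hasSum_integral_of_dominated_convergence (fun i s => u i * Real.exp (-(k * s)))
    (fun i => ((hc i).mul continuousOn_const).aestronglyMeasurable measurableSet_Ioi)
    (fun i => (ae_restrict_iff' measurableSet_Ioi).2 (ae_of_all _ fun s hs => ?_))
    (ae_of_all _ fun s => hu.mul_right _) ?_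
    ((ae_restrict_iff' measurableSet_Ioi).2 (ae_of_all _ fun s hs' => (hs s hs').mul_right _))
  · rw [norm_mul, norm_exp_mul_I, mul_one]
    exact hb i s hs
  · simp_rw [tsum_mul_right]
    exact (integrableOn_exp_neg_mul hk).const_mul _

lemma hasSum_loopIntegral {ι : Type*} [Countable ι] {f : ι → ℂ → ℂ} {u : ι → ℝ} {φ : ℝ}
    (hk : 0 < k) (hu : Summable u)
    (hc : ∀ i θ, |θ| = φ → ContinuousOn (fun s => f i (rayPoint a θ s)) (Set.Ioi 0))
    (hb : ∀ i θ s, |θ| = φ → 0 < s → ‖f i (rayPoint a θ s)‖ ≤ u i * Real.exp (-(k * s)))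
    (hs : ∀ θ s, |θ| = φ → 0 < s →
      HasSum (fun i => f i (rayPoint a θ s)) (F (rayPoint a θ s))) (hφ : 0 ≤ φ) :
    HasSum (fun i => loopIntegral (f i) a φ) (loopIntegral F a φ) := by
  have h : ∀ θ, |θ| = φ → HasSum (fun i => rayIntegral (f i) a θ) (rayIntegral F a θ) :=
    fun θ hθ => hasSum_rayIntegral hk hu (fun i => hc i θ hθ) (fun i s h => hb i θ s hθ h)
      fun s h => hs θ s hθ h
  exact ((h φ (abs_of_nonneg hφ)).sub (h (-φ) (by rw [abs_neg, abs_of_nonneg hφ]))).div_const _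

lemma loopIntegral_const_mul (c : ℂ) (F : ℂ → ℂ) (a φ : ℝ) :
    loopIntegral (fun z => c * F z) a φ = c * loopIntegral F a φ := by
  simp only [loopIntegral, rayIntegral, mul_assoc, integral_const_mul]
  ring

lemma loopIntegral_comp_mul {x φ : ℝ} (hx : 0 < x) :
    loopIntegral (fun z => F (x * z)) a φ = (x : ℂ)⁻¹ * loopIntegral F (x * a) φ := by
  have h : ∀ θ, rayIntegral (fun z => F (x * z)) a θ = (x : ℂ)⁻¹ * rayIntegral F (x * a) θ := by
    intro θ
    have := integral_comp_mul_left_Ioi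
      (fun s => F (rayPoint (x * a) θ s) * Complex.exp (θ * Complex.I)) 0 hx
    rw [mul_zero, Complex.real_smul, Complex.ofReal_inv] at this
    rw [rayIntegral, rayIntegral, ← this]
    refine integral_congr_ae (ae_of_all _ fun s => ?_)
    simp only [rayPoint]
    push_cast
    ring_nf
  rw [loopIntegral, loopIntegral, h, h]
  ring

/-- A primitive converges at infinity along a ray on which the function is integrable. -/
lemma tendsto_primitive_ray (hd : ∀ s, 0 ≤ s → HasDerivAt H (F (rayPoint a θ s)) (rayPoint a θ s))
    (hi : IntegrableOn (fun s => F (rayPoint a θ s) * Complex.exp (θ * Complex.I)) (Set.Ioi 0)) :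
    Tendsto (fun s => H (rayPoint a θ s)) atTop (𝓝 (H a + rayIntegral F a θ)) := by
  have hd' : ∀ s, 0 ≤ s → HasDerivAt (fun s => H (rayPoint a θ s))
      (F (rayPoint a θ s) * Complex.exp (θ * Complex.I)) s := fun s hs =>
    (hd s hs).comp s hasDerivAt_rayPoint
  have h1 := intervalIntegral_tendsto_integral_Ioi 0 hi tendsto_id
  have h2 := h1.const_add (H a)
  refine h2.congr' ?_
  filter_upwards [eventually_ge_atTop 0] with S hS
  rw [id, intervalIntegral.integral_eq_sub_of_hasDerivAt (f := fun s => H (rayPoint a θ s))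
    (fun s hs => hd' s ?_)]
  · simp
  · rw [intervalIntegrable_iff_integrableOn_Ioc_of_le hS]
    exact hi.mono_set Set.Ioc_subset_Ioi_self
  · rw [Set.uIcc_of_le hS] at hs
    exact hs.1

lemma rayIntegral_deriv {F' : ℂ → ℂ}
    (hd : ∀ s, 0 ≤ s → HasDerivAt F (F' (rayPoint a θ s)) (rayPoint a θ s))
    (hi : IntegrableOn (fun s => F' (rayPoint a θ s) * Complex.exp (θ * Complex.I)) (Set.Ioi 0))
    (h0 : Tendsto (fun s => F (rayPoint a θ s)) atTop (𝓝 0)) : rayIntegral F' a θ = -F a := by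
  have := tendsto_nhds_unique (tendsto_primitive_ray hd hi) h0
  exact eq_neg_of_add_eq_zero_right this

/-- The change of a primitive along a segment. -/
lemma norm_primitive_sub_le {z w : ℂ} (hd : ∀ v ∈ segment ℝ z w, HasDerivAt H (F v) v)
    (hb : ∀ v ∈ segment ℝ z w, ‖F v‖ ≤ C) : ‖H w - H z‖ ≤ C * ‖w - z‖ :=
  (convex_segment z w).norm_image_sub_le_of_norm_hasDerivWithin_le
    (fun v hv => (hd v hv).hasDerivWithinAt) hb (left_mem_segment ℝ z w) (right_mem_segment ℝ z w)

lemma tendsto_exp_neg_mul (hk : 0 < k) (C : ℝ) :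
    Tendsto (fun s : ℝ => C * Real.exp (-(k * s))) atTop (𝓝 0) := by
  have h : Tendsto (fun s : ℝ => Real.exp (-(k * s))) atTop (𝓝 0) :=
    Real.tendsto_exp_neg_atTop_nhds_zero.comp (tendsto_id.const_mul_atTop hk)
  simpa using h.const_mul C

end Rays

/-! ### Hankel's integral for the reciprocal Gamma function -/

section Hankel

/-- A power is dominated by an exponential away from zero. -/
lemma exists_rpow_le_mul_exp (b : ℝ) {c m : ℝ} (hc : 0 < c) (hm : 0 < m) :
    ∃ C, 0 ≤ C ∧ ∀ r, m ≤ r → r ^ b ≤ C * Real.exp (c * r) := by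
  set N := ⌈b⌉₊
  refine ⟨m ^ b * (N.factorial / (c * m) ^ N), by positivity, fun r hr => ?_⟩
  have hr0 : 0 < r := hm.trans_le hr
  have h1 : 1 ≤ r / m := (one_le_div hm).2 hr
  calc r ^ b = m ^ b * (r / m) ^ b := by
        rw [← Real.mul_rpow hm.le (by positivity), mul_div_cancel₀ _ hm.ne']
    _ ≤ m ^ b * (r / m) ^ (N : ℝ) := by
        gcongr
        exact Nat.le_ceil b
    _ = m ^ b * ((c * r) ^ N / (c * m) ^ N) := by
        rw [Real.rpow_natCast, ← div_pow, mul_div_mul_left _ _ hc.ne']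
    _ ≤ m ^ b * ((N.factorial * Real.exp (c * r)) / (c * m) ^ N) := by
        gcongr
        have := Real.pow_div_factorial_le_exp (c * r) (by positivity) N
        rwa [div_le_iff₀ (by positivity), mul_comm (Real.exp _)] at this
    _ = _ := by ring

lemma exists_norm_cpow_le_mul_exp (α : ℂ) {c m : ℝ} (hc : 0 < c) (hm : 0 < m) :
    ∃ C, 0 ≤ C ∧ ∀ z : ℂ, m ≤ ‖z‖ → ‖z ^ α‖ ≤ C * Real.exp (c * ‖z‖) := by
  obtain ⟨C, hC0, hC⟩ := exists_rpow_le_mul_exp α.re hc hm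
  refine ⟨C * Real.exp (Real.pi * |α.im|), by positivity, fun z hz => ?_⟩
  refine (Complex.norm_cpow_le _ _).trans ?_
  rw [div_eq_mul_inv, ← Real.exp_neg]
  calc _ ≤ (C * Real.exp (c * ‖z‖)) * Real.exp (Real.pi * |α.im|) := by
        gcongr
        · exact hC _ hz
        · refine (neg_le_abs _).trans ?_
          rw [abs_mul]
          exact mul_le_mul_of_nonneg_right (Complex.abs_arg_le_pi z) (abs_nonneg _)
    _ = _ := by ring

variable {φ a : ℝ}

lemma cos_neg_of_angle (h1 : Real.pi / 2 < φ) (h2 : φ < Real.pi) : Real.cos φ < 0 :=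
  Real.cos_neg_of_pi_div_two_lt_of_lt h1 (by linarith [Real.pi_pos])

lemma sin_pos_of_angle (h1 : Real.pi / 2 < φ) (h2 : φ < Real.pi) : 0 < Real.sin φ :=
  Real.sin_pos_of_pos_of_lt_pi (by linarith [Real.pi_pos]) h2

lemma abs_sin_of_abs_eq {θ : ℝ} (h : |θ| = φ) : |Real.sin θ| = |Real.sin φ| := by
  rw [← h]
  rcases abs_choice θ with h | h <;> rw [h]
  rw [Real.sin_neg, abs_neg]

lemma cos_of_abs_eq {θ : ℝ} (h : |θ| = φ) : Real.cos θ = Real.cos φ := by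
  rw [← h, Real.cos_abs]

lemma rayPoint_mem_slitPlane {θ s : ℝ} (h1 : Real.pi / 2 < φ) (h2 : φ < Real.pi) (hθ : |θ| = φ)
    (ha : 0 < a) : rayPoint a θ s ∈ Complex.slitPlane := by
  rw [Complex.mem_slitPlane_iff, rayPoint_re, rayPoint_im]
  by_cases hs : s = 0
  · left; simpa [hs]
  · right
    refine mul_ne_zero hs ?_
    rw [← abs_pos, abs_sin_of_abs_eq hθ]
    exact abs_pos.2 (sin_pos_of_angle h1 h2).ne'

/-- The integrand decays exponentially along the rays, locally uniformly in the vertex. -/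
lemma exists_norm_cpow_mul_exp_le (α : ℂ) (h1 : Real.pi / 2 < φ) (h2 : φ < Real.pi) {m : ℝ}
    (hm : 0 < m) : ∃ C, 0 ≤ C ∧ ∀ θ u s : ℝ, |θ| = φ → 0 ≤ u → 0 ≤ s → m ≤ ‖rayPoint u θ s‖ →
      ‖rayPoint u θ s ^ α * Complex.exp (rayPoint u θ s)‖ ≤
        C * Real.exp (2 * u) * Real.exp (-(-Real.cos φ / 2 * s)) := by
  have hcos := cos_neg_of_angle h1 h2
  obtain ⟨C, hC0, hC⟩ := exists_norm_cpow_le_mul_exp α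
    (show 0 < -Real.cos φ / 2 by linarith) hm
  refine ⟨C, hC0, fun θ u s hθ hu hs hz => ?_⟩
  rw [norm_mul, Complex.norm_exp, rayPoint_re, cos_of_abs_eq hθ]
  calc _ ≤ C * Real.exp (-Real.cos φ / 2 * (u + s)) * Real.exp (u + s * Real.cos φ) := by
        gcongr
        refine (hC _ hz).trans ?_
        gcongr
        · linarith
        · exact norm_rayPoint_le hu hs
    _ = C * Real.exp ((1 - Real.cos φ / 2) * u + -(-Real.cos φ / 2 * s)) := by
        rw [mul_assoc, ← Real.exp_add]
        congr 2
        ring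
    _ ≤ C * Real.exp (2 * u + -(-Real.cos φ / 2 * s)) := by
        gcongr
        linarith [Real.neg_one_le_cos φ]
    _ = _ := by rw [Real.exp_add, mul_assoc]

lemma integrableOn_ray_cpow (α : ℂ) (h1 : Real.pi / 2 < φ) (h2 : φ < Real.pi) {θ : ℝ}
    (hθ : |θ| = φ) (ha : 0 < a) :
    IntegrableOn (fun s => (rayPoint a θ s ^ α * Complex.exp (rayPoint a θ s)) *
      Complex.exp (θ * Complex.I)) (Set.Ioi 0) := by
  have hm : 0 < a * |Real.sin θ| := mul_pos ha (by
    rw [abs_sin_of_abs_eq hθ]; exact abs_pos.2 (sin_pos_of_angle h1 h2).ne')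
  obtain ⟨C, -, hC⟩ := exists_norm_cpow_mul_exp_le α h1 h2 hm
  refine integrableOn_ray (F := fun z => z ^ α * Complex.exp z)
    (show 0 < -Real.cos φ / 2 by linarith [cos_neg_of_angle h1 h2])
    ?_ (C := C * Real.exp (2 * a)) fun s hs =>
      hC θ a s hθ ha.le hs.le (mul_sin_le_norm_rayPoint ha.le)
  refine Continuous.continuousOn (continuous_iff_continuousAt.2 fun s => ?_)
  have hc : ContinuousAt (rayPoint a θ) s := continuous_rayPoint.continuousAt
  exact (hc.cpow continuousAt_const (rayPoint_mem_slitPlane h1 h2 hθ ha)).mul hc.cexp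

lemma tendsto_ray_cpow (α : ℂ) (h1 : Real.pi / 2 < φ) (h2 : φ < Real.pi) {θ : ℝ}
    (hθ : |θ| = φ) (ha : 0 < a) :
    Tendsto (fun s => rayPoint a θ s ^ α * Complex.exp (rayPoint a θ s)) atTop (𝓝 0) := by
  have hm : 0 < a * |Real.sin θ| := mul_pos ha (by
    rw [abs_sin_of_abs_eq hθ]; exact abs_pos.2 (sin_pos_of_angle h1 h2).ne')
  obtain ⟨C, -, hC⟩ := exists_norm_cpow_mul_exp_le α h1 h2 hm
  refine squeeze_zero_norm' ?_ (tendsto_exp_neg_mul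
    (show 0 < -Real.cos φ / 2 by linarith [cos_neg_of_angle h1 h2]) (C * Real.exp (2 * a)))
  filter_upwards [eventually_ge_atTop 0] with s hs using
    hC θ a s hθ ha.le hs (mul_sin_le_norm_rayPoint ha.le)

/-- In the logarithmic variable `z = eʷ` the integrand `zᵅ eᶻ dz` becomes entire. -/
lemma exists_log_primitive (α : ℂ) : ∃ G : ℂ → ℂ, ∀ w,
    HasDerivAt G (Complex.exp ((1 + α) * w + Complex.exp w)) w := by
  obtain ⟨G, hG⟩ := (show Differentiable ℂ fun w => Complex.exp ((1 + α) * w + Complex.exp w) by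
    fun_prop).isExactOn_univ
  exact ⟨G, fun w => hG w (Set.mem_univ w)⟩

lemma hasDerivAt_comp_log {α : ℂ} {G : ℂ → ℂ}
    (hG : ∀ w, HasDerivAt G (Complex.exp ((1 + α) * w + Complex.exp w)) w) {z : ℂ}
    (hz : z ∈ Complex.slitPlane) :
    HasDerivAt (fun z => G (Complex.log z)) (z ^ α * Complex.exp z) z := by
  have hz0 := Complex.slitPlane_ne_zero hz
  have e : Complex.exp ((1 + α) * Complex.log z + Complex.exp (Complex.log z)) * z⁻¹ =
      z ^ α * Complex.exp z := by
    rw [Complex.exp_add, Complex.exp_log hz0, add_mul, one_mul, Complex.exp_add,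
      Complex.exp_log hz0, Complex.cpow_def_of_ne_zero hz0, mul_comm α]
    field_simp
  rw [← e]
  exact (hG (Complex.log z)).comp z (Complex.hasDerivAt_log hz)

/-- Far out, the primitive hardly changes between the ray from `a` and the ray from `0`. -/
lemma tendsto_primitive_shift {α : ℂ} {H : ℂ → ℂ} (h1 : Real.pi / 2 < φ) (h2 : φ < Real.pi)
    (hH : ∀ z ∈ Complex.slitPlane, HasDerivAt H (z ^ α * Complex.exp z) z) {θ : ℝ}
    (hθ : |θ| = φ) (ha : 0 < a) :
    Tendsto (fun s => H (rayPoint a θ s) - H (rayPoint 0 θ s)) atTop (𝓝 0) := by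
  have hsin : 0 < |Real.sin θ| := by
    rw [abs_sin_of_abs_eq hθ]; exact abs_pos.2 (sin_pos_of_angle h1 h2).ne'
  obtain ⟨C, hC0, hC⟩ := exists_norm_cpow_mul_exp_le α h1 h2 hsin
  refine squeeze_zero_norm' ?_ (tendsto_exp_neg_mul
    (show 0 < -Real.cos φ / 2 by linarith [cos_neg_of_angle h1 h2]) (C * Real.exp (2 * a) * a))
  filter_upwards [eventually_ge_atTop 1] with s hs
  have hseg : ∀ v ∈ segment ℝ (rayPoint 0 θ s) (rayPoint a θ s), ∃ u, 0 ≤ u ∧ u ≤ a ∧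
      v = rayPoint u θ s := by
    intro v hv
    rw [segment_eq_image_lineMap] at hv
    obtain ⟨t, ht, rfl⟩ := hv
    refine ⟨t * a, mul_nonneg ht.1 ha.le, by nlinarith [ht.2], ?_⟩
    rw [AffineMap.lineMap_apply_module', Complex.real_smul]
    simp only [rayPoint]
    push_cast
    ring
  have him : ∀ u, |Real.sin θ| ≤ |(rayPoint u θ s).im| := by
    intro u
    rw [rayPoint_im, abs_mul, abs_of_nonneg (show 0 ≤ s by linarith)]
    exact le_mul_of_one_le_left hsin.le hs
  have hb := norm_primitive_sub_le (F := fun z => z ^ α * Complex.exp z) (H := H)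
    (C := C * Real.exp (2 * a) * Real.exp (-(-Real.cos φ / 2 * s)))
    (z := rayPoint 0 θ s) (w := rayPoint a θ s) (fun v hv => ?_) (fun v hv => ?_)
  · refine hb.trans (le_of_eq ?_)
    have : ‖rayPoint a θ s - rayPoint 0 θ s‖ = a := by
      have : rayPoint a θ s - rayPoint 0 θ s = (a : ℂ) := by simp [rayPoint]
      rw [this, Complex.norm_real, Real.norm_of_nonneg ha.le]
    rw [this]
    ring
  · obtain ⟨u, -, -, rfl⟩ := hseg v hv
    refine hH _ (Complex.mem_slitPlane_iff.2 (Or.inr fun h => ?_))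
    have := him u
    rw [h, abs_zero] at this
    linarith
  · obtain ⟨u, hu0, hua, rfl⟩ := hseg v hv
    refine (hC θ u s hθ hu0 (by linarith)
      ((him u).trans (Complex.abs_im_le_norm _))).trans ?_
    gcongr

lemma norm_exp_log_integrand (α : ℂ) (u t : ℝ) :
    ‖Complex.exp ((1 + α) * ((u : ℂ) + t * Complex.I) +
      Complex.exp ((u : ℂ) + t * Complex.I))‖ =
      Real.exp ((1 + α.re) * u - α.im * t + Real.exp u * Real.cos t) := by
  rw [Complex.norm_exp, Complex.add_re, Complex.exp_re]
  congr 1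
  simp

/-- The change of the logarithmic primitive along a vertical segment. -/
lemma norm_log_primitive_sub_le {α : ℂ} {G : ℂ → ℂ}
    (hG : ∀ w, HasDerivAt G (Complex.exp ((1 + α) * w + Complex.exp w)) w) {u t₁ t₂ κ : ℝ}
    (h : ∀ t ∈ Set.uIcc t₁ t₂, |t| ≤ Real.pi ∧ Real.cos t ≤ κ) (ht : |t₂ - t₁| ≤ 2 * Real.pi) :
    ‖G (u + t₂ * Complex.I) - G (u + t₁ * Complex.I)‖ ≤
      Real.exp ((1 + α.re) * u + |α.im| * Real.pi + Real.exp u * κ) * (2 * Real.pi) := by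
  have hseg : ∀ v ∈ segment ℝ ((u : ℂ) + t₁ * Complex.I) (u + t₂ * Complex.I),
      ∃ t ∈ Set.uIcc t₁ t₂, v = u + t * Complex.I := by
    intro v hv
    rw [segment_eq_image_lineMap] at hv
    obtain ⟨r, hr, rfl⟩ := hv
    refine ⟨AffineMap.lineMap t₁ t₂ r, ?_, ?_⟩
    · rw [← segment_eq_uIcc, segment_eq_image_lineMap]
      exact ⟨r, hr, rfl⟩
    · rw [AffineMap.lineMap_apply_module', AffineMap.lineMap_apply_module', Complex.real_smul,
        smul_eq_mul]
      push_cast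
      ring
  refine (norm_primitive_sub_le (fun v _ => hG v) fun v hv => ?_).trans
    (mul_le_mul_of_nonneg_left ?_ (Real.exp_pos _).le)
  · obtain ⟨t, ht, rfl⟩ := hseg v hv
    rw [norm_exp_log_integrand, Real.exp_le_exp]
    have h3 : -(α.im * t) ≤ |α.im| * Real.pi := by
      refine (neg_le_abs _).trans ?_
      rw [abs_mul]
      exact mul_le_mul_of_nonneg_left (h t ht).1 (abs_nonneg _)
    have h4 := mul_le_mul_of_nonneg_left (h t ht).2 (Real.exp_pos u).le
    linarith
  · have : (u : ℂ) + t₂ * Complex.I - (u + t₁ * Complex.I) = ((t₂ - t₁ : ℝ) : ℂ) * Complex.I := by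
      push_cast; ring
    rw [this, norm_mul, Complex.norm_I, mul_one, Complex.norm_real, Real.norm_eq_abs]
    exact ht

lemma log_rayPoint_zero {θ s : ℝ} (hs : 0 < s) (hθ : |θ| < Real.pi) :
    Complex.log (rayPoint 0 θ s) = Real.log s + θ * Complex.I := by
  have e : rayPoint 0 θ s = Complex.exp (Real.log s + θ * Complex.I) := by
    rw [rayPoint_zero_left, Complex.exp_add, ← Complex.ofReal_exp, Real.exp_log hs]
  rw [e, Complex.log_exp]
  · simpa using (abs_lt.1 hθ).1
  · simpa using (abs_lt.1 hθ).2.le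

lemma tendsto_log_primitive_sub {α : ℂ} {G : ℂ → ℂ}
    (hG : ∀ w, HasDerivAt G (Complex.exp ((1 + α) * w + Complex.exp w)) w)
    (h1 : Real.pi / 2 < φ) (h2 : φ < Real.pi) {t₁ t₂ : ℝ}
    (h : ∀ t ∈ Set.uIcc t₁ t₂, |t| ≤ Real.pi ∧ Real.cos t ≤ Real.cos φ)
    (ht : |t₂ - t₁| ≤ 2 * Real.pi) :
    Tendsto (fun s : ℝ => G (Real.log s + t₂ * Complex.I) - G (Real.log s + t₁ * Complex.I))
      atTop (𝓝 0) := by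
  have hcos := cos_neg_of_angle h1 h2
  obtain ⟨C, hC0, hC⟩ := exists_rpow_le_mul_exp (1 + α.re)
    (show 0 < -Real.cos φ / 2 by linarith) one_pos
  refine squeeze_zero_norm' ?_ (tendsto_exp_neg_mul
    (show 0 < -Real.cos φ / 2 by linarith) (C * Real.exp (|α.im| * Real.pi) * (2 * Real.pi)))
  filter_upwards [eventually_ge_atTop 1] with s hs
  have hs0 : 0 < s := by linarith
  refine (norm_log_primitive_sub_le hG h ht).trans ?_
  rw [Real.exp_log hs0, Real.exp_add, Real.exp_add]
  have e : Real.exp ((1 + α.re) * Real.log s) = s ^ (1 + α.re) := by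
    rw [Real.rpow_def_of_pos hs0, mul_comm]
  rw [e]
  calc _ ≤ C * Real.exp (-Real.cos φ / 2 * s) * Real.exp (|α.im| * Real.pi) *
        Real.exp (s * Real.cos φ) * (2 * Real.pi) := by
        have := Real.pi_pos
        gcongr
        exact hC s hs
    _ = C * Real.exp (|α.im| * Real.pi) * (2 * Real.pi) *
        (Real.exp (-Real.cos φ / 2 * s) * Real.exp (s * Real.cos φ)) := by ring
    _ = _ := by
        rw [← Real.exp_add]
        congr 2
        ring

/-- The integral across the cut of the logarithmic primitive. -/
lemma tendsto_log_primitive_cut {α : ℂ} {G : ℂ → ℂ} (hα : -1 < α.re)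
    (hG : ∀ w, HasDerivAt G (Complex.exp ((1 + α) * w + Complex.exp w)) w) :
    Tendsto (fun s : ℝ => G (Real.log s + Real.pi * Complex.I) -
      G (Real.log s + (-Real.pi : ℝ) * Complex.I)) atTop
      (𝓝 (Complex.Gamma (1 + α) * (2 * Complex.I * Complex.sin (Real.pi * (1 + α))))) := by
  have hα' : 0 < (1 + α).re := by simp; linarith
  set c : ℂ := 2 * Complex.I * Complex.sin (Real.pi * (1 + α)) with hc
  -- The primitive is extended by zero to negative arguments, to have its limit at the origin.
  set h : ℝ → ℂ := fun s => if s ≤ 0 then 0 else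
    G (Real.log s + Real.pi * Complex.I) - G (Real.log s + (-Real.pi : ℝ) * Complex.I) with hh
  have hder : ∀ s ∈ Set.Ioi (0 : ℝ),
      HasDerivAt h ((Real.exp (-s) : ℂ) * (s : ℂ) ^ (1 + α - 1) * c) s := by
    intro s hs
    have hs0 : (s : ℂ) ≠ 0 := by exact_mod_cast (ne_of_gt hs)
    have hlog : ∀ t : ℝ, HasDerivAt (fun s : ℝ => (Real.log s : ℂ) + t * Complex.I)
        ((s⁻¹ : ℝ) : ℂ) s := fun t =>
      ((Real.hasDerivAt_log (ne_of_gt hs)).ofReal_comp).add_const _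
    have hd := ((hG _).comp s (hlog Real.pi)).sub ((hG _).comp s (hlog (-Real.pi)))
    have hexp : ∀ t : ℝ, Complex.exp ((Real.log s : ℂ) + t * Complex.I) =
        s * Complex.exp (t * Complex.I) := fun t => by
      rw [Complex.exp_add, ← Complex.ofReal_exp, Real.exp_log hs]
    have hm1 : Complex.exp ((-Real.pi : ℝ) * Complex.I) = -1 := by
      rw [Complex.ofReal_neg, neg_mul, Complex.exp_neg, Complex.exp_pi_mul_I]
      norm_num
    have hval : Complex.exp ((1 + α) * ((Real.log s : ℂ) + Real.pi * Complex.I) +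
          Complex.exp ((Real.log s : ℂ) + Real.pi * Complex.I)) * ((s⁻¹ : ℝ) : ℂ) -
        Complex.exp ((1 + α) * ((Real.log s : ℂ) + (-Real.pi : ℝ) * Complex.I) +
          Complex.exp ((Real.log s : ℂ) + (-Real.pi : ℝ) * Complex.I)) * ((s⁻¹ : ℝ) : ℂ) =
        (Real.exp (-s) : ℂ) * (s : ℂ) ^ (1 + α - 1) * c := by
      rw [hexp, hexp, Complex.exp_pi_mul_I, hm1, Complex.exp_add, Complex.exp_add, mul_add,
        mul_add, Complex.exp_add, Complex.exp_add, hc, Complex.sin]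
      have e1 : Complex.exp ((1 + α) * (Real.log s : ℂ)) = s * (s : ℂ) ^ (1 + α - 1) := by
        rw [Complex.cpow_sub _ _ hs0, Complex.cpow_one, mul_div_cancel₀ _ hs0,
          Complex.cpow_def_of_ne_zero hs0, mul_comm, Complex.ofReal_log (le_of_lt hs)]
      have e2 : Complex.exp (-(Real.pi * (1 + α)) * Complex.I) =
          Complex.exp ((1 + α) * ((-Real.pi : ℝ) * Complex.I)) := by
        congr 1; push_cast; ring
      have e3 : Complex.exp (Real.pi * (1 + α) * Complex.I) =
          Complex.exp ((1 + α) * (Real.pi * Complex.I)) := by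
        congr 1; ring
      have e4 : ((Real.exp (-s) : ℝ) : ℂ) = Complex.exp (-(s : ℂ)) := by push_cast; rfl
      rw [e1, e2, e3, e4, mul_neg_one, Complex.ofReal_inv]
      generalize Complex.exp ((1 + α) * ((-Real.pi : ℝ) * Complex.I)) = A
      generalize Complex.exp ((1 + α) * (Real.pi * Complex.I)) = B
      generalize (s : ℂ) ^ (1 + α - 1) = p
      generalize Complex.exp (-(s : ℂ)) = e
      field_simp
      linear_combination p * e * (B - A) * Complex.I_sq
    rw [hval] at hd
    refine hd.congr_of_eventuallyEq ?_
    filter_upwards [lt_mem_nhds hs] with r hr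
    simp [hh, not_le.2 hr]
  have hint : IntegrableOn (fun s : ℝ => (Real.exp (-s) : ℂ) * (s : ℂ) ^ (1 + α - 1) * c)
      (Set.Ioi 0) := (Complex.GammaIntegral_convergent hα').mul_const c
  have hcont : ContinuousWithinAt h (Set.Ici 0) 0 := by
    have h0 : h 0 = 0 := by simp [hh]
    rw [ContinuousWithinAt, h0]
    have hlim : Tendsto (fun s : ℝ => s ^ (1 + α).re * (Real.exp (|α.im| * Real.pi) *
        Real.exp s * (2 * Real.pi))) (𝓝[≥] 0) (𝓝 0) := by
      have hcont : Continuous fun s : ℝ => s ^ (1 + α).re * (Real.exp (|α.im| * Real.pi) *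
          Real.exp s * (2 * Real.pi)) :=
        (Real.continuous_rpow_const hα'.le).mul (by fun_prop)
      have := (hcont.tendsto 0).mono_left (nhdsWithin_le_nhds (s := Set.Ici (0 : ℝ)))
      rwa [Real.zero_rpow hα'.ne', zero_mul] at this
    refine squeeze_zero_norm' ?_ hlim
    filter_upwards [self_mem_nhdsWithin] with s hs
    have hpi := Real.pi_pos
    rcases (show (0 : ℝ) ≤ s from hs).eq_or_lt with rfl | hs'
    · rw [h0, norm_zero]
      have := Real.zero_rpow hα'.ne'
      rw [this, zero_mul]
    · simp only [hh, not_le.2 hs', if_false]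
      refine (norm_log_primitive_sub_le hG (κ := 1) (fun t ht => ?_) ?_).trans ?_
      · rw [Set.uIcc_of_le (by linarith)] at ht
        exact ⟨abs_le.2 ht, Real.cos_le_one t⟩
      · rw [sub_neg_eq_add, abs_of_pos (by linarith)]; linarith
      · rw [Real.exp_log hs', Real.exp_add, Real.exp_add, Real.rpow_def_of_pos hs', mul_one,
          Complex.add_re, Complex.one_re, mul_comm (Real.log s)]
        exact le_of_eq (by ring)
  have hex : Tendsto h atTop (𝓝 (limUnder atTop h)) := by
    refine tendsto_limUnder_of_hasDerivAt_of_integrableOn_Ioi hder hint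
  have hval := integral_Ioi_of_hasDerivAt_of_tendsto hcont hder hint hex
  rw [integral_mul_const, show h 0 = 0 by simp [hh], sub_zero] at hval
  have hGam : ∫ s in Set.Ioi (0 : ℝ), (Real.exp (-s) : ℂ) * (s : ℂ) ^ (1 + α - 1) =
      Complex.Gamma (1 + α) := by
    rw [Complex.Gamma_eq_integral hα']; rfl
  rw [hGam] at hval
  rw [← hval] at hex
  refine hex.congr' ?_
  filter_upwards [eventually_gt_atTop 0] with s hs
  simp [hh, not_le.2 hs]

lemma inv_Gamma_neg_eq {α : ℂ} (hα : -1 < α.re) :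
    Complex.Gamma (1 + α) * (2 * Complex.I * Complex.sin (Real.pi * (1 + α))) /
      (2 * Real.pi * Complex.I) = (Complex.Gamma (-α))⁻¹ := by
  have hG : Complex.Gamma (1 + α) ≠ 0 := Complex.Gamma_ne_zero_of_re_pos (by simp; linarith)
  have hpi : (Real.pi : ℂ) ≠ 0 := by exact_mod_cast Real.pi_ne_zero
  have hrefl := Complex.Gamma_mul_Gamma_one_sub (1 + α)
  rw [show 1 - (1 + α) = -α by ring] at hrefl
  by_cases hs : Complex.sin (Real.pi * (1 + α)) = 0
  · rw [hs, div_zero, mul_eq_zero, or_iff_right hG] at hrefl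
    rw [hs, hrefl]
    simp
  · have hne : Complex.Gamma (-α) ≠ 0 := fun h => by
      rw [h, mul_zero, eq_comm, div_eq_zero_iff] at hrefl
      exact hrefl.elim hpi hs
    rw [eq_div_iff hs] at hrefl
    refine eq_inv_of_mul_eq_one_left ?_
    rw [div_mul_eq_mul_div, div_eq_one_iff_eq (by simp [hpi])]
    linear_combination (2 * Complex.I) * hrefl

lemma loopIntegral_cpow_of_re_gt {α : ℂ} (hα : -1 < α.re) (h1 : Real.pi / 2 < φ)
    (h2 : φ < Real.pi) (ha : 0 < a) :
    loopIntegral (fun z => z ^ α * Complex.exp z) a φ = (Complex.Gamma (-α))⁻¹ := by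
  have hφ0 : 0 < φ := by linarith [Real.pi_pos]
  obtain ⟨G, hG⟩ := exists_log_primitive α
  set H : ℂ → ℂ := fun z => G (Complex.log z)
  have hH : ∀ z ∈ Complex.slitPlane, HasDerivAt H (z ^ α * Complex.exp z) z :=
    fun z hz => hasDerivAt_comp_log hG hz
  have e1 : |φ| = φ := abs_of_pos hφ0
  have e2 : |(-φ)| = φ := by rw [abs_neg, e1]
  have hray : ∀ θ, |θ| = φ → Tendsto (fun s => H (rayPoint 0 θ s)) atTop
      (𝓝 (H a + rayIntegral (fun z => z ^ α * Complex.exp z) a θ)) := fun θ hθ => by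
    have := (tendsto_primitive_ray (F := fun z => z ^ α * Complex.exp z) (H := H)
      (fun s _ => hH _ (rayPoint_mem_slitPlane h1 h2 hθ ha))
      (integrableOn_ray_cpow α h1 h2 hθ ha)).sub (tendsto_primitive_shift h1 h2 hH hθ ha)
    simpa using this
  have hcut : ∀ t₁ t₂, |t₂ - t₁| ≤ 2 * Real.pi →
      (∀ t ∈ Set.uIcc t₁ t₂, φ ≤ |t| ∧ |t| ≤ Real.pi) →
      Tendsto (fun s : ℝ => G (Real.log s + t₂ * Complex.I) - G (Real.log s + t₁ * Complex.I))
        atTop (𝓝 0) := fun t₁ t₂ ht h =>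
    tendsto_log_primitive_sub hG h1 h2 (fun t hmem => ⟨(h t hmem).2, by
      rw [← Real.cos_abs t]
      exact Real.cos_le_cos_of_nonneg_of_le_pi hφ0.le (h t hmem).2 (h t hmem).1⟩) ht
  have hup := hcut Real.pi φ (by rw [abs_le]; constructor <;> linarith) fun t ht => by
    rw [Set.uIcc_of_ge h2.le] at ht
    rw [abs_of_pos (by linarith [ht.1])]
    exact ht
  have hdown := hcut (-Real.pi) (-φ) (by rw [abs_le]; constructor <;> linarith) fun t ht => by
    rw [Set.uIcc_of_le (by linarith)] at ht
    rw [abs_of_neg (by linarith [ht.2])]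
    constructor <;> linarith [ht.1, ht.2]
  have hlim1 := (hray φ e1).sub (hray (-φ) e2)
  have hlim2 := (tendsto_log_primitive_cut hα hG).add (hup.sub hdown)
  have heq : (fun s => H (rayPoint 0 φ s) - H (rayPoint 0 (-φ) s)) =ᶠ[atTop] fun s : ℝ =>
      G (Real.log s + Real.pi * Complex.I) - G (Real.log s + (-Real.pi : ℝ) * Complex.I) +
      (G (Real.log s + φ * Complex.I) - G (Real.log s + Real.pi * Complex.I) -
      (G (Real.log s + (-φ : ℝ) * Complex.I) -
        G (Real.log s + (-Real.pi : ℝ) * Complex.I))) := by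
    filter_upwards [eventually_gt_atTop 0] with s hs
    simp only [H]
    rw [log_rayPoint_zero hs (by rw [e1]; exact h2), log_rayPoint_zero hs (by rw [e2]; exact h2)]
    ring
  have := tendsto_nhds_unique (hlim1.congr' heq) hlim2
  rw [add_sub_add_left_eq_sub, sub_zero, add_zero] at this
  rw [loopIntegral, this, inv_Gamma_neg_eq hα]

/-- The exponent `-1`, for which the reflection formula is not available, is reached by
continuity. -/
lemma loopIntegral_cpow_neg_one (h1 : Real.pi / 2 < φ) (h2 : φ < Real.pi) (ha : 0 < a) :
    loopIntegral (fun z => z ^ (-1 : ℂ) * Complex.exp z) a φ =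
      (Complex.Gamma (-(-1 : ℂ)))⁻¹ := by
  have hφ0 : 0 < φ := by linarith [Real.pi_pos]
  have hcos := cos_neg_of_angle h1 h2
  set α : ℕ → ℂ := fun n => -1 + ((1 / ((n : ℝ) + 1) : ℝ) : ℂ) with hα
  have hαlim : Tendsto α atTop (𝓝 (-1)) := by
    have := ((Complex.continuous_ofReal.tendsto 0).comp
      (tendsto_one_div_add_atTop_nhds_zero_nat (𝕜 := ℝ))).const_add (-1 : ℂ)
    simpa [hα] using this
  have hray : ∀ θ, |θ| = φ → Tendsto (fun n => rayIntegral (fun z => z ^ α n * Complex.exp z) a θ)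
      atTop (𝓝 (rayIntegral (fun z => z ^ (-1 : ℂ) * Complex.exp z) a θ)) := by
    intro θ hθ
    have hm : 0 < a * |Real.sin θ| := mul_pos ha (by
      rw [abs_sin_of_abs_eq hθ]; exact abs_pos.2 (sin_pos_of_angle h1 h2).ne')
    refine tendsto_integral_of_dominated_convergence
      (fun s => ((1 + (a * |Real.sin θ|)⁻¹) * Real.exp a) * Real.exp (-(-Real.cos φ * s)))
      (fun n => (integrableOn_ray_cpow (α n) h1 h2 hθ ha).aestronglyMeasurable)
      ((integrableOn_exp_neg_mul (by linarith)).const_mul _) (fun n => ?_) ?_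
    · refine (ae_restrict_iff' measurableSet_Ioi).2 (ae_of_all _ fun s hs => ?_)
      have hz := mul_sin_le_norm_rayPoint (θ := θ) (s := s) ha.le
      set z := rayPoint a θ s with hzdef
      have hz0 : 0 < ‖z‖ := hm.trans_le hz
      rw [norm_mul, norm_exp_mul_I, mul_one, norm_mul, Complex.norm_exp, hzdef, rayPoint_re,
        ← hzdef, cos_of_abs_eq hθ]
      have hexp : ((1 + (a * |Real.sin θ|)⁻¹) * Real.exp a) * Real.exp (-(-Real.cos φ * s)) =
          (1 + (a * |Real.sin θ|)⁻¹) * Real.exp (a + s * Real.cos φ) := by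
        rw [mul_assoc, ← Real.exp_add]
        congr 2
        ring
      rw [hexp]
      refine mul_le_mul_of_nonneg_right ?_ (Real.exp_pos _).le
      have hpow : ‖z ^ α n‖ = ‖z‖ ^ (-1 + 1 / ((n : ℝ) + 1)) := by
        have : α n = ((-1 + 1 / ((n : ℝ) + 1) : ℝ) : ℂ) := by simp [hα]
        rw [this, Complex.norm_cpow_real]
      have hn : 1 / ((n : ℝ) + 1) ≤ 1 := by
        rw [div_le_one (by positivity)]
        linarith [(Nat.cast_nonneg n : (0 : ℝ) ≤ n)]
      have hn0 : 0 ≤ 1 / ((n : ℝ) + 1) := by positivity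
      rw [hpow]
      rcases le_total 1 ‖z‖ with h | h
      · refine (Real.rpow_le_one_of_one_le_of_nonpos h (by linarith)).trans ?_
        linarith [inv_pos.2 hm]
      · have : ‖z‖ ^ (-1 + 1 / ((n : ℝ) + 1)) ≤ ‖z‖ ^ (-1 : ℝ) :=
          Real.rpow_le_rpow_of_exponent_ge hz0 h (by linarith)
        rw [Real.rpow_neg_one] at this
        linarith [inv_anti₀ hm hz]
    · refine ae_of_all _ fun s => ?_
      have hz0 : rayPoint a θ s ≠ 0 := Complex.slitPlane_ne_zero
        (rayPoint_mem_slitPlane h1 h2 hθ ha)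
      exact ((hαlim.const_cpow (Or.inl hz0)).mul_const _).mul_const _
  have hL := ((hray φ (abs_of_pos hφ0)).sub (hray (-φ) (by rw [abs_neg, abs_of_pos hφ0]))).div_const
    (2 * Real.pi * Complex.I)
  have hR : Tendsto (fun n => (Complex.Gamma (-α n))⁻¹) atTop
      (𝓝 (Complex.Gamma (-(-1 : ℂ)))⁻¹) :=
    (Complex.differentiable_one_div_Gamma.continuous.tendsto _).comp hαlim.neg
  refine tendsto_nhds_unique hL (hR.congr fun n => ?_)
  refine (loopIntegral_cpow_of_re_gt ?_ h1 h2 ha).symm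
  have : 0 < 1 / ((n : ℝ) + 1) := by positivity
  have e : (α n).re = -1 + 1 / ((n : ℝ) + 1) := by
    simp only [hα, Complex.add_re, Complex.neg_re, Complex.one_re, Complex.ofReal_re]
  linarith

/-- **Hankel's formula** `(1 / 2πi) ∫ zᵅ eᶻ dz = 1 / Γ(-α)`. -/
lemma loopIntegral_cpow (α : ℂ) (h1 : Real.pi / 2 < φ) (h2 : φ < Real.pi) (ha : 0 < a) :
    loopIntegral (fun z => z ^ α * Complex.exp z) a φ = (Complex.Gamma (-α))⁻¹ := by
  have hφ0 : 0 < φ := by linarith [Real.pi_pos]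
  have key : ∀ n : ℕ, ∀ α : ℂ, -1 - (n : ℝ) < α.re →
      loopIntegral (fun z => z ^ α * Complex.exp z) a φ = (Complex.Gamma (-α))⁻¹ := by
    intro n
    induction n with
    | zero =>
      intro α hα
      exact loopIntegral_cpow_of_re_gt (by simpa using hα) h1 h2 ha
    | succ n ih =>
      intro α hα
      by_cases hα1 : α = -1
      · rw [hα1]
        exact loopIntegral_cpow_neg_one h1 h2 ha
      have hne : α + 1 ≠ 0 := fun h => hα1 (eq_neg_of_add_eq_zero_left h)
      have hih := ih (α + 1) (by push_cast at hα; simp; linarith)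
      -- Integrate the derivative of `z ^ (α + 1) * exp z` along both rays.
      have hray : ∀ θ, |θ| = φ →
          (α + 1) * rayIntegral (fun z => z ^ α * Complex.exp z) a θ +
            rayIntegral (fun z => z ^ (α + 1) * Complex.exp z) a θ =
            -((a : ℂ) ^ (α + 1) * Complex.exp a) := by
        intro θ hθ
        have i1 := (integrableOn_ray_cpow α h1 h2 hθ ha).const_mul (α + 1)
        have i2 := integrableOn_ray_cpow (α + 1) h1 h2 hθ ha
        have hd := rayIntegral_deriv (F := fun z => z ^ (α + 1) * Complex.exp z)
          (F' := fun z => (α + 1) * (z ^ α * Complex.exp z) + z ^ (α + 1) * Complex.exp z)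
          (a := a) (θ := θ) (fun s _ => ?_) ?_ (tendsto_ray_cpow (α + 1) h1 h2 hθ ha)
        · rw [← hd, rayIntegral, rayIntegral, rayIntegral, ← integral_const_mul,
            ← integral_add i1 i2]
          refine integral_congr_ae (ae_of_all _ fun s => ?_)
          simp only
          ring
        · have hz := rayPoint_mem_slitPlane (s := s) h1 h2 hθ ha
          have := ((hasDerivAt_id (rayPoint a θ s)).cpow_const (c := α + 1) hz).mul
            (Complex.hasDerivAt_exp (rayPoint a θ s))
          rw [add_sub_cancel_right, mul_one] at this
          have e : (α + 1) * id (rayPoint a θ s) ^ α * Complex.exp (rayPoint a θ s) =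
            (α + 1) * (rayPoint a θ s ^ α * Complex.exp (rayPoint a θ s)) := by
            rw [mul_assoc]; rfl
          rw [e] at this
          exact this
        · refine (i1.add i2).congr (ae_of_all _ fun s => ?_)
          simp only [Pi.add_apply]
          ring
      have hp := hray φ (abs_of_pos hφ0)
      have hm := hray (-φ) (by rw [abs_neg, abs_of_pos hφ0])
      have hsum : (α + 1) * loopIntegral (fun z => z ^ α * Complex.exp z) a φ +
          loopIntegral (fun z => z ^ (α + 1) * Complex.exp z) a φ = 0 := by
        rw [loopIntegral, loopIntegral, mul_div_assoc', ← add_div,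
          show (α + 1) * (rayIntegral (fun z => z ^ α * Complex.exp z) a φ -
            rayIntegral (fun z => z ^ α * Complex.exp z) a (-φ)) +
            (rayIntegral (fun z => z ^ (α + 1) * Complex.exp z) a φ -
            rayIntegral (fun z => z ^ (α + 1) * Complex.exp z) a (-φ)) = 0 by
              linear_combination hp - hm, zero_div]
      have hΓ : Complex.Gamma (-α) = -(α + 1) * Complex.Gamma (-(α + 1)) := by
        rw [← Complex.Gamma_add_one _ (neg_ne_zero.2 hne)]
        congr 1
        ring
      rw [hih] at hsum
      rw [hΓ, mul_inv]
      have hne' : -(α + 1) ≠ 0 := neg_ne_zero.2 hne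
      rw [eq_inv_mul_iff_mul_eq₀ hne']
      linear_combination -hsum
  obtain ⟨n, hn⟩ := exists_nat_gt (-α.re)
  exact key n α (by linarith)

lemma ofReal_mul_cpow {x : ℝ} (hx : 0 < x) (z α : ℂ) :
    ((x : ℂ) * z) ^ α = (x : ℂ) ^ α * z ^ α := by
  have hx0 : (x : ℂ) ≠ 0 := by exact_mod_cast hx.ne'
  by_cases hz : z = 0
  · by_cases hα : α = 0
    · simp [hα]
    · rw [hz, mul_zero, Complex.zero_cpow hα, mul_zero]
  · rw [Complex.cpow_def_of_ne_zero (mul_ne_zero hx0 hz), Complex.cpow_def_of_ne_zero hx0,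
      Complex.cpow_def_of_ne_zero hz, ← Complex.exp_add, Complex.log_ofReal_mul hx hz,
      ← Complex.ofReal_log hx.le, add_mul]

/-- Hankel's formula with a positive parameter. -/
lemma loopIntegral_cpow_mul (α : ℂ) (h1 : Real.pi / 2 < φ) (h2 : φ < Real.pi) (ha : 0 < a)
    {x : ℝ} (hx : 0 < x) :
    loopIntegral (fun z => z ^ α * Complex.exp (z * x)) a φ =
      (x : ℂ) ^ (-1 - α) / Complex.Gamma (-α) := by
  have hx0 : (x : ℂ) ≠ 0 := by exact_mod_cast hx.ne'
  have h := loopIntegral_comp_mul (F := fun z => z ^ α * Complex.exp z) (a := a) (φ := φ) hx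
  rw [loopIntegral_cpow α h1 h2 (mul_pos hx ha)] at h
  have e : (fun z : ℂ => z ^ α * Complex.exp (z * x)) =
      fun z => (x : ℂ) ^ (-α) * ((x * z) ^ α * Complex.exp (x * z)) := by
    funext z
    have : (x : ℂ) ^ (-α) * (x : ℂ) ^ α = 1 := by
      rw [← Complex.cpow_add _ _ hx0, neg_add_cancel, Complex.cpow_zero]
    rw [ofReal_mul_cpow hx, mul_comm z]
    linear_combination -(z ^ α * Complex.exp (x * z)) * this
  rw [e, loopIntegral_const_mul, h, sub_eq_add_neg, Complex.cpow_add _ _ hx0,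
    Complex.cpow_neg_one, div_eq_mul_inv]
  ring

end Hankel

/-! ### From vertical lines to the rays -/

section Inversion

variable {f : ℂ → ℂ} {φ φ' a x ε S ρ : ℝ}

lemma rayPoint_mem_sector {M u θ s : ℝ} (hφ : φ < φ') (hu : 0 < u) (hs : 0 ≤ s) (hθ : |θ| = φ)
    (h0 : Real.sin φ ≠ 0) (hM : M < ‖rayPoint u θ s‖) : rayPoint u θ s ∈ sector φ' M := by
  refine ⟨hM, (abs_arg_rayPoint_le hu hs ?_).trans_lt (by rwa [hθ])⟩
  rw [← abs_pos, abs_sin_of_abs_eq hθ]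
  exact abs_pos.2 h0

/-- The integral over a horizontal segment that starts on the ray from `a`. -/
lemma norm_primitive_horizontal_le {H : ℂ → ℂ} (hx : 0 < x)
    (hH : ∀ z, HasDerivAt H (f z * Complex.exp (z * x)) z) (hf : Continuous f) {θ u : ℝ}
    (hau : a ≤ u) (hρ0 : 0 ≤ ρ) (hρ : ∀ v, a ≤ v → ‖f (rayPoint v θ S)‖ ≤ ρ) :
    ‖H (rayPoint u θ S) - H (rayPoint a θ S)‖ ≤ ρ * Real.exp (x * (rayPoint u θ S).re) / x := by
  have hd : ∀ v : ℝ, HasDerivAt (fun v : ℝ => H (rayPoint v θ S))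
      (f (rayPoint v θ S) * Complex.exp (rayPoint v θ S * x)) v := fun v => by
    have h1 : HasDerivAt (fun v : ℝ => rayPoint v θ S) 1 v := by
      have := ((hasDerivAt_id v).ofReal_comp).add_const (S * Complex.exp (θ * Complex.I))
      simpa [rayPoint] using this
    have := (hH (rayPoint v θ S)).comp v h1
    rwa [mul_one] at this
  have hcont : Continuous fun v : ℝ => rayPoint v θ S := by unfold rayPoint; fun_prop
  have hcont' : Continuous fun v : ℝ => f (rayPoint v θ S) * Complex.exp (rayPoint v θ S * x) := by
    fun_prop
  have hint := intervalIntegral.integral_eq_sub_of_hasDerivAt (fun v _ => hd v)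
    (hcont'.intervalIntegrable a u)
  rw [← hint]
  set c := S * Real.cos θ
  have hbd : ∀ v : ℝ, HasDerivAt (fun v => ρ * Real.exp (x * (v + c)) / x)
      (ρ * Real.exp (x * (v + c))) v := fun v => by
    have h1 : HasDerivAt (fun v => x * (v + c)) x v := by
      simpa using ((hasDerivAt_id v).add_const c).const_mul x
    have := (h1.exp.const_mul ρ).div_const x
    rwa [← mul_assoc, mul_div_cancel_right₀ _ hx.ne'] at this
  have hbint := intervalIntegral.integral_eq_sub_of_hasDerivAt (fun v _ => hbd v)
    ((show Continuous fun v => ρ * Real.exp (x * (v + c)) by fun_prop).intervalIntegrable a u)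
  refine (intervalIntegral.norm_integral_le_of_norm_le hau
    (g := fun v => ρ * Real.exp (x * (v + c)))
    (ae_of_all _ fun v hv => ?_) ((show Continuous fun v => ρ * Real.exp (x * (v + c)) by
      fun_prop).intervalIntegrable a u)).trans ?_
  · rw [norm_mul, Complex.norm_exp, Complex.re_mul_ofReal, rayPoint_re, mul_comm _ x]
    exact mul_le_mul_of_nonneg_right (hρ v hv.1.le) (Real.exp_pos _).le
  · rw [hbint, rayPoint_re]
    have : 0 ≤ ρ * Real.exp (x * (a + c)) / x := by positivity
    linarith

/-- The integral over a vertical segment agrees with the integrals over two segments of the rays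
up to the contribution of two horizontal segments. -/
lemma norm_vertical_sub_rays_le (hf : Differentiable ℂ f) (hx : 0 < x)
    (haS : a ≤ ε - S * Real.cos φ) (hρ0 : 0 ≤ ρ) (hφ0 : 0 ≤ φ)
    (hρ : ∀ v θ, |θ| = φ → a ≤ v → ‖f (rayPoint v θ S)‖ ≤ ρ) :
    ‖(∫ y in (-(S * Real.sin φ))..(S * Real.sin φ),
        f (ε + y * Complex.I) * Complex.exp ((ε + y * Complex.I) * x)) * Complex.I -
      ((∫ s in (0 : ℝ)..S, f (rayPoint a φ s) * Complex.exp (rayPoint a φ s * x) *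
          Complex.exp (φ * Complex.I)) -
        ∫ s in (0 : ℝ)..S, f (rayPoint a (-φ) s) * Complex.exp (rayPoint a (-φ) s * x) *
          Complex.exp ((-φ : ℝ) * Complex.I))‖ ≤ 2 * (ρ * Real.exp (x * ε) / x) := by
  obtain ⟨H, hH'⟩ := (show Differentiable ℂ fun z => f z * Complex.exp (z * x) by
    fun_prop).isExactOn_univ
  have hH : ∀ z, HasDerivAt H (f z * Complex.exp (z * x)) z := fun z => hH' z (Set.mem_univ z)
  have hfc := hf.continuous
  have hrc : ∀ θ, Continuous (rayPoint a θ) := fun θ => continuous_rayPoint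
  have hray : ∀ θ, ∫ s in (0 : ℝ)..S, f (rayPoint a θ s) * Complex.exp (rayPoint a θ s * x) *
      Complex.exp (θ * Complex.I) = H (rayPoint a θ S) - H a := by
    intro θ
    have := hrc θ
    rw [intervalIntegral.integral_eq_sub_of_hasDerivAt (f := fun s => H (rayPoint a θ s))
      (fun s _ => (hH _).comp s hasDerivAt_rayPoint)
      (Continuous.intervalIntegrable (by fun_prop) _ _)]
    simp
  have hvert : (∫ y in (-(S * Real.sin φ))..(S * Real.sin φ),
        f (ε + y * Complex.I) * Complex.exp ((ε + y * Complex.I) * x)) * Complex.I =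
      H (ε + (S * Real.sin φ : ℝ) * Complex.I) - H (ε + (-(S * Real.sin φ) : ℝ) * Complex.I) := by
    rw [← intervalIntegral.integral_mul_const]
    refine intervalIntegral.integral_eq_sub_of_hasDerivAt
      (f := fun y : ℝ => H (ε + y * Complex.I)) (fun y _ => ?_)
      (Continuous.intervalIntegrable (by fun_prop) _ _)
    have h1 : HasDerivAt (fun y : ℝ => (ε : ℂ) + y * Complex.I) Complex.I y := by
      simpa using (((hasDerivAt_id y).ofReal_comp).mul_const Complex.I).const_add (ε : ℂ)
    exact (hH _).comp y h1
  have hpt : ∀ θ, |θ| = φ → rayPoint (ε - S * Real.cos φ) θ S =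
      ε + (S * Real.sin θ : ℝ) * Complex.I := by
    intro θ hθ
    rw [rayPoint_eq, cos_of_abs_eq hθ]
    congr 2
    ring
  have hhor : ∀ θ, |θ| = φ → ‖H (ε + (S * Real.sin θ : ℝ) * Complex.I) - H (rayPoint a θ S)‖ ≤
      ρ * Real.exp (x * ε) / x := by
    intro θ hθ
    have := norm_primitive_horizontal_le hx hH hfc (θ := θ) haS hρ0 fun v hv => hρ v θ hθ hv
    rwa [hpt θ hθ, ← hpt θ hθ, rayPoint_re, cos_of_abs_eq hθ, sub_add_cancel, hpt θ hθ] at this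
  have e1 := hhor φ (abs_of_nonneg hφ0)
  have e2 := hhor (-φ) (by rw [abs_neg, abs_of_nonneg hφ0])
  rw [Real.sin_neg, mul_neg] at e2
  rw [hvert, hray, hray]
  refine le_trans (le_of_eq ?_) ((norm_sub_le _ _).trans ((add_le_add e1 e2).trans
    (le_of_eq (by ring))))
  congr 1
  ring

/-- A function of the sector that tends to zero at infinity there. -/
def VanishesInSector (f : ℂ → ℂ) (φ : ℝ) : Prop :=
  ∀ ρ > 0, ∃ M > 0, ∀ w ∈ sector φ M, ‖f w‖ ≤ ρ

lemma norm_mul_exp_le {θ s C : ℝ} (hθ : |θ| = φ) (hC : ‖f (rayPoint a θ s)‖ ≤ C) :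
    ‖f (rayPoint a θ s) * Complex.exp (rayPoint a θ s * x)‖ ≤
      (C * Real.exp (a * x)) * Real.exp (-(-Real.cos φ * x * s)) := by
  rw [norm_mul, Complex.norm_exp, Complex.re_mul_ofReal, rayPoint_re, cos_of_abs_eq hθ, mul_assoc C,
    ← Real.exp_add]
  refine mul_le_mul hC (le_of_eq ?_) (Real.exp_pos _).le ((norm_nonneg _).trans hC)
  congr 1
  ring

lemma integrableOn_ray_mul_exp {θ C : ℝ} (hx : 0 < x) (hcos : Real.cos φ < 0) (hθ : |θ| = φ)
    (hf : ContinuousOn (fun s => f (rayPoint a θ s)) (Set.Ioi 0))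
    (hC : ∀ s, 0 < s → ‖f (rayPoint a θ s)‖ ≤ C) :
    IntegrableOn (fun s => (f (rayPoint a θ s) * Complex.exp (rayPoint a θ s * x)) *
      Complex.exp (θ * Complex.I)) (Set.Ioi 0) := by
  have := continuous_rayPoint (a := a) (θ := θ)
  exact integrableOn_ray (F := fun z => f z * Complex.exp (z * x))
    (mul_pos (neg_pos.2 hcos) hx) (hf.mul (by fun_prop)) fun s hs => norm_mul_exp_le hθ (hC s hs)

/-- The inversion integrals over vertical lines converge to the integral over the rays. -/
lemma tendsto_vertical (h1 : Real.pi / 2 < φ) (h2 : φ < Real.pi)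
    (hf : Differentiable ℂ f) (hφ : φ < φ') (hdec : VanishesInSector f φ')
    (hx : 0 < x) (ha : 0 < a)
    (hone : ∀ θ s, |θ| = φ → 0 < s → ‖f (rayPoint a θ s)‖ ≤ 1) (ε : ℝ) :
    Tendsto (fun T : ℝ => (1 / (2 * (Real.pi : ℂ))) *
        ∫ y in (-T)..T, f (ε + y * Complex.I) * Complex.exp ((ε + y * Complex.I) * x)) atTop
      (𝓝 (loopIntegral (fun z => f z * Complex.exp (z * x)) a φ)) := by
  have hcos := cos_neg_of_angle h1 h2
  have hsin := sin_pos_of_angle h1 h2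
  have hφ0 : 0 < φ := by linarith [Real.pi_pos]
  have hfc := hf.continuous
  have hint : ∀ θ, |θ| = φ → Tendsto (fun S => ∫ s in (0 : ℝ)..S, f (rayPoint a θ s) *
      Complex.exp (rayPoint a θ s * x) * Complex.exp (θ * Complex.I)) atTop
      (𝓝 (rayIntegral (fun z => f z * Complex.exp (z * x)) a θ)) := fun θ hθ => by
    have := continuous_rayPoint (a := a) (θ := θ)
    exact intervalIntegral_tendsto_integral_Ioi 0
      (integrableOn_ray_mul_exp hx hcos hθ (by fun_prop) fun s hs => hone θ s hθ hs) tendsto_id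
  have hR := (hint φ (abs_of_pos hφ0)).sub (hint (-φ) (by rw [abs_neg, abs_of_pos hφ0]))
  have hdiff : Tendsto (fun S : ℝ => (∫ y in (-(S * Real.sin φ))..(S * Real.sin φ),
        f (ε + y * Complex.I) * Complex.exp ((ε + y * Complex.I) * x)) * Complex.I -
      ((∫ s in (0 : ℝ)..S, f (rayPoint a φ s) * Complex.exp (rayPoint a φ s * x) *
          Complex.exp (φ * Complex.I)) -
        ∫ s in (0 : ℝ)..S, f (rayPoint a (-φ) s) * Complex.exp (rayPoint a (-φ) s * x) *
          Complex.exp ((-φ : ℝ) * Complex.I))) atTop (𝓝 0) := by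
    rw [Metric.tendsto_atTop]
    intro δ hδ
    set ρ := δ / 4 / (Real.exp (x * ε) / x) with hρdef
    have hρ0 : 0 < ρ := by positivity
    obtain ⟨M, hM0, hM⟩ := hdec ρ hρ0
    refine ⟨max 0 (max ((a - ε) / -Real.cos φ) (M / Real.sin φ + 1)), fun S hS => ?_⟩
    have hS0 : 0 ≤ S := (le_max_left _ _).trans hS
    have hS1 : (a - ε) / -Real.cos φ ≤ S := ((le_max_left _ _).trans (le_max_right _ _)).trans hS
    have hS2 : M / Real.sin φ + 1 ≤ S := ((le_max_right _ _).trans (le_max_right _ _)).trans hS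
    rw [div_le_iff₀ (neg_pos.2 hcos)] at hS1
    have hS3 : M < S * Real.sin φ := by
      rw [← div_lt_iff₀ hsin]; linarith
    rw [dist_zero_right]
    refine (norm_vertical_sub_rays_le hf hx (a := a) (by linarith) hρ0.le hφ0.le
      fun v θ hθ hv => hM _ (rayPoint_mem_sector hφ (by linarith) hS0 hθ hsin.ne' ?_)).trans_lt ?_
    · refine hS3.trans_le (le_trans (le_of_eq ?_) (Complex.abs_im_le_norm _))
      rw [rayPoint_im, abs_mul, abs_of_nonneg hS0, abs_sin_of_abs_eq hθ, abs_of_pos hsin]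
    · have : ρ * Real.exp (x * ε) / x = δ / 4 := by
        rw [hρdef]
        field_simp
      rw [this]
      linarith
  have hS := hdiff.add hR
  have hcomp := (hS.comp (tendsto_id.atTop_div_const hsin)).div_const (2 * Real.pi * Complex.I)
  rw [zero_add] at hcomp
  refine hcomp.congr fun T => ?_
  simp only [Function.comp_apply, id, sub_add_cancel, div_mul_cancel₀ _ hsin.ne']
  rw [mul_div_mul_right _ _ Complex.I_ne_zero, one_div_mul_eq_div]

/-- A bound of the inversion integrals that is locally uniform in `x`. -/
lemma exists_norm_vertical_le (h1 : Real.pi / 2 < φ) (h2 : φ < Real.pi)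
    (hf : Differentiable ℂ f) (hφ : φ < φ')
    (hdec : VanishesInSector f φ') (ha : 0 < a)
    (hone : ∀ θ s, |θ| = φ → 0 < s → ‖f (rayPoint a θ s)‖ ≤ 1) :
    ∃ C T₀ : ℝ, ∀ x T : ℝ, 0 < x → T₀ ≤ T → ‖∫ y in (-T)..T, f ((0 : ℝ) + y * Complex.I) *
      Complex.exp (((0 : ℝ) + y * Complex.I) * x)‖ ≤ C * Real.exp (a * x) / x := by
  have hcos := cos_neg_of_angle h1 h2
  have hsin := sin_pos_of_angle h1 h2
  have hφ0 : 0 < φ := by linarith [Real.pi_pos]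
  obtain ⟨M, hM0, hM⟩ := hdec 1 one_pos
  set S₀ := max 0 (max (a / -Real.cos φ) (M / Real.sin φ + 1))
  refine ⟨2 + 2 / -Real.cos φ, S₀ * Real.sin φ, fun x T hx hT => ?_⟩
  set S := T / Real.sin φ with hSdef
  have hS : S₀ ≤ S := (le_div_iff₀ hsin).2 hT
  have hS0 : 0 ≤ S := (le_max_left _ _).trans hS
  have hS1 : a / -Real.cos φ ≤ S := ((le_max_left _ _).trans (le_max_right _ _)).trans hS
  have hS2 : M / Real.sin φ + 1 ≤ S := ((le_max_right _ _).trans (le_max_right _ _)).trans hS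
  rw [div_le_iff₀ (neg_pos.2 hcos)] at hS1
  have hS3 : M < S * Real.sin φ := by
    rw [← div_lt_iff₀ hsin]; linarith
  have hb := norm_vertical_sub_rays_le hf hx (ε := 0) (a := a) (S := S) (by linarith) zero_le_one
    hφ0.le fun v θ hθ hv => hM _ (rayPoint_mem_sector hφ (by linarith) hS0 hθ hsin.ne' (by
      refine hS3.trans_le (le_trans (le_of_eq ?_) (Complex.abs_im_le_norm _))
      rw [rayPoint_im, abs_mul, abs_of_nonneg hS0, abs_sin_of_abs_eq hθ, abs_of_pos hsin]))
  have hT' : S * Real.sin φ = T := div_mul_cancel₀ _ hsin.ne'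
  rw [hT', mul_zero, Real.exp_zero, mul_one] at hb
  have hk : 0 < -Real.cos φ * x := mul_pos (neg_pos.2 hcos) hx
  have hray : ∀ θ, |θ| = φ → ‖∫ s in (0 : ℝ)..S, f (rayPoint a θ s) *
      Complex.exp (rayPoint a θ s * x) * Complex.exp (θ * Complex.I)‖ ≤
      Real.exp (a * x) * (1 / (-Real.cos φ * x)) := fun θ hθ => by
    have hval : ∫ s in Set.Ioi (0 : ℝ), Real.exp (-(-Real.cos φ * x * s)) =
        1 / (-Real.cos φ * x) := by
      have := integral_exp_mul_Ioi (neg_lt_zero.2 hk) 0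
      simp only [mul_zero, Real.exp_zero, neg_mul] at this
      simp only [neg_mul]
      rw [this]
      ring
    rw [intervalIntegral.integral_of_le hS0]
    refine (norm_integral_le_of_norm_le (((integrableOn_exp_neg_mul hk).mono_set
      Set.Ioc_subset_Ioi_self).const_mul (Real.exp (a * x)))
      ((ae_restrict_iff' measurableSet_Ioc).2 (ae_of_all _ fun s hs => ?_))).trans ?_
    · rw [norm_mul, norm_exp_mul_I, mul_one]
      simpa using norm_mul_exp_le (x := x) hθ (hone θ s hθ hs.1)
    · rw [integral_const_mul, ← hval]
      refine mul_le_mul_of_nonneg_left ?_ (Real.exp_pos _).le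
      exact setIntegral_mono_set (integrableOn_exp_neg_mul hk)
        (ae_of_all _ fun s => (Real.exp_pos _).le) Set.Ioc_subset_Ioi_self.eventuallyLE
  have r1 := hray φ (abs_of_pos hφ0)
  have r2 := hray (-φ) (by rw [abs_neg, abs_of_pos hφ0])
  have hexp : 1 ≤ Real.exp (a * x) := Real.one_le_exp (by positivity)
  have hfin : 2 * (1 / x) + (Real.exp (a * x) * (1 / (-Real.cos φ * x)) +
      Real.exp (a * x) * (1 / (-Real.cos φ * x))) ≤
      (2 + 2 / -Real.cos φ) * Real.exp (a * x) / x := by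
    have e : (2 + 2 / -Real.cos φ) * Real.exp (a * x) / x = 2 * (1 / x) * Real.exp (a * x) +
        (Real.exp (a * x) * (1 / (-Real.cos φ * x)) +
          Real.exp (a * x) * (1 / (-Real.cos φ * x))) := by
      have := hcos.ne
      field_simp
      ring
    rw [e]
    have : 2 * (1 / x) ≤ 2 * (1 / x) * Real.exp (a * x) :=
      le_mul_of_one_le_right (by positivity) hexp
    linarith
  refine le_trans ?_ hfin
  have hI : ∀ J : ℂ, ‖J‖ = ‖J * Complex.I‖ := fun J => by
    rw [norm_mul, Complex.norm_I, mul_one]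
  rw [hI]
  refine (norm_le_norm_sub_add _ _).trans (add_le_add hb ((norm_sub_le _ _).trans
    (add_le_add r1 r2)))

/-- The integral over the rays depends continuously on `x`. -/
lemma continuousOn_loopIntegral (h1 : Real.pi / 2 < φ) (h2 : φ < Real.pi)
    (hf : Differentiable ℂ f)
    (hone : ∀ θ s, |θ| = φ → 0 < s → ‖f (rayPoint a θ s)‖ ≤ 1) (ha : 0 < a) :
    ContinuousOn (fun x : ℝ => loopIntegral (fun z => f z * Complex.exp (z * x)) a φ)
      (Set.Ioi 0) := by
  have hcos := cos_neg_of_angle h1 h2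
  have hφ0 : 0 < φ := by linarith [Real.pi_pos]
  have hfc := hf.continuous
  have hray : ∀ θ, |θ| = φ → ∀ x₀ : ℝ, 0 < x₀ →
      ContinuousAt (fun x : ℝ => rayIntegral (fun z => f z * Complex.exp (z * x)) a θ) x₀ := by
    intro θ hθ x₀ hx₀
    have hrc := continuous_rayPoint (a := a) (θ := θ)
    refine continuousAt_of_dominated (bound := fun s =>
      Real.exp (a * (2 * x₀)) * Real.exp (-(-Real.cos φ * (x₀ / 2) * s)))
      (Eventually.of_forall fun x => (Continuous.aestronglyMeasurable (by fun_prop))) ?_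
      ((integrableOn_exp_neg_mul (mul_pos (neg_pos.2 hcos) (by positivity))).const_mul _)
      (ae_of_all _ fun s => by fun_prop)
    filter_upwards [Ioo_mem_nhds (show x₀ / 2 < x₀ by linarith) (show x₀ < 2 * x₀ by linarith)]
      with x hx
    refine (ae_restrict_iff' measurableSet_Ioi).2 (ae_of_all _ fun s hs => ?_)
    rw [norm_mul, norm_exp_mul_I, mul_one]
    refine (norm_mul_exp_le (x := x) hθ (hone θ s hθ hs)).trans ?_
    rw [one_mul]
    have hs0 : 0 < s := hs
    have := neg_pos.2 hcos
    gcongr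
    · exact hx.2.le
    · exact hx.1.le
  intro x hx
  exact (((hray φ (abs_of_pos hφ0) x hx).sub
    (hray (-φ) (by rw [abs_neg, abs_of_pos hφ0]) x hx)).div_const _).continuousWithinAt

end Inversion

/-! ### The expansion over the rays -/

section Expansion

variable {R Ω : Type*} [Fintype R] [MeasurableSpace R] [MeasurableSingletonClass R]
  [MeasurableSpace Ω] {μ : Measure R} [IsProbabilityMeasure μ] {P : R → Polynomial ℝ} {E : ℝ}
  {ℙ : Measure Ω} [IsProbabilityMeasure ℙ] {env : ℕ → Ω → R} {ξ : ℕ → ℕ → Ω → ℕ}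

lemma LCoeff_eq_stripCoeff (hE : 1 < E) {j : ℕ} (hq : 0 < q μ P j) (n : ℤ) :
    LCoeff μ P E ℙ ξ n j = stripCoeff (addForm (K μ P E ℙ ξ j) E (q μ P j)) n := by
  refine intervalIntegral.integral_congr fun x _ => ?_
  simp only [L, addForm]
  rw [Real.rpow_def_of_pos hq, Real.rpow_def_of_pos (by linarith : 0 < E)]
  push_cast
  rw [mul_neg, mul_comm (Real.log (q μ P j) : ℂ), mul_comm (Real.log E : ℂ)]

lemma ofReal_cpow_expo (hE : 1 < E) (j : ℕ) (n : ℤ) {x : ℝ} (hx : 0 < x) :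
    (x : ℂ) ^ (-1 - expo μ P E j n) =
      ((x ^ (-1 - Real.logb E (q μ P j)) : ℝ) : ℂ) *
        Complex.exp (2 * Real.pi * Complex.I * n * (-Real.logb E x : ℝ)) := by
  have hl : (Real.log E : ℂ) ≠ 0 := by exact_mod_cast (Real.log_pos hE).ne'
  have hx0 : (x : ℂ) ≠ 0 := by exact_mod_cast hx.ne'
  rw [Complex.cpow_def_of_ne_zero hx0, Real.rpow_def_of_pos hx, Complex.ofReal_exp,
    ← Complex.exp_add, expo, Real.logb, Real.logb, ← Complex.ofReal_log hx.le]
  congr 1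
  push_cast
  field_simp
  ring

/-- Hankel's formula turns the terms of the expansion of `K_j` into those of `A_j`. -/
lemma loopIntegral_term (hE : 1 < E) (j : ℕ) (n : ℤ) {φ a x : ℝ} (h1 : Real.pi / 2 < φ)
    (h2 : φ < Real.pi) (ha : 0 < a) (hx : 0 < x) :
    loopIntegral (fun z => LCoeff μ P E ℙ ξ n j * z ^ expo μ P E j n * Complex.exp (z * x)) a φ =
      ((x ^ (-1 - Real.logb E (q μ P j)) : ℝ) : ℂ) *
        ATerm μ P E ℙ ξ j (-Real.logb E x) n := by
  simp_rw [mul_assoc (LCoeff μ P E ℙ ξ n j)]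
  rw [loopIntegral_const_mul, loopIntegral_cpow_mul _ h1 h2 ha hx, ofReal_cpow_expo hE j n hx,
    ATerm]
  ring

lemma mul_pow_mem_sector (hE : 1 < E) {φ M : ℝ} {z : ℂ} (hz : z ≠ 0) (harg : |z.arg| < φ) :
    ∃ m : ℕ, (E : ℂ) ^ m * z ∈ sector φ M := by
  have hE0 : 0 < E := by linarith
  obtain ⟨m, hm⟩ := pow_unbounded_of_one_lt (M / ‖z‖) hE
  refine ⟨m, ?_, ?_⟩
  · rw [norm_mul, norm_pow, Complex.norm_real, Real.norm_of_nonneg hE0.le,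
      ← div_lt_iff₀ (norm_pos_iff.2 hz)]
    exact hm
  · rwa [← Complex.ofReal_pow, Complex.arg_real_mul _ (pow_pos hE0 m)]

/-- The expansion of `K_j` extends from the sector to the right half-plane. -/
lemma hasSum_K_of_sector (hE : 1 < E) {φ M : ℝ} (hφ : Real.pi / 2 < φ) {j : ℕ}
    (hq : 0 < q μ P j)
    (hmul : ∀ z : ℂ, 0 < z.re → K μ P E ℙ ξ j (E * z) = q μ P j * K μ P E ℙ ξ j z)
    (hsec : ∀ z ∈ sector φ M, HasSum (fun n : ℤ => LCoeff μ P E ℙ ξ n j * z ^ expo μ P E j n)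
      (K μ P E ℙ ξ j z)) {z : ℂ} (hz : 0 < z.re) :
    HasSum (fun n : ℤ => LCoeff μ P E ℙ ξ n j * z ^ expo μ P E j n) (K μ P E ℙ ξ j z) := by
  have hE0 : 0 < E := by linarith
  have hz0 : z ≠ 0 := fun h => by simp [h] at hz
  obtain ⟨m, hm⟩ := mul_pow_mem_sector (M := M) hE hz0
    ((Complex.abs_arg_lt_pi_div_two_iff.2 (Or.inl hz)).trans hφ)
  have hpow : ∀ m : ℕ, K μ P E ℙ ξ j ((E : ℂ) ^ m * z) =
      (q μ P j : ℂ) ^ m * K μ P E ℙ ξ j z := by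
    intro m
    induction m with
    | zero => simp
    | succ m ih =>
      rw [pow_succ', mul_assoc, hmul _ ?_, ih, pow_succ', mul_assoc]
      rw [← Complex.ofReal_pow, Complex.re_ofReal_mul]
      positivity
  have hqm : (q μ P j : ℂ) ^ m ≠ 0 := pow_ne_zero _ (by exact_mod_cast hq.ne')
  have hEm : 0 < E ^ m := pow_pos hE0 m
  have hl : (Real.log E : ℂ) ≠ 0 := by exact_mod_cast (Real.log_pos hE).ne'
  have hpowexp : ∀ n : ℤ, ((E : ℂ) ^ m) ^ expo μ P E j n = (q μ P j : ℂ) ^ m := by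
    intro n
    rw [Complex.cpow_def_of_ne_zero (by exact_mod_cast hEm.ne'), ← Complex.ofReal_pow,
      ← Complex.ofReal_log hEm.le, Real.log_pow, expo]
    have e : ((m * Real.log E : ℝ) : ℂ) *
        ((2 * Real.pi * Complex.I * n + Real.log (q μ P j)) / Real.log E) =
        m * Real.log (q μ P j) + ((m * n : ℤ) : ℂ) * (2 * Real.pi * Complex.I) := by
      push_cast
      field_simp
      ring
    rw [e, Complex.exp_add, Complex.exp_int_mul_two_pi_mul_I, mul_one, Complex.exp_nat_mul,
      ← Complex.ofReal_exp, Real.exp_log hq]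
  have hs := (hsec _ hm).mul_left ((q μ P j : ℂ) ^ m)⁻¹
  rw [hpow, inv_mul_cancel_left₀ hqm] at hs
  refine hs.congr_fun fun n => ?_
  have := ofReal_mul_cpow hEm z (expo μ P E j n)
  rw [Complex.ofReal_pow, hpowexp] at this
  rw [this]
  field_simp

/-- The contour: `φ'` is the opening of a sector in which `Π` vanishes at infinity, the direction
`φ` of the rays lies strictly between `π / 2` and `φ'`, and the vertex `a` is so far to the right
that the rays stay outside the disk of radius `M`, where the expansions over `j` and over `n`
hold with summable majorants; they are integrated term by term. -/
lemma IsOffspringFamily.exists_loop_expansion (hξ : IsOffspringFamily μ P ℙ env ξ)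
    (h : OffspringLaws μ P E) (hangle : Real.pi < criticalAngle P)
    (hinv : ∃ ρ > 0, ∀ z : ℂ, ‖z‖ < ρ →
      Tendsto (fun J : ℕ => ∑ j ∈ Finset.Icc 1 J, (bCoeff ℙ ξ j : ℂ) * Phi ℙ ξ j z)
        atTop (𝓝 z)) :
    ∃ φ φ' a : ℝ, Real.pi / 2 < φ ∧ φ < Real.pi ∧ φ < φ' ∧ 0 < a ∧
      VanishesInSector (PiFun μ P E) φ' ∧
      (∀ θ s, |θ| = φ → 0 < s → ‖PiFun μ P E (rayPoint a θ s)‖ ≤ 1) ∧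
      (∀ j, 1 ≤ j → (∀ z : ℂ, 0 < z.re →
        Tendsto (KApprox μ P E ℙ ξ j z) atTop (𝓝 (K μ P E ℙ ξ j z)) ∧
        K μ P E ℙ ξ j (E * z) = q μ P j * K μ P E ℙ ξ j z ∧
        HasSum (fun n : ℤ => LCoeff μ P E ℙ ξ n j * z ^ expo μ P E j n) (K μ P E ℙ ξ j z)) ∧
        ∀ x : ℝ, Summable (ATerm μ P E ℙ ξ j x)) ∧
      ∀ x : ℝ, 0 < x →
        HasSum (fun j : ℕ => (bCoeff ℙ ξ (j + 1) : ℂ) *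
          ((x ^ (-1 - Real.logb E (q μ P (j + 1))) : ℝ) : ℂ) *
          A μ P E ℙ ξ (j + 1) (-Real.logb E x))
        (loopIntegral (fun z => PiFun μ P E z * Complex.exp (z * x)) a φ) := by
  have hE := h.one_lt
  have hE0 : 0 < E := by linarith
  obtain ⟨ψ, hψ1, hψ2, hP⟩ := exists_attractsSector hangle
  obtain ⟨φ, hφ1, hφψ⟩ := exists_between hψ1
  obtain ⟨φ', hφφ', hφ'⟩ := exists_between hφψ
  have hφπ : φ < Real.pi := by linarith
  have hφ0 : 0 ≤ φ := by linarith [Real.pi_pos]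
  have hcos := cos_neg_of_angle hφ1 hφπ
  have hsin := sin_pos_of_angle hφ1 hφπ
  obtain ⟨M₁, hM₁, hKs, u, hu, hsum⟩ := hξ.exists_sector_expansion h hψ2 hP hφ' hinv
  have hdec : VanishesInSector (PiFun μ P E) φ' := fun ρ hρ => h.exists_norm_PiFun_le hψ2 hP hφ' hρ
  obtain ⟨M₂, hM₂, hone⟩ := hdec 1 one_pos
  set M := max M₁ M₂
  set a := (M + 1) / Real.sin φ with hadef
  have hM0 : 0 < M := hM₁.trans_le (le_max_left _ _)
  have ha : 0 < a := by positivity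
  have hasin : M < a * Real.sin φ := by rw [hadef, div_mul_cancel₀ _ hsin.ne']; linarith
  have hnorm : ∀ θ s, |θ| = φ → a * Real.sin φ ≤ ‖rayPoint a θ s‖ := fun θ s hθ => by
    have := mul_sin_le_norm_rayPoint (θ := θ) (s := s) ha.le
    rwa [abs_sin_of_abs_eq hθ, abs_of_pos hsin] at this
  have hmem : ∀ θ s, |θ| = φ → 0 < s → rayPoint a θ s ∈ sector φ' M := fun θ s hθ hs =>
    rayPoint_mem_sector hφφ' ha hs.le hθ hsin.ne' (hasin.trans_le (hnorm θ s hθ))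
  have hmem₁ : ∀ θ s, |θ| = φ → 0 < s → rayPoint a θ s ∈ sector φ' M₁ := fun θ s hθ hs =>
    ⟨(le_max_left _ _).trans_lt (hmem θ s hθ hs).1, (hmem θ s hθ hs).2⟩
  have hmem₂ : ∀ θ s, |θ| = φ → 0 < s → rayPoint a θ s ∈ sector φ' M₂ := fun θ s hθ hs =>
    ⟨(le_max_right _ _).trans_lt (hmem θ s hθ hs).1, (hmem θ s hθ hs).2⟩
  have hKlim : ∀ j, 1 ≤ j → ∀ z : ℂ, 0 < z.re →
      Tendsto (KApprox μ P E ℙ ξ j z) atTop (𝓝 (K μ P E ℙ ξ j z)) := fun j hj z hz =>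
    hξ.tendsto_KApprox h (hφ1.trans hφφ') (hKs j hj).1 hz
  have hKmul : ∀ j, 1 ≤ j → ∀ z : ℂ, 0 < z.re →
      K μ P E ℙ ξ j (E * z) = q μ P j * K μ P E ℙ ξ j z := fun j hj z hz =>
    hξ.K_mul h hz (hKlim j hj z hz)
  have hexp : ∀ j, 1 ≤ j → _ := fun j hj => exists_multiplicative_expansion (κ := K μ P E ℙ ξ j)
    hE (h.q_pos' j) (hφ'.le.trans hψ2) hM₁ (hKs j hj).2.2 (hKs j hj).2.1
    (fun x hx => hKmul j hj x (by simpa using hx))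
  have hKsec : ∀ j, 1 ≤ j → ∀ z ∈ sector φ' M₁,
      HasSum (fun n : ℤ => LCoeff μ P E ℙ ξ n j * z ^ expo μ P E j n) (K μ P E ℙ ξ j z) :=
    fun j hj z hz => ((hexp j hj).1 z hz).congr_fun fun n => by
      rw [LCoeff_eq_stripCoeff hE (h.q_pos' j), expo]
  -- The expansion of `K_j` may be integrated term by term over the rays.
  have hloopK : ∀ j, 1 ≤ j → ∀ x : ℝ, 0 < x →
      HasSum (fun n => ((x ^ (-1 - Real.logb E (q μ P j)) : ℝ) : ℂ) *
        ATerm μ P E ℙ ξ j (-Real.logb E x) n)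
      (loopIntegral (fun z => K μ P E ℙ ξ j z * Complex.exp (z * x)) a φ) := by
    intro j hj x hx
    obtain ⟨v, hv, hvb⟩ := (hexp j hj).2 φ hφ0 hφφ'
    set σ := Real.log (q μ P j) / Real.log E with hσ
    have hσ0 : σ ≤ 0 := div_nonpos_of_nonpos_of_nonneg
      (Real.log_nonpos (h.q_pos' j).le (h.q_lt_one hj).le) (Real.log_pos hE).le
    have hv0 : ∀ n, 0 ≤ v n := fun n => by
      have := (norm_nonneg _).trans (hvb 1 one_ne_zero (by simpa using hφ0) n)
      simpa using this
    have hb : ∀ (n : ℤ) θ s, |θ| = φ → 0 < s →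
        ‖LCoeff μ P E ℙ ξ n j * rayPoint a θ s ^ expo μ P E j n‖ ≤
          v n * (a * Real.sin φ) ^ σ := by
      intro n θ s hθ hs
      have hz := hnorm θ s hθ
      have hz0 : 0 < ‖rayPoint a θ s‖ := (by positivity : 0 < a * Real.sin φ).trans_le hz
      rw [LCoeff_eq_stripCoeff hE (h.q_pos' j), expo]
      refine (hvb _ (norm_pos_iff.1 hz0) ?_ n).trans (mul_le_mul_of_nonneg_left ?_ (hv0 n))
      · rw [← hθ]
        refine abs_arg_rayPoint_le ha hs.le ?_
        rw [← abs_pos, abs_sin_of_abs_eq hθ]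
        exact abs_pos.2 hsin.ne'
      · exact Real.rpow_le_rpow_of_nonpos (by positivity) hz hσ0
    have := hasSum_loopIntegral (φ := φ) (a := a)
      (f := fun n z => LCoeff μ P E ℙ ξ n j * z ^ expo μ P E j n * Complex.exp (z * x))
      (F := fun z => K μ P E ℙ ξ j z * Complex.exp (z * x))
      (mul_pos (neg_pos.2 hcos) hx)
      ((hv.mul_right ((a * Real.sin φ) ^ σ)).mul_right (Real.exp (a * x)))
      (fun n θ hθ => ?_) (fun n θ s hθ hs => norm_mul_exp_le
        (f := fun z => LCoeff μ P E ℙ ξ n j * z ^ expo μ P E j n) hθ (hb n θ s hθ hs))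
      (fun θ s hθ hs => (hKsec j hj _ (hmem₁ θ s hθ hs)).mul_right _) hφ0
    · exact this.congr_fun fun n => (loopIntegral_term hE j n hφ1 hφπ ha hx).symm
    · refine Continuous.continuousOn (continuous_iff_continuousAt.2 fun s => ?_)
      have hc : ContinuousAt (rayPoint a θ) s := continuous_rayPoint.continuousAt
      exact (continuousAt_const.mul (hc.cpow continuousAt_const
        (rayPoint_mem_slitPlane hφ1 hφπ hθ ha))).mul (hc.mul continuousAt_const).cexp
  have hA : ∀ j, 1 ≤ j → ∀ x : ℝ, Summable (ATerm μ P E ℙ ξ j x) := by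
    intro j hj y
    have hx : 0 < E ^ (-y) := Real.rpow_pos_of_pos hE0 _
    have hy : -Real.logb E (E ^ (-y)) = y := by
      rw [Real.logb_rpow hE0 hE.ne', neg_neg]
    have hs := (hloopK j hj _ hx).summable
    rw [hy] at hs
    refine (summable_mul_left_iff ?_).1 hs
    exact_mod_cast (Real.rpow_pos_of_pos hx _).ne'
  have hloopA : ∀ j, 1 ≤ j → ∀ x : ℝ, 0 < x →
      loopIntegral (fun z => K μ P E ℙ ξ j z * Complex.exp (z * x)) a φ =
      ((x ^ (-1 - Real.logb E (q μ P j)) : ℝ) : ℂ) * A μ P E ℙ ξ j (-Real.logb E x) :=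
    fun j hj x hx => (hloopK j hj x hx).unique ((hA j hj _).hasSum.mul_left _)
  refine ⟨φ, φ', a, hφ1, hφπ, hφφ', ha, hdec, fun θ s hθ hs => hone _ (hmem₂ θ s hθ hs),
    fun j hj => ⟨fun z hz => ⟨hKlim j hj z hz, hKmul j hj z hz, ?_⟩, hA j hj⟩, fun x hx => ?_⟩
  · exact hasSum_K_of_sector hE (hφ1.trans hφφ') (h.q_pos' j) (hKmul j hj) (hKsec j hj) hz
  · have := hasSum_loopIntegral (φ := φ) (a := a)
      (f := fun j z => (bCoeff ℙ ξ (j + 1) : ℂ) * K μ P E ℙ ξ (j + 1) z * Complex.exp (z * x))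
      (F := fun z => PiFun μ P E z * Complex.exp (z * x))
      (mul_pos (neg_pos.2 hcos) hx) (hu.mul_right (Real.exp (a * x)))
      (fun j θ hθ => ?_) (fun j θ s hθ hs => norm_mul_exp_le
        (f := fun z => (bCoeff ℙ ξ (j + 1) : ℂ) * K μ P E ℙ ξ (j + 1) z) hθ
        ((hsum _ (hmem₁ θ s hθ hs)).1 j))
      (fun θ s hθ hs => (hsum _ (hmem₁ θ s hθ hs)).2.mul_right _) hφ0
    · refine this.congr_fun fun j => ?_
      simp_rw [mul_assoc (bCoeff ℙ ξ (j + 1) : ℂ)]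
      rw [loopIntegral_const_mul, hloopA (j + 1) (by omega) x hx]
    · have hrc := continuous_rayPoint (a := a) (θ := θ)
      have hKc : ContinuousOn (fun s => K μ P E ℙ ξ (j + 1) (rayPoint a θ s)) (Set.Ioi 0) :=
        (hKs (j + 1) (by omega)).2.2.continuousOn.comp hrc.continuousOn
          fun s hs => hmem₁ θ s hθ hs
      exact (continuousOn_const.mul hKc).mul (by fun_prop)

end Expansion

/-! ### Fourier inversion for measures -/

section FourierInversion

open scoped FourierTransform ContDiff

/-- The truncated inversion integral `(1 / 2π) ∫_{-T}^{T} f(iy) e^{iyx} dy`. -/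
noncomputable def truncInv (f : ℂ → ℂ) (x T : ℝ) : ℂ :=
  (1 / (2 * (Real.pi : ℂ))) *
    ∫ y in (-T)..T, f (y * Complex.I) * Complex.exp (y * Complex.I * x)

variable {ν : Measure ℝ} [IsProbabilityMeasure ν] {f : ℂ → ℂ} {g : ℝ → ℂ}

lemma fourierInv_apply (hg : ContDiff ℝ ∞ g) (hgc : HasCompactSupport g) :
    Continuous (𝓕 g) ∧ Integrable (𝓕 g) ∧
      ∀ v, g v = ∫ w : ℝ, Complex.exp ((2 * Real.pi * w * v : ℝ) * Complex.I) * 𝓕 g w := by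
  have hc : Continuous (𝓕 g) := (𝓕 (hgc.toSchwartzMap hg)).continuous
  have hi : Integrable (𝓕 g) := (𝓕 (hgc.toSchwartzMap hg)).integrable
  have hgi : Integrable g := (hgc.toSchwartzMap hg).integrable
  refine ⟨hc, hi, fun v => ?_⟩
  have := congrFun (hg.continuous.fourierInv_fourier_eq hgi hi) v
  rw [Real.fourierInv_eq'] at this
  rw [← this]
  refine integral_congr_ae (ae_of_all _ fun w => ?_)
  simp only [smul_eq_mul, RCLike.inner_apply, conj_trivial]
  rw [mul_comm v w, ← mul_assoc]

/-- Parseval's identity for a test function and a probability measure. -/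
lemma integral_eq_integral_fourier
    (hν : ∀ y : ℝ, f (y * Complex.I) = ∫ v : ℝ, Complex.exp (-(y * Complex.I * v)) ∂ν)
    (hg : ContDiff ℝ ∞ g) (hgc : HasCompactSupport g) :
    ∫ v, g v ∂ν = ∫ w : ℝ, 𝓕 g w * f ((-(2 * Real.pi * w) : ℝ) * Complex.I) := by
  obtain ⟨hc, hi, hinv⟩ := fourierInv_apply hg hgc
  simp_rw [hinv]
  rw [integral_integral_swap]
  · refine integral_congr_ae (ae_of_all _ fun w => ?_)
    simp only
    rw [integral_mul_const, mul_comm, hν]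
    congr 1
    refine integral_congr_ae (ae_of_all _ fun v => ?_)
    simp only
    congr 1
    push_cast
    ring
  · refine (hi.comp_snd ν).bdd_mul (c := 1) (Continuous.aestronglyMeasurable (by fun_prop))
      (ae_of_all _ fun z => ?_)
    rw [Complex.norm_exp_ofReal_mul_I]

lemma integral_fourier_trunc (hf : Continuous f) (hg : ContDiff ℝ ∞ g)
    (hgc : HasCompactSupport g) {T : ℝ} (hT : 0 ≤ T) :
    ∫ w in (-T)..T, 𝓕 g w * f ((-(2 * Real.pi * w) : ℝ) * Complex.I) =
      ∫ v, g v * truncInv f v (2 * Real.pi * T) := by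
  have hgi : Integrable g := hg.continuous.integrable_of_hasCompactSupport hgc
  have hsub : ∀ v : ℝ, truncInv f v (2 * Real.pi * T) = ∫ w in (-T)..T,
      f ((-(2 * Real.pi * w) : ℝ) * Complex.I) *
        Complex.exp ((-(2 * Real.pi * w) : ℝ) * Complex.I * v) := by
    intro v
    have h := intervalIntegral.smul_integral_comp_mul_left (a := -T) (b := T)
      (fun y : ℝ => f (y * Complex.I) * Complex.exp (y * Complex.I * v)) (-(2 * Real.pi))
    have e1 : -(2 * Real.pi) * -T = 2 * Real.pi * T := by ring
    have e2 : -(2 * Real.pi) * T = -(2 * Real.pi * T) := by ring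
    rw [e1, e2, intervalIntegral.integral_symm (-(2 * Real.pi * T)), Complex.real_smul, eq_comm,
      neg_eq_iff_eq_neg] at h
    rw [truncInv, h]
    have hpi : (Real.pi : ℂ) ≠ 0 := by exact_mod_cast Real.pi_ne_zero
    have hc : ∀ J : ℂ, 1 / (2 * (Real.pi : ℂ)) * -(((-(2 * Real.pi) : ℝ) : ℂ) * J) = J := by
      intro J
      push_cast
      field_simp
    rw [hc]
    simp only [neg_mul]
  simp_rw [hsub, ← intervalIntegral.integral_const_mul]
  simp_rw [intervalIntegral.integral_of_le (neg_le_self hT)]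
  rw [integral_integral_swap]
  · refine integral_congr_ae (ae_of_all _ fun w => ?_)
    simp only
    rw [Real.fourier_real_eq_integral_exp_smul, ← integral_mul_const]
    refine integral_congr_ae (ae_of_all _ fun v => ?_)
    simp only [smul_eq_mul]
    have : ((-2 * Real.pi * v * w : ℝ) : ℂ) * Complex.I =
      ((-(2 * Real.pi * w) : ℝ) : ℂ) * Complex.I * v := by push_cast; ring
    rw [this]
    ring
  · have hcont : Continuous fun w : ℝ => f ((-(2 * Real.pi * w) : ℝ) * Complex.I) := by fun_prop
    have hfi : Integrable (fun w : ℝ => f ((-(2 * Real.pi * w) : ℝ) * Complex.I))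
        (volume.restrict (Set.Ioc (-T) T)) :=
      (hcont.integrableOn_Icc).mono_set Set.Ioc_subset_Icc_self
    have hprod := hgi.mul_prod hfi
    have : Integrable (fun z : ℝ × ℝ => Complex.exp ((-(2 * Real.pi * z.2) : ℝ) * Complex.I * z.1) *
        (g z.1 * f ((-(2 * Real.pi * z.2) : ℝ) * Complex.I)))
        (volume.prod (volume.restrict (Set.Ioc (-T) T))) := by
      refine hprod.bdd_mul (c := 1) (Continuous.aestronglyMeasurable (by fun_prop))
        (ae_of_all _ fun z => ?_)
      have : ((-(2 * Real.pi * z.2) : ℝ) : ℂ) * Complex.I * z.1 =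
        ((-(2 * Real.pi * z.2) * z.1 : ℝ) : ℂ) * Complex.I := by push_cast; ring
      rw [this, Complex.norm_exp_ofReal_mul_I]
    refine this.congr (ae_of_all _ fun z => ?_)
    simp only [Function.uncurry]
    ring

/-- If the truncated inversion integrals converge boundedly, the limit is the density of the
measure against test functions. -/
lemma integral_eq_integral_mul_of_tendsto_truncInv (hf : Continuous f)
    (hν : ∀ y : ℝ, f (y * Complex.I) = ∫ v : ℝ, Complex.exp (-(y * Complex.I * v)) ∂ν)
    (hg : ContDiff ℝ ∞ g) (hgc : HasCompactSupport g) {s : Set ℝ} (hs : ∀ x ∉ s, g x = 0)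
    {p : ℝ → ℂ} (hlim : ∀ x ∈ s, Tendsto (truncInv f x) atTop (𝓝 (p x)))
    {B T₀ : ℝ} (hbd : ∀ x ∈ s, ∀ T, T₀ ≤ T → ‖truncInv f x T‖ ≤ B) :
    ∫ v, g v ∂ν = ∫ v, g v * p v := by
  obtain ⟨hc, hi, -⟩ := fourierInv_apply hg hgc
  have hgi : Integrable g := hg.continuous.integrable_of_hasCompactSupport hgc
  have hf1 : ∀ y : ℝ, ‖f (y * Complex.I)‖ ≤ 1 := fun y => by
    rw [hν]
    refine (norm_integral_le_of_norm_le_const (C := 1) (ae_of_all _ fun v => ?_)).trans (by simp)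
    have : -((y : ℂ) * Complex.I * v) = ((-(y * v) : ℝ) : ℂ) * Complex.I := by push_cast; ring
    rw [this, Complex.norm_exp_ofReal_mul_I]
  have hmul : Integrable fun w : ℝ => 𝓕 g w * f ((-(2 * Real.pi * w) : ℝ) * Complex.I) :=
    hi.mul_bdd (c := 1) (Continuous.aestronglyMeasurable (by fun_prop))
      (ae_of_all _ fun w => hf1 _)
  have hL := intervalIntegral_tendsto_integral hmul tendsto_neg_atTop_atBot tendsto_id
  rw [← integral_eq_integral_fourier hν hg hgc] at hL
  have htop : Tendsto (fun T : ℝ => 2 * Real.pi * T) atTop atTop :=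
    tendsto_id.const_mul_atTop Real.two_pi_pos
  have hmeas : ∀ T, AEStronglyMeasurable (fun v => g v * truncInv f v T) := fun T => by
    have : Continuous fun v => truncInv f v T := by
      refine continuous_const.mul ?_
      refine intervalIntegral.continuous_parametric_intervalIntegral_of_continuous' ?_ _ _
      simp only [Function.uncurry_def]
      fun_prop
    exact (hg.continuous.mul this).aestronglyMeasurable
  have hR : Tendsto (fun T : ℝ => ∫ v, g v * truncInv f v (2 * Real.pi * T)) atTop
      (𝓝 (∫ v, g v * p v)) := by
    refine tendsto_integral_filter_of_dominated_convergence (fun v => ‖g v‖ * B)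
      (Eventually.of_forall fun T => hmeas _) ?_ (hgi.norm.mul_const B)
      (ae_of_all _ fun v => ?_)
    · filter_upwards [htop.eventually_ge_atTop T₀] with T hT
      refine ae_of_all _ fun v => ?_
      by_cases hv : v ∈ s
      · rw [norm_mul]
        exact mul_le_mul_of_nonneg_left (hbd v hv _ hT) (norm_nonneg _)
      · simp [hs v hv]
    · by_cases hv : v ∈ s
      · exact ((hlim v hv).comp htop).const_mul _
      · simp [hs v hv]
  refine tendsto_nhds_unique hL (hR.congr' ?_)
  filter_upwards [eventually_ge_atTop 0] with T hT
  exact (integral_fourier_trunc hf hg hgc hT).symm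

end FourierInversion

/-! ### Measures on the positive half-line given by their integrals of bump functions -/

section Bump

variable {ν : Measure ℝ} {p : ℝ → ℝ}

/-- Measures without mass on `(-∞, 0]` are determined by the intervals with positive left
end. -/
lemma measure_eq_of_Ioo_of_pos {m m' : Measure ℝ} [IsFiniteMeasure m] (h0 : m (Set.Iic 0) = 0)
    (h0' : m' (Set.Iic 0) = 0)
    (h : ∀ a b : ℝ, 0 < a → a < b → m (Set.Ioo a b) = m' (Set.Ioo a b)) : m = m' := by
  have hred : ∀ (κ : Measure ℝ), κ (Set.Iic 0) = 0 → ∀ a b : ℝ,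
      κ (Set.Ioo a b) = ⨆ n : ℕ, κ (Set.Ioo (max a 0 + 1 / ((n : ℝ) + 1)) b) := by
    intro κ hκ a b
    have hsub : Set.Ioo a b =ᵐ[κ] Set.Ioo (max a 0) b := by
      have hae : ∀ᵐ x ∂κ, x ∉ Set.Iic (0 : ℝ) := measure_eq_zero_iff_ae_notMem.1 hκ
      filter_upwards [hae] with x hx
      exact propext ⟨fun hx' => ⟨max_lt hx'.1 (not_le.1 hx), hx'.2⟩,
        fun hx' => ⟨(le_max_left _ _).trans_lt hx'.1, hx'.2⟩⟩
    have hun : Set.Ioo (max a 0) b = ⋃ n : ℕ, Set.Ioo (max a 0 + 1 / ((n : ℝ) + 1)) b := by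
      ext x
      simp only [Set.mem_Ioo, Set.mem_iUnion]
      constructor
      · rintro ⟨h1, h2⟩
        obtain ⟨n, hn⟩ := exists_nat_one_div_lt (sub_pos.2 h1)
        exact ⟨n, by linarith, h2⟩
      · rintro ⟨n, h1, h2⟩
        have : 0 < 1 / ((n : ℝ) + 1) := by positivity
        exact ⟨by linarith, h2⟩
    rw [measure_congr hsub, hun, Monotone.measure_iUnion]
    intro n k hnk
    refine Set.Ioo_subset_Ioo_left ?_
    have : 1 / ((k : ℝ) + 1) ≤ 1 / ((n : ℝ) + 1) := by gcongr
    linarith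
  refine Real.measure_ext_Ioo_rat fun a b => ?_
  rw [hred m h0, hred m' h0']
  refine iSup_congr fun n => ?_
  have hpos : 0 < max (a : ℝ) 0 + 1 / ((n : ℝ) + 1) :=
    add_pos_of_nonneg_of_pos (le_max_right _ _) (by positivity)
  by_cases hlt : max (a : ℝ) 0 + 1 / ((n : ℝ) + 1) < b
  · exact h _ _ hpos hlt
  · rw [Set.Ioo_eq_empty hlt, measure_empty, measure_empty]

lemma nonneg_of_integral_bump (hp : ContinuousOn p (Set.Ioi 0))
    (hb : ∀ (c : ℝ) (g : ContDiffBump c), g.rOut < c → ∫ v, g v ∂ν = ∫ v, g v * p v)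
    {c : ℝ} (hc : 0 < c) : 0 ≤ p c := by
  by_contra hneg
  rw [not_le] at hneg
  have hnear : ∀ᶠ v in 𝓝 c, p v < p c / 2 :=
    ((hp.continuousAt (Ioi_mem_nhds hc)).eventually_lt_const (by linarith))
  obtain ⟨δ, hδ, hball⟩ := Metric.eventually_nhds_iff_ball.1 hnear
  set r := min δ c / 2
  have hr : 0 < r := by positivity
  have hrδ : r < δ := (half_lt_self (lt_min hδ hc)).trans_le (min_le_left _ _)
  have hrc : r < c := (half_lt_self (lt_min hδ hc)).trans_le (min_le_right _ _)
  set g : ContDiffBump c := ⟨r / 2, r, by positivity, by linarith⟩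
  have h1 := hb c g hrc
  have h2 : 0 ≤ ∫ v, g v ∂ν := integral_nonneg fun v => g.nonneg
  have h3 : ∫ v, g v * (-p v) ≥ ∫ v, g v * (-(p c / 2)) := by
    refine integral_mono_of_nonneg (ae_of_all _ fun v => ?_) ?_ (ae_of_all _ fun v => ?_)
    · exact mul_nonneg g.nonneg (by linarith)
    · have hcont : Continuous fun v => g v * (-p v) := by
        refine continuous_iff_continuousAt.2 fun v => ?_
        by_cases hv : 0 < v
        · exact g.continuous.continuousAt.mul (hp.continuousAt (Ioi_mem_nhds hv)).neg
        · have hev : (fun v => g v * (-p v)) =ᶠ[𝓝 v] fun _ => 0 := by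
            have : v < c - r := by linarith
            filter_upwards [Iio_mem_nhds this] with y hy
            rw [g.zero_of_le_dist, zero_mul]
            have hy' : y < c - r := hy
            rw [Real.dist_eq, abs_sub_comm, abs_of_pos (by linarith)]
            exact (show r ≤ c - y by linarith)
          exact hev.continuousAt
      exact hcont.integrable_of_hasCompactSupport g.hasCompactSupport.mul_right
    · by_cases hv : v ∈ Metric.ball c r
      · exact mul_le_mul_of_nonneg_left
          (by linarith [hball v (Metric.ball_subset_ball hrδ.le hv)]) g.nonneg
      · have : g v = 0 := g.zero_of_le_dist (by simpa using hv)
        simp [this]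
  have h4 : 0 < ∫ v, g v * (-(p c / 2)) := by
    rw [integral_mul_const]
    exact mul_pos g.integral_pos (by linarith)
  simp only [mul_neg, integral_neg] at h3 h4
  linarith

lemma measure_Ioo_of_integral_bump [IsFiniteMeasure ν] (hp : ContinuousOn p (Set.Ioi 0))
    (hb : ∀ (c : ℝ) (g : ContDiffBump c), g.rOut < c → ∫ v, g v ∂ν = ∫ v, g v * p v)
    {a b : ℝ} (ha : 0 < a) (hab : a < b) :
    ν.real (Set.Ioo a b) = ∫ v in Set.Ioo a b, p v := by
  set c := (a + b) / 2
  set r := (b - a) / 2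
  have hr : 0 < r := by simp only [r]; linarith
  have hIoo : Set.Ioo a b = Metric.ball c r := by
    rw [Real.ball_eq_Ioo]; congr 1 <;> simp only [c, r] <;> ring
  have hIcc : Set.Icc a b = Metric.closedBall c r := by
    rw [Real.closedBall_eq_Icc]; congr 1 <;> simp only [c, r] <;> ring
  set g : ℕ → ContDiffBump c := fun n =>
    ⟨r * (1 - 1 / ((n : ℝ) + 2)), r, by
      refine mul_pos hr (sub_pos.2 ?_)
      rw [div_lt_one (by positivity)]
      linarith [(Nat.cast_nonneg n : (0 : ℝ) ≤ n)], by
      refine mul_lt_of_lt_one_right hr (sub_lt_self _ (by positivity))⟩ with hg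
  have hlim : ∀ v, Tendsto (fun n => g n v) atTop (𝓝 ((Set.Ioo a b).indicator 1 v)) := by
    intro v
    by_cases hv : v ∈ Set.Ioo a b
    · rw [Set.indicator_of_mem hv]
      rw [hIoo, Metric.mem_ball] at hv
      have ht : Tendsto (fun n : ℕ => r * (1 - 1 / ((n : ℝ) + 2))) atTop (𝓝 (r * (1 - 0))) := by
        refine (tendsto_const_nhds.sub ?_).const_mul r
        refine tendsto_const_nhds.div_atTop ?_
        exact tendsto_atTop_add_const_right _ _ tendsto_natCast_atTop_atTop
      rw [sub_zero, mul_one] at ht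
      refine tendsto_const_nhds.congr' ?_
      filter_upwards [ht.eventually_const_le hv] with n hn
      exact ((g n).one_of_mem_closedBall hn).symm
    · rw [Set.indicator_of_notMem hv]
      refine tendsto_const_nhds.congr fun n => ((g n).zero_of_le_dist ?_).symm
      rw [hIoo, Metric.mem_ball, not_lt] at hv
      exact hv
  have hL : Tendsto (fun n => ∫ v, g n v ∂ν) atTop (𝓝 (∫ v, (Set.Ioo a b).indicator 1 v ∂ν)) :=
    tendsto_integral_of_dominated_convergence (fun _ => 1)
      (fun n => (g n).continuous.aestronglyMeasurable) (integrable_const 1)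
      (fun n => ae_of_all _ fun v => by
        rw [Real.norm_of_nonneg (g n).nonneg]; exact (g n).le_one)
      (ae_of_all _ hlim)
  rw [integral_indicator_one measurableSet_Ioo] at hL
  have hpc : ContinuousOn p (Set.Icc a b) := hp.mono fun v hv => ha.trans_le hv.1
  have hpi : IntegrableOn p (Set.Icc a b) := hpc.integrableOn_Icc
  have hset : ∀ n, ∫ v, g n v * p v = ∫ v in Set.Icc a b, g n v * p v := fun n => by
    rw [setIntegral_eq_integral_of_forall_compl_eq_zero]
    intro v hv
    rw [(g n).zero_of_le_dist, zero_mul]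
    rw [hIcc, Metric.mem_closedBall, not_le] at hv
    exact hv.le
  have hR : Tendsto (fun n => ∫ v in Set.Icc a b, g n v * p v) atTop
      (𝓝 (∫ v in Set.Icc a b, (Set.Ioo a b).indicator 1 v * p v)) :=
    tendsto_integral_of_dominated_convergence (fun v => ‖p v‖)
      (fun n => ((g n).continuous.aestronglyMeasurable).mul hpi.aestronglyMeasurable) hpi.norm
      (fun n => ae_of_all _ fun v => by
        rw [norm_mul, Real.norm_of_nonneg (g n).nonneg]
        exact mul_le_of_le_one_left (norm_nonneg _) (g n).le_one)
      (ae_of_all _ fun v => (hlim v).mul_const _)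
  have heq : ∫ v in Set.Icc a b, (Set.Ioo a b).indicator 1 v * p v = ∫ v in Set.Ioo a b, p v := by
    have : (fun v => (Set.Ioo a b).indicator 1 v * p v) = (Set.Ioo a b).indicator p := by
      funext v
      by_cases hv : v ∈ Set.Ioo a b <;> simp [hv]
    rw [this, setIntegral_indicator measurableSet_Ioo,
      Set.inter_eq_right.2 Set.Ioo_subset_Icc_self]
  rw [heq] at hR
  refine tendsto_nhds_unique hL (hR.congr fun n => ?_)
  rw [hb c (g n) (by simp only [hg, c, r]; linarith), hset]

/-- A finite measure without mass on `(-∞, 0]` whose integrals of bump functions are given by a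
continuous function has this function as density. -/
lemma eq_withDensity_of_integral_bump [IsFiniteMeasure ν] (h0 : ν (Set.Iic 0) = 0)
    (hp : ContinuousOn p (Set.Ioi 0))
    (hb : ∀ (c : ℝ) (g : ContDiffBump c), g.rOut < c → ∫ v, g v ∂ν = ∫ v, g v * p v) :
    ν = (volume.restrict (Set.Ioi 0)).withDensity fun x => ENNReal.ofReal (p x) := by
  refine measure_eq_of_Ioo_of_pos h0 ?_ fun a b ha hab => ?_
  · rw [withDensity_apply _ measurableSet_Iic, Measure.restrict_restrict measurableSet_Iic,
      Set.Iic_inter_Ioi, Set.Ioc_self, Measure.restrict_empty, lintegral_zero_measure]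
  · have hsub : Set.Ioo a b ⊆ Set.Ioi 0 := fun v hv => ha.trans hv.1
    have hpi : IntegrableOn p (Set.Ioo a b) :=
      ((hp.mono fun v hv => ha.trans_le hv.1 :
        ContinuousOn p (Set.Icc a b)).integrableOn_Icc).mono_set
        Set.Ioo_subset_Icc_self
    rw [withDensity_apply _ measurableSet_Ioo, Measure.restrict_restrict measurableSet_Ioo,
      Set.inter_eq_left.2 hsub, ← ofReal_integral_eq_lintegral_ofReal hpi
        ((ae_restrict_iff' measurableSet_Ioo).2 (ae_of_all _ fun v hv =>
          nonneg_of_integral_bump hp hb (hsub hv))),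
      ← measure_Ioo_of_integral_bump hp hb ha hab, ofReal_measureReal]

end Bump

/-! ### The density of the martingale limit -/

section Density

variable {R Ω : Type*} [Fintype R] [MeasurableSpace R] [MeasurableSingletonClass R]
  [MeasurableSpace Ω] {μ : Measure R} [IsProbabilityMeasure μ] {P : R → Polynomial ℝ} {E : ℝ}
  {ℙ : Measure Ω} [IsProbabilityMeasure ℙ] {env : ℕ → Ω → R} {ξ : ℕ → ℕ → Ω → ℕ}

lemma inversionIntegral_zero (x T : ℝ) :
    inversionIntegral μ P E 0 x T = truncInv (PiFun μ P E) x T := by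
  simp [inversionIntegral, truncInv]

lemma OffspringLaws.PiFun_conj (h : OffspringLaws μ P E) (z : ℂ) :
    PiFun μ P E (starRingEnd ℂ z) = starRingEnd ℂ (PiFun μ P E z) := by
  refine tendsto_nhds_unique (h.tendsto_PiFun _)
    (((Complex.continuous_conj.tendsto _).comp (h.tendsto_PiFun z)).congr fun t => ?_)
  rw [Function.comp_apply, ← annealed_conj μ (f := id) (fun _ => rfl)]
  simp

lemma OffspringLaws.conj_truncInv (h : OffspringLaws μ P E) (x T : ℝ) :
    starRingEnd ℂ (truncInv (PiFun μ P E) x T) = truncInv (PiFun μ P E) x T := by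
  rw [truncInv, map_mul, ← intervalIntegral.intervalIntegral_conj]
  have hneg := intervalIntegral.integral_comp_neg (a := -T) (b := T)
    (fun y : ℝ => PiFun μ P E (y * Complex.I) * Complex.exp (y * Complex.I * x))
  rw [neg_neg] at hneg
  rw [← hneg]
  congr 1
  · rw [map_div₀, map_one, map_mul, Complex.conj_ofReal, map_ofNat]
  · refine intervalIntegral.integral_congr fun y _ => ?_
    rw [map_mul, ← h.PiFun_conj, ← Complex.exp_conj]
    simp

/-- The limit of the inversion integrals on the imaginary axis is real, so it is the density. -/
lemma OffspringLaws.density_eq (h : OffspringLaws μ P E) {x : ℝ} {l : ℂ}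
    (hl : Tendsto (truncInv (PiFun μ P E) x) atTop (𝓝 l)) : (density μ P E x : ℂ) = l := by
  have hl' : Tendsto (inversionIntegral μ P E 0 x) atTop (𝓝 l) :=
    hl.congr fun T => (inversionIntegral_zero x T).symm
  rw [density, hl'.limUnder_eq]
  refine Complex.conj_eq_iff_re.1 (tendsto_nhds_unique
    (((Complex.continuous_conj.tendsto _).comp hl).congr fun T => ?_) hl)
  exact h.conj_truncInv x T

lemma IsOffspringFamily.PiFun_eq_integral (hξ : IsOffspringFamily μ P ℙ env ξ)
    (h : OffspringLaws μ P E) {z : ℂ} (hz : 0 ≤ z.re) :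
    PiFun μ P E z = ∫ ω, Complex.exp (-z * martingaleLimit E ξ ω) ∂ℙ := by
  have hpos : ∀ z : ℂ, 0 < z.re →
      PiFun μ P E z = ∫ ω, Complex.exp (-z * martingaleLimit E ξ ω) ∂ℙ := fun z hz =>
    tendsto_nhds_unique (h.tendsto_PiFun z) (hξ.tendsto_annealed_id h hz)
  set δ : ℕ → ℂ := fun n => z + ((1 / ((n : ℝ) + 1) : ℝ) : ℂ) with hδ
  have hδre : ∀ n, 0 < (δ n).re := fun n => by
    have : 0 < 1 / ((n : ℝ) + 1) := by positivity
    simp only [hδ, Complex.add_re, Complex.ofReal_re]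
    linarith
  have hδlim : Tendsto δ atTop (𝓝 z) := by
    have := ((Complex.continuous_ofReal.tendsto 0).comp
      (tendsto_one_div_add_atTop_nhds_zero_nat (𝕜 := ℝ))).const_add z
    simpa [hδ] using this
  have h1 := (h.differentiable_PiFun.continuous.tendsto z).comp hδlim
  refine tendsto_nhds_unique h1 ?_
  have h2 : Tendsto (fun n => ∫ ω, Complex.exp (-δ n * martingaleLimit E ξ ω) ∂ℙ) atTop
      (𝓝 (∫ ω, Complex.exp (-z * martingaleLimit E ξ ω) ∂ℙ)) := by
    have hmeas := hξ.aemeasurable_martingaleLimit h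
    refine tendsto_integral_of_dominated_convergence (fun _ => 1) (fun n => ?_)
      (integrable_const 1) (fun n => ?_) (ae_of_all _ fun ω => ?_)
    · exact (Complex.measurable_exp.comp_aemeasurable
        ((Complex.measurable_ofReal.comp_aemeasurable hmeas).const_mul _)).aestronglyMeasurable
    · filter_upwards [hξ.ae_martingaleLimit_nonneg h] with ω hω
      rw [Complex.norm_exp, Complex.re_mul_ofReal, Complex.neg_re]
      exact Real.exp_le_one_iff.2 (by nlinarith [hδre n])
    · exact (((hδlim.neg).mul_const _).cexp)
  exact h2.congr fun n => (hpos _ (hδre n)).symm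

/-- The martingale limit is positive, since its Laplace transform vanishes at infinity. -/
lemma IsOffspringFamily.map_martingaleLimit_Iic_zero (hξ : IsOffspringFamily μ P ℙ env ξ)
    (h : OffspringLaws μ P E) {φ' : ℝ} (hφ' : 0 < φ')
    (hdec : VanishesInSector (PiFun μ P E) φ') :
    (ℙ.map (martingaleLimit E ξ)) (Set.Iic 0) = 0 := by
  have hmeas := hξ.aemeasurable_martingaleLimit h
  rw [Measure.map_apply_of_aemeasurable hmeas measurableSet_Iic]
  set S := martingaleLimit E ξ ⁻¹' Set.Iic 0 with hS
  have hSn : NullMeasurableSet S ℙ := hmeas.nullMeasurableSet_preimage measurableSet_Iic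
  suffices hle : ∀ ρ > 0, ℙ.real S ≤ ρ by
    have : ℙ.real S = 0 := le_antisymm (le_of_forall_gt_imp_ge_of_dense hle) measureReal_nonneg
    rwa [measureReal_eq_zero_iff] at this
  intro ρ hρ
  obtain ⟨M, hM, hbound⟩ := hdec ρ hρ
  have hlam : ((M + 1 : ℝ) : ℂ) ∈ sector φ' M := by
    refine ⟨?_, ?_⟩
    · rw [Complex.norm_real, Real.norm_of_nonneg (by linarith)]; linarith
    · rw [Complex.arg_ofReal_of_nonneg (by linarith), abs_zero]; exact hφ'
  have hb := hbound _ hlam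
  rw [hξ.PiFun_eq_integral h (by simp; linarith)] at hb
  have hreal : ∫ ω, Complex.exp (-((M + 1 : ℝ) : ℂ) * martingaleLimit E ξ ω) ∂ℙ =
      ((∫ ω, Real.exp (-(M + 1) * martingaleLimit E ξ ω) ∂ℙ : ℝ) : ℂ) := by
    rw [← integral_complex_ofReal]
    refine integral_congr_ae (ae_of_all _ fun ω => ?_)
    simp only
    push_cast
    rfl
  rw [hreal, Complex.norm_real] at hb
  refine le_trans ?_ ((le_abs_self _).trans hb)
  have hint : Integrable (fun ω => Real.exp (-(M + 1) * martingaleLimit E ξ ω)) ℙ := by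
    refine Integrable.of_bound (C := 1) (Real.measurable_exp.comp_aemeasurable
      (hmeas.const_mul _)).aestronglyMeasurable ?_
    filter_upwards [hξ.ae_martingaleLimit_nonneg h] with ω hω
    rw [Real.norm_of_nonneg (Real.exp_pos _).le]
    exact Real.exp_le_one_iff.2 (by nlinarith)
  calc ℙ.real S = ∫ ω in S, (1 : ℝ) ∂ℙ := by simp
    _ ≤ ∫ ω in S, Real.exp (-(M + 1) * martingaleLimit E ξ ω) ∂ℙ := by
        refine setIntegral_mono_on₀ (integrable_const _).integrableOn hint.integrableOn hSn ?_
        intro ω hω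
        have : martingaleLimit E ξ ω ≤ 0 := hω
        exact Real.one_le_exp (by nlinarith)
    _ ≤ _ := setIntegral_le_integral hint (ae_of_all _ fun ω => (Real.exp_pos _).le)

/-- The law of the martingale limit, from inversion integrals that are shifted to the rays. -/
lemma IsOffspringFamily.law_martingaleLimit (hξ : IsOffspringFamily μ P ℙ env ξ)
    (h : OffspringLaws μ P E) {φ φ' a : ℝ} (h1 : Real.pi / 2 < φ) (h2 : φ < Real.pi)
    (hφ : φ < φ') (ha : 0 < a) (hdec : VanishesInSector (PiFun μ P E) φ')
    (hone : ∀ θ s, |θ| = φ → 0 < s → ‖PiFun μ P E (rayPoint a θ s)‖ ≤ 1) :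
    (∀ x : ℝ, 0 < x → (density μ P E x : ℂ) =
      loopIntegral (fun z => PiFun μ P E z * Complex.exp (z * x)) a φ) ∧
    (∀ x : ℝ, 0 < x → 0 ≤ density μ P E x) ∧
    ℙ.map (martingaleLimit E ξ) =
      (volume.restrict (Set.Ioi 0)).withDensity fun x => ENNReal.ofReal (density μ P E x) := by
  have hd := h.differentiable_PiFun
  have hmeas := hξ.aemeasurable_martingaleLimit h
  have hpi := Real.pi_pos
  have hloop : ∀ x : ℝ, 0 < x → Tendsto (truncInv (PiFun μ P E) x) atTop
      (𝓝 (loopIntegral (fun z => PiFun μ P E z * Complex.exp (z * x)) a φ)) := fun x hx =>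
    (tendsto_vertical h1 h2 hd hφ hdec hx ha hone 0).congr fun T => by simp [truncInv]
  have hden : ∀ x : ℝ, 0 < x → (density μ P E x : ℂ) =
      loopIntegral (fun z => PiFun μ P E z * Complex.exp (z * x)) a φ := fun x hx =>
    h.density_eq (hloop x hx)
  have hcont : ContinuousOn (density μ P E) (Set.Ioi 0) := by
    refine (Complex.continuous_re.comp_continuousOn
      (continuousOn_loopIntegral h1 h2 hd hone ha)).congr fun x hx => ?_
    rw [Function.comp_apply, ← hden x hx, Complex.ofReal_re]
  have : IsProbabilityMeasure (ℙ.map (martingaleLimit E ξ)) :=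
    Measure.isProbabilityMeasure_map hmeas
  have hν : ∀ y : ℝ, PiFun μ P E (y * Complex.I) =
      ∫ v : ℝ, Complex.exp (-(y * Complex.I * v)) ∂(ℙ.map (martingaleLimit E ξ)) := fun y => by
    rw [integral_map hmeas (Continuous.aestronglyMeasurable (by fun_prop)),
      hξ.PiFun_eq_integral h (by simp)]
    simp only [neg_mul]
  obtain ⟨C, T₀, hC⟩ := exists_norm_vertical_le h1 h2 hd hφ hdec ha hone
  have hbump : ∀ (c : ℝ) (g : ContDiffBump c), g.rOut < c →
      ∫ v, g v ∂(ℙ.map (martingaleLimit E ξ)) = ∫ v, g v * density μ P E v := by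
    intro c g hg
    have hs : ∀ x ∈ Metric.closedBall c g.rOut, c - g.rOut ≤ x ∧ x ≤ c + g.rOut := fun x hx => by
      rwa [Real.closedBall_eq_Icc] at hx
    have hpos : ∀ x ∈ Metric.closedBall c g.rOut, 0 < x := fun x hx => by
      linarith [(hs x hx).1]
    have hgc : HasCompactSupport fun v => ((g v : ℝ) : ℂ) :=
      g.hasCompactSupport.comp_left Complex.ofReal_zero
    have key := integral_eq_integral_mul_of_tendsto_truncInv (p := fun x => (density μ P E x : ℂ))
      hd.continuous hν (Complex.ofRealCLM.contDiff.comp g.contDiff) hgc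
      (s := Metric.closedBall c g.rOut) (fun x hx => by
        have : g x = 0 := g.zero_of_le_dist (not_le.1 hx).le
        simp [this])
      (fun x hx => by rw [hden x (hpos x hx)]; exact hloop x (hpos x hx))
      (B := 1 / (2 * Real.pi) * (|C| * Real.exp (a * (c + g.rOut)) / (c - g.rOut))) (T₀ := T₀)
      (fun x hx T hT => ?_)
    · simp only [Function.comp_apply, Complex.ofRealCLM_apply, ← Complex.ofReal_mul] at key
      rw [integral_complex_ofReal, integral_complex_ofReal] at key
      exact_mod_cast key
    · have hx0 := hpos x hx
      have hCx := hC x T hx0 hT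
      simp only [Complex.ofReal_zero, zero_add] at hCx
      rw [truncInv, norm_mul]
      have e : ‖(1 / (2 * (Real.pi : ℂ)))‖ = 1 / (2 * Real.pi) := by
        simp [abs_of_pos hpi]
      rw [e]
      refine mul_le_mul_of_nonneg_left (hCx.trans ?_) (by positivity)
      have hlow : 0 < c - g.rOut := by linarith
      refine div_le_div₀ (by positivity) ?_ hlow (hs x hx).1
      refine mul_le_mul (le_abs_self C) (Real.exp_le_exp.2 ?_) (Real.exp_pos _).le (abs_nonneg _)
      exact mul_le_mul_of_nonneg_left (hs x hx).2 ha.le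
  refine ⟨hden, fun x hx => nonneg_of_integral_bump hcont hbump hx,
    eq_withDensity_of_integral_bump (hξ.map_martingaleLimit_Iic_zero h (by linarith) hdec)
      hcont hbump⟩

end Density

section Periodicity

variable {R Ω : Type*} [MeasurableSpace R] [MeasurableSpace Ω]

lemma ATerm_add_one (μ : Measure R) (P : R → Polynomial ℝ) (E : ℝ) (ℙ : Measure Ω)
    (ξ : ℕ → ℕ → Ω → ℕ) (j : ℕ) (x : ℝ) (n : ℤ) :
    ATerm μ P E ℙ ξ j (x + 1) n = ATerm μ P E ℙ ξ j x n := by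
  have e : (2 * Real.pi * Complex.I * n * ((x + 1 : ℝ) : ℂ)) =
      2 * Real.pi * Complex.I * n * x + n * (2 * Real.pi * Complex.I) := by
    push_cast
    ring
  rw [ATerm, ATerm, e, Complex.exp_add, Complex.exp_int_mul_two_pi_mul_I, mul_one]

lemma periodic_A (μ : Measure R) (P : R → Polynomial ℝ) (E : ℝ) (ℙ : Measure Ω)
    (ξ : ℕ → ℕ → Ω → ℕ) (j : ℕ) : Function.Periodic (A μ P E ℙ ξ j) 1 := fun x =>
  tsum_congr fun n => ATerm_add_one μ P E ℙ ξ j x n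

end Periodicity

end GWRE

theorem mainTheorem1 {R Ω : Type*} [Finite R] [MeasurableSpace R] [MeasurableSingletonClass R]
    [MeasurableSpace Ω]
    (μ : Measure R) [IsProbabilityMeasure μ] (P : R → Polynomial ℝ) (E : ℝ)
    (ℙ : Measure Ω) [IsProbabilityMeasure ℙ] (env : ℕ → Ω → R) (ξ : ℕ → ℕ → Ω → ℕ)
    -- offspring generating functions: non-trivial, no extinction, common mean
    (hP_nonneg : ∀ r k, 0 ≤ (P r).coeff k) (hP_one : ∀ r, (P r).eval 1 = 1)
    (hP_zero : ∀ r, (P r).coeff 0 = 0) (hP_nontrivial : ∀ r, P r ≠ Polynomial.X)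
    (hE : ∀ r, (Polynomial.derivative (P r)).eval 1 = E)
    -- the Schröder case
    (hq : 0 < GWRE.q μ P 1)
    -- the offspring numbers of the branching process in the random environment
    (hξ : GWRE.IsOffspringFamily μ P ℙ env ξ)
    (hangle : Real.pi < GWRE.criticalAngle P)
    -- the pseudo-inverse series converges to `z` in a disk
    (hinv : ∃ ρ > 0, ∀ z : ℂ, ‖z‖ < ρ →
      Tendsto (fun J : ℕ => ∑ j ∈ Finset.Icc 1 J, (GWRE.bCoeff ℙ ξ j : ℂ) * GWRE.Phi ℙ ξ j z)
        atTop (𝓝 z)) :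
    -- the limits in the definitions exist
    (∀ᵐ ω ∂ℙ, Tendsto (fun t : ℕ => (GWRE.population ξ 1 t ω : ℝ) / E ^ t) atTop
      (𝓝 (GWRE.martingaleLimit E ξ ω))) ∧
    (∀ n j : ℕ, 1 ≤ j →
      Tendsto (GWRE.rareRatio ℙ ξ n j) atTop (𝓝 (GWRE.phi ℙ ξ n j))) ∧
    (∀ z : ℂ, Tendsto (fun t : ℕ => GWRE.annealed μ P id t (1 - z / (E : ℂ) ^ t)) atTop
      (𝓝 (GWRE.PiFun μ P E z))) ∧
    (∀ ε x : ℝ, 0 ≤ ε → 0 < x →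
      Tendsto (GWRE.inversionIntegral μ P E ε x) atTop (𝓝 (GWRE.density μ P E x : ℂ))) ∧
    -- `p` is the density of the martingale limit
    (∀ x : ℝ, 0 < x → 0 ≤ GWRE.density μ P E x) ∧
    ℙ.map (GWRE.martingaleLimit E ξ) =
      (volume.restrict (Set.Ioi 0)).withDensity
        (fun x => ENNReal.ofReal (GWRE.density μ P E x)) ∧
    -- `K_j`, its multiplicative periodicity and expansion, and `A_j`
    (∀ j : ℕ, 1 ≤ j →
      (∀ z : ℂ, ‖z‖ < 1 →
        Summable fun n : ℕ => (GWRE.phi ℙ ξ (j + n) j : ℂ) * z ^ (j + n)) ∧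
      (∀ z : ℂ, 0 < z.re →
        Tendsto (GWRE.KApprox μ P E ℙ ξ j z) atTop (𝓝 (GWRE.K μ P E ℙ ξ j z)) ∧
        GWRE.K μ P E ℙ ξ j (E * z) = GWRE.q μ P j * GWRE.K μ P E ℙ ξ j z ∧
        HasSum (fun n : ℤ => GWRE.LCoeff μ P E ℙ ξ n j * z ^ GWRE.expo μ P E j n)
          (GWRE.K μ P E ℙ ξ j z)) ∧
      (∀ x : ℝ, Summable (GWRE.ATerm μ P E ℙ ξ j x)) ∧
      Function.Periodic (GWRE.A μ P E ℙ ξ j) 1) ∧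
    -- the expansion of the density
    (∀ x : ℝ, 0 < x →
      HasSum
        (fun j : ℕ => (GWRE.bCoeff ℙ ξ (j + 1) : ℂ) *
          ((x ^ (-1 - Real.logb E (GWRE.q μ P (j + 1))) : ℝ) : ℂ) *
          GWRE.A μ P E ℙ ξ (j + 1) (-Real.logb E x))
        (GWRE.density μ P E x : ℂ)) := by
  cases nonempty_fintype R
  have h : GWRE.OffspringLaws μ P E := ⟨hP_nonneg, hP_one, hP_zero, hP_nontrivial, hE, hq⟩
  obtain ⟨φ, φ', a, h1, h2, hφ, ha, hdec, hone, hK, hexp⟩ :=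
    hξ.exists_loop_expansion h hangle hinv
  obtain ⟨hden, hnonneg, hlaw⟩ := hξ.law_martingaleLimit h h1 h2 hφ ha hdec hone
  refine ⟨hξ.ae_tendsto_martingaleLimit h, fun n j _ => hξ.tendsto_rareRatio h n j,
    h.tendsto_PiFun, fun ε x _ hx => ?_, hnonneg, hlaw, fun j hj => ⟨fun z hz => ?_,
    (hK j hj).1, (hK j hj).2, GWRE.periodic_A μ P E ℙ ξ j⟩, fun x hx => ?_⟩
  · rw [hden x hx]
    exact GWRE.tendsto_vertical h1 h2 h.differentiable_PiFun hφ hdec hx ha hone ε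
  · exact hξ.summable_phi h j hz
  · rw [hden x hx]
    exact hexp x hx
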